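/- **Definitions.** For $r,m\ge 1$ let $\lambda_m\colon \mathrm{Spin}(m)\to \mathrm{SO}(m)$ be the standard double covering, $\mathrm{Spin}^r(m)=(\mathrm{Spin}(m)\times \mathrm{Spin}(r))/\langle(-1,-1)\rangle$, and let $\lambda^r_m\colon \mathrm{Spin}^r(m)\to \mathrm{SO}(m)$ and $\xi^r_m\colon \mathrm{Spin}^r(m)\to \mathrm{SO}(r)$ be the homomorphisms $[\mu,\nu]\mapsto\lambda_m(\mu)$ and $[\mu,\nu]\mapsto \lambda_r(\nu)$. Let $M$ be an oriented Riemannian $m$-manifold with positively oriented orthonormal frame bundle $FM$. A *spin$^r$ structure* on $M$ is a smooth principal $\mathrm{Spin}^r(m)$-bundle $P\to M$ with a smooth bundle map $\Phi\colon P\to FM$ over $\mathrm{id}_M$ such that $\Phi(p\cdot k)=\Phi(p)\cdot\lambda^r_m(k)$. If a Lie group $G$ acts smoothly on $M$ by orientation-preserving isometries, the structure is *$G$-invariant* if it is equipped with a smooth left action of $G$ on $P$ that commutes with the right action of $\mathrm{Spin}^r(m)$ and makes $\Phi$ $G$-equivariant. Two $G$-invariant spin$^r$ structures are *$G$-equivariantly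 equivalent* if there is a diffeomorphism $f\colon P_1\to P_2$ that is equivariant for $G$ and for $\mathrm{Spin}^r(m)$ and satisfies $\Phi_2\circ f=\Phi_1$. The *$G$-invariant spin type* $\Sigma(M,G)$ is the least $r\ge 1$ such that $M$ admits a $G$-invariant spin$^r$ structure. For $x\in M$ with isotropy group $H\subseteq G$, a $G$-invariant spin$^r$ structure *corresponds* to a homomorphism $\varphi\colon H\to \mathrm{SO}(r)$ if for some $p_0\in P$ over $x$ the homomorphism $\tilde\sigma\colon H\to \mathrm{Spin}^r(m)$ defined by $h\cdot p_0=p_0\cdot\tilde\sigma(h)$ satisfies $\xi^r_m\circ\tilde\sigma=\varphi$. A spin$^{\mathbb H}$ structure is a spin$^3$ structure. Let $\mathrm{Sp}(k)\cdot \mathrm{Sp}(1)=(\mathrm{Sp}(k)\times \mathrm{Sp}(1))/\{\pm(1,1)\}$ act on $\mathbb H^{k}$ by $[A,q]\cdot v=Avq^{-1}$, and hence on the unit sphere $S^{4k-1}\subset\mathbb H^k$ with its round metric and either orientation. Let $\lambda_3\colon \mathrm{Sp}(1)\to \mathrm{SO}(3)$ be the double covering given by $\lambda_3(q)x=qxq^{-1}$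 on $\operatorname{Im}\mathbb H\cong\mathbb R^3$. **Theorem.** For every integer $n\ge 0$ the $\mathrm{Sp}(2n+1)\cdot \mathrm{Sp}(1)$-invariant spin type of $S^{8n+3}$ is $3$. Hence, for every $n\ge 0$, $$\Sigma\bigl(S^{4n+3},\mathrm{Sp}(n+1)\cdot \mathrm{Sp}(1)\bigr)=\begin{cases}1,& n\text{ odd},\\ 3,& n\text{ even}.\end{cases}$$ Moreover, for every $n\ge 0$ there is, up to equivariant equivalence, a unique $\mathrm{Sp}(2n+1)\cdot \mathrm{Sp}(1)$-invariant spin$^{\mathbb H}$ structure on $S^{8n+3}$. It corresponds, at every point $x\in S^{8n+3}$, to the restriction to the isotropy group of $x$ of the homomorphism $\mathrm{Sp}(2n+1)\cdot \mathrm{Sp}(1)\to \mathrm{SO}(3)$, $[A,q]\mapsto\lambda_3(q)$; in particular, on the isotropy group $\mathrm{Sp}(2n)\cdot \mathrm{Sp}(1)=\{[\mathrm{diag}(q,A),q]\}$ of the first basis vector, it corresponds to $[A,q]\mapsto\lambda_3(q)$. -/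

import Mathlib

noncomputable section

namespace SphereSpin

open Diffeology CliffordAlgebra
open scoped ContDiff Quaternion

/-! ### Smooth structures

All smooth structures below are diffeologies: `X` is described by the smooth maps `ℝᵈ → X`, and a
map is smooth if it preserves these.  Smooth manifolds form a full subcategory, in which closed
subgroups of matrix groups (embedded submanifolds) carry the subspace diffeology, quotients of Lie
groups by closed subgroups the quotient diffeology, and products the product diffeology.  Hence for
all the spaces below `DSmooth` is smoothness in the usual sense. -/

/-- The subspace (pull-back) diffeology: `p` is smooth if and only if `f ∘ p` is. -/
@[reducible]
def inducedDiffeology {X Y : Type*} [DiffeologicalSpace Y] (f : X → Y) :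
    DiffeologicalSpace X where
  plots _ := {p | IsPlot (f ∘ p)}
  constant_plots _ := isPlot_const
  plot_reparam hp hf := by
    exact isPlot_reparam (X := Y) hp hf
  locality {n p} hp := DiffeologicalSpace.locality (p := f ∘ p) fun x => by
    obtain ⟨u, hu, hxu, h⟩ := hp x
    exact ⟨u, hu, hxu, fun {m g} hg hg' => h hg hg'⟩

/-- The smooth structure of a finite-dimensional real vector space: a map into it is smooth if
and only if all its coordinates, equivalently all linear functionals of it, are smooth. -/
@[reducible]
def linearDiffeology (E : Type*) [AddCommGroup E] [Module ℝ E] : DiffeologicalSpace E :=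
  ⨅ f : E →ₗ[ℝ] ℝ, inducedDiffeology f

instance {X : Type*} [DiffeologicalSpace X] (p : X → Prop) : DiffeologicalSpace (Subtype p) :=
  inducedDiffeology Subtype.val

instance {X Y : Type*} [DiffeologicalSpace X] [DiffeologicalSpace Y] :
    DiffeologicalSpace (X × Y) :=
  inducedDiffeology Prod.fst ⊓ inducedDiffeology Prod.snd

/-- The quotient diffeology: the finest one for which the projection is smooth. -/
instance {K : Type*} [Group K] [DiffeologicalSpace K] (N : Subgroup K) :
    DiffeologicalSpace (K ⧸ N) :=
  sInf {d | @DSmooth K (K ⧸ N) _ d (fun k => (k : K ⧸ N))}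

/-! ### The groups `Spin(n)` and `Spinʳ(n)` -/

/-- The quadratic form `x₁² + ⋯ + xₙ²` on `ℝⁿ`. -/
def euclideanForm (n : ℕ) : QuadraticForm ℝ (Fin n → ℝ) :=
  QuadraticMap.weightedSumSquares ℝ fun _ : Fin n => (1 : ℝ)

lemma euclideanForm_apply {n : ℕ} (v : Fin n → ℝ) : euclideanForm n v = v ⬝ᵥ v := by
  simp [euclideanForm, QuadraticMap.weightedSumSquares_apply, dotProduct]

lemma euclideanForm_polar {n : ℕ} (v w : Fin n → ℝ) :
    QuadraticMap.polar (euclideanForm n) v w = 2 * (v ⬝ᵥ w) := by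
  simp only [QuadraticMap.polar, euclideanForm_apply, add_dotProduct, dotProduct_add]
  rw [dotProduct_comm w v]; ring

/-- The Clifford algebra of Euclidean `ℝⁿ`. -/
abbrev Cl (n : ℕ) : Type := CliffordAlgebra (euclideanForm n)

instance (n : ℕ) : DiffeologicalSpace (Cl n) := linearDiffeology (Cl n)

/-- The group `Spin(n)`: even unit-norm products of vectors in the Clifford algebra. -/
abbrev Spin (n : ℕ) : Type := spinGroup (euclideanForm n)

lemma ι_inj (n : ℕ) : Function.Injective (ι (euclideanForm n)) := by
  intro a b h
  have := congrArg (equivExterior (euclideanForm n)) h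
  simp only [equivExterior, changeFormEquiv_apply, changeForm_ι] at this
  exact (ExteriorAlgebra.ι_leftInverse (R := ℝ)).injective this

instance (n : ℕ) : Nontrivial (Cl n) := (equivExterior (euclideanForm n)).nontrivial

lemma algebraMap_inj (n : ℕ) : Function.Injective (algebraMap ℝ (Cl n)) :=
  FaithfulSMul.algebraMap_injective ℝ _

lemma exists_adjoint {n : ℕ} (x : (Cl n)ˣ) (hx : x ∈ lipschitzGroup (euclideanForm n)) :
    ∃ T : (Fin n → ℝ) →ₗ[ℝ] (Fin n → ℝ),
      (∀ v, ι (euclideanForm n) (T v) =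
        involute (x : Cl n) * ι (euclideanForm n) v * (x⁻¹ : (Cl n)ˣ)) ∧
      (((x : Cl n) ∈ evenOdd (euclideanForm n) 0 ∧ LinearMap.det T = 1) ∨
        ((x : Cl n) ∈ evenOdd (euclideanForm n) 1 ∧ LinearMap.det T = -1)) := by
  have key : ∀ (y : (Cl n)ˣ) (a : Fin n → ℝ), ι (euclideanForm n) a = y →
      ∃ T : (Fin n → ℝ) →ₗ[ℝ] (Fin n → ℝ),
      (∀ v, ι (euclideanForm n) (T v) =
        involute (y : Cl n) * ι (euclideanForm n) v * (y⁻¹ : (Cl n)ˣ)) ∧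
      (((y : Cl n) ∈ evenOdd (euclideanForm n) 0 ∧ LinearMap.det T = 1) ∨
        ((y : Cl n) ∈ evenOdd (euclideanForm n) 1 ∧ LinearMap.det T = -1)) := by
    intro y a ha
    let := y.invertible
    let : Invertible (ι (euclideanForm n) a) := by rwa [ha]
    let : Invertible (euclideanForm n a) := invertibleOfInvertibleι _ a
    have hne : (euclideanForm n a) ≠ 0 := (isUnit_of_invertible (euclideanForm n a)).ne_zero
    refine ⟨Matrix.toLin' (1 + Matrix.replicateCol Unit (-(2 / euclideanForm n a) • a) *
      Matrix.replicateRow Unit a), ?_, Or.inr ⟨?_, ?_⟩⟩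
    · intro v
      simp_rw [← invOf_units y, ← ha, involute_ι, neg_mul, ι_mul_ι_mul_invOf_ι _ a v, ← map_neg]
      congr 1
      rw [euclideanForm_polar, Matrix.toLin'_apply, Matrix.add_mulVec, Matrix.one_mulVec]
      rw [← Matrix.vecMulVec_eq, Matrix.vecMulVec_mulVec]
      ext i
      simp only [Pi.add_apply, Pi.smul_apply, Pi.neg_apply, Pi.sub_apply, smul_eq_mul,
        MulOpposite.smul_eq_mul_unop, MulOpposite.unop_op, invOf_eq_inv]
      ring
    · rw [← ha]; exact ι_mem_evenOdd_one _ _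
    · rw [LinearMap.det_toLin', Matrix.det_one_add_replicateCol_mul_replicateRow, dotProduct_smul,
        ← euclideanForm_apply]
      simp only [smul_eq_mul]
      field_simp
      norm_num
  unfold lipschitzGroup at hx
  induction hx using Subgroup.closure_induction'' with
  | mem x hx => obtain ⟨a, ha⟩ := hx; exact key x a ha
  | inv_mem x hx =>
    obtain ⟨a, ha⟩ := hx
    let := x.invertible
    let : Invertible (ι (euclideanForm n) a) := by rwa [ha]
    let : Invertible (euclideanForm n a) := invertibleOfInvertibleι _ a
    refine key x⁻¹ (⅟(euclideanForm n a) • a) ?_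
    rw [← invOf_ι, ← invOf_units x]
    exact invertible_unique _ _ ha
  | one =>
    refine ⟨LinearMap.id, fun v => by simp, Or.inl ⟨?_, by simp⟩⟩
    exact SetLike.one_mem_graded _
  | mul y z _ _ hy hz =>
    obtain ⟨S, hS, hS'⟩ := hy
    obtain ⟨T, hT, hT'⟩ := hz
    refine ⟨S ∘ₗ T, fun v => ?_, ?_⟩
    · simp only [LinearMap.comp_apply, hS, hT, Units.val_mul, map_mul, mul_inv_rev, mul_assoc]
    · rw [LinearMap.det_comp, Units.val_mul]
      rcases hS' with ⟨h1, h2⟩ | ⟨h1, h2⟩ <;> rcases hT' with ⟨h3, h4⟩ | ⟨h3, h4⟩ <;> rw [h2, h4]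
      · exact Or.inl ⟨by simpa using SetLike.mul_mem_graded h1 h3, by simp⟩
      · exact Or.inr ⟨by simpa using SetLike.mul_mem_graded h1 h3, by simp⟩
      · exact Or.inr ⟨by simpa using SetLike.mul_mem_graded h1 h3, by simp⟩
      · refine Or.inl ⟨?_, by simp⟩
        have h := SetLike.mul_mem_graded h1 h3
        rwa [show (1 : ZMod 2) + 1 = 0 from rfl] at h


lemma spin_conj_mem {n : ℕ} (x : Spin n) (v : Fin n → ℝ) :
    (x : Cl n) * (ι (euclideanForm n) v * star (x : Cl n)) ∈
      LinearMap.range (ι (euclideanForm n)) := by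
  rw [← mul_assoc]
  exact spinGroup.conjAct_smul_ι_mem_range_ι (x := spinGroup.toUnits x) x.2 v

/-- The linear map `v ↦ x v x⁻¹` of `ℝⁿ`, for `x ∈ Spin(n)` (whose inverse is `star x`). -/
def spinConj {n : ℕ} (x : Spin n) : (Fin n → ℝ) →ₗ[ℝ] (Fin n → ℝ) :=
  (LinearEquiv.ofInjective (ι (euclideanForm n)) (ι_inj n)).symm.toLinearMap ∘ₗ
    LinearMap.codRestrict (LinearMap.range (ι (euclideanForm n)))
      (LinearMap.mulLeft ℝ (x : Cl n) ∘ₗ LinearMap.mulRight ℝ (star (x : Cl n)) ∘ₗ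
        ι (euclideanForm n)) (spin_conj_mem x)

lemma ι_spinConj {n : ℕ} (x : Spin n) (v : Fin n → ℝ) :
    ι (euclideanForm n) (spinConj x v) =
      (x : Cl n) * (ι (euclideanForm n) v * star (x : Cl n)) := by
  unfold spinConj
  have := congrArg Subtype.val ((LinearEquiv.ofInjective (ι (euclideanForm n))
    (ι_inj n)).apply_symm_apply ⟨_, spin_conj_mem x v⟩)
  exact this

lemma spinConj_mul {n : ℕ} (x y : Spin n) : spinConj (x * y) = spinConj x ∘ₗ spinConj y := by
  ext1 i
  refine LinearMap.ext fun v => ι_inj n ?_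
  simp [ι_spinConj, mul_assoc]

lemma spinConj_dotProduct {n : ℕ} (x : Spin n) (v w : Fin n → ℝ) :
    spinConj x v ⬝ᵥ spinConj x w = v ⬝ᵥ w := by
  have h : ∀ u : Fin n → ℝ, euclideanForm n (spinConj x u) = euclideanForm n u := by
    intro u
    apply algebraMap_inj n
    rw [← ι_sq_scalar, ← ι_sq_scalar, ι_spinConj]
    have hx : star (x : Cl n) * (x : Cl n) = 1 := spinGroup.star_mul_self_of_mem x.2
    have hx' : (x : Cl n) * star (x : Cl n) = 1 := spinGroup.mul_star_self_of_mem x.2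
    calc _ = (x : Cl n) * (ι (euclideanForm n) u * ((star (x : Cl n) * (x : Cl n)) *
          ι (euclideanForm n) u)) * star (x : Cl n) := by simp only [mul_assoc]
      _ = _ := by
        rw [hx, one_mul, ι_sq_scalar, ← Algebra.commutes, mul_assoc, hx', mul_one]
  have h2 : QuadraticMap.polar (euclideanForm n) (spinConj x v) (spinConj x w) =
      QuadraticMap.polar (euclideanForm n) v w := by
    simp only [QuadraticMap.polar, ← map_add, h]
  rw [euclideanForm_polar, euclideanForm_polar] at h2
  linarith

lemma spinConj_transpose_mul {n : ℕ} (x : Spin n) :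
    (LinearMap.toMatrix' (spinConj x)).transpose * LinearMap.toMatrix' (spinConj x) = 1 := by
  ext i j
  have h := spinConj_dotProduct x (Pi.single i 1) (Pi.single j 1)
  rw [Matrix.mul_apply]
  simp only [Matrix.transpose_apply, LinearMap.toMatrix'_apply]
  simpa [dotProduct, Matrix.one_apply, Pi.single_apply, eq_comm] using h

lemma spinConj_det {n : ℕ} (x : Spin n) : LinearMap.det (spinConj x) = 1 := by
  obtain ⟨T, hT, hT'⟩ := exists_adjoint (spinGroup.toUnits x)
    (spinGroup.units_mem_lipschitzGroup x.2)
  have hTx : T = spinConj x := by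
    refine LinearMap.ext fun v => ι_inj n ?_
    rw [hT, ι_spinConj, ← mul_assoc]
    congr 2
    exact spinGroup.involute_eq x.2
  subst hTx
  rcases hT' with ⟨_, h⟩ | ⟨h, _⟩
  · exact h
  · exfalso
    have h0 : (x : Cl n) ∈ evenOdd (euclideanForm n) 0 := spinGroup.mem_even x.2
    have h1 := (Submodule.disjoint_def.1 (evenOdd_isCompl (Q := euclideanForm n)).disjoint) _ h0 h
    have hx : star (x : Cl n) * (x : Cl n) = 1 := spinGroup.star_mul_self_of_mem x.2
    rw [h1, mul_zero] at hx
    exact zero_ne_one hx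

/-- The standard covering `λₙ : Spin(n) → SO(n)`, `λₙ(x) v = x v x⁻¹`. -/
def spinCover (n : ℕ) : Spin n →* Matrix.specialOrthogonalGroup (Fin n) ℝ where
  toFun x := ⟨LinearMap.toMatrix' (spinConj x), by
    rw [Matrix.mem_specialOrthogonalGroup_iff, Matrix.mem_orthogonalGroup_iff',
      LinearMap.det_toMatrix']
    refine ⟨?_, spinConj_det x⟩
    exact spinConj_transpose_mul x⟩
  map_one' := by
    apply Subtype.ext
    have : spinConj (1 : Spin n) = LinearMap.id := by
      refine LinearMap.ext fun v => ι_inj n ?_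
      simp [ι_spinConj]
    simp [this]
  map_mul' x y := by
    apply Subtype.ext
    simp [spinConj_mul, LinearMap.toMatrix'_comp]

/-- The subgroup `ℤ₂ = {(1, 1), (-1, -1)}` of `Spin(n) × Spin(r)`. -/
def spinRCenter (r n : ℕ) : Subgroup (Spin n × Spin r) where
  carrier := {z | ((z.1 : Cl n) = 1 ∧ (z.2 : Cl r) = 1) ∨
    ((z.1 : Cl n) = -1 ∧ (z.2 : Cl r) = -1)}
  one_mem' := Or.inl ⟨rfl, rfl⟩
  mul_mem' := by
    rintro a b (⟨h1, h2⟩ | ⟨h1, h2⟩) (⟨h3, h4⟩ | ⟨h3, h4⟩) <;>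
      simp only [Set.mem_ofPred_eq, Prod.fst_mul, Prod.snd_mul, Submonoid.coe_mul, h1, h2, h3, h4,
        mul_one, mul_neg, neg_neg, and_self, true_or, or_true]
  inv_mem' := by
    rintro a (⟨h1, h2⟩ | ⟨h1, h2⟩)
    · left
      simp [← spinGroup.star_eq_inv, h1, h2]
    · right
      simp [← spinGroup.star_eq_inv, h1, h2]

instance (r n : ℕ) : (spinRCenter r n).Normal where
  conj_mem := by
    rintro a (⟨h1, h2⟩ | ⟨h1, h2⟩) g
    · left
      simp [h1, h2, ← spinGroup.star_eq_inv]
    · right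
      simp [h1, h2, ← spinGroup.star_eq_inv]

/-- `Spinʳ(n) = (Spin(n) × Spin(r)) / ℤ₂`. -/
abbrev SpinR (r n : ℕ) : Type := (Spin n × Spin r) ⧸ spinRCenter r n

lemma spinCover_eq_one {n : ℕ} (x : Spin n) (hx : (x : Cl n) = 1 ∨ (x : Cl n) = -1) :
    spinCover n x = 1 := by
  have : spinConj x = LinearMap.id := by
    refine LinearMap.ext fun v => ι_inj n ?_
    rcases hx with h | h <;> simp [ι_spinConj, h]
  apply Subtype.ext
  simp [spinCover, this]

/-- `λʳₙ : Spinʳ(n) → SO(n)`, `[μ, ν] ↦ λₙ(μ)`. -/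
def spinRCover (r n : ℕ) : SpinR r n →* Matrix.specialOrthogonalGroup (Fin n) ℝ :=
  QuotientGroup.lift (spinRCenter r n) ((spinCover n).comp (MonoidHom.fst _ _)) fun z hz =>
    spinCover_eq_one z.1 (hz.imp And.left And.left)

/-- `ξʳₙ : Spinʳ(n) → SO(r)`, `[μ, ν] ↦ λᵣ(ν)`. -/
def spinRAux (r n : ℕ) : SpinR r n →* Matrix.specialOrthogonalGroup (Fin r) ℝ :=
  QuotientGroup.lift (spinRCenter r n) ((spinCover r).comp (MonoidHom.snd _ _)) fun z hz =>
    spinCover_eq_one z.2 (hz.imp And.right And.right)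

/-! ### The group `Sp(k)·Sp(1)` and its action on `ℍᵏ` -/

/-- The Euclidean space `ℍᵏ`, of real dimension `4k`. -/
abbrev QuatSpace (k : ℕ) : Type := PiLp 2 fun _ : Fin k => ℍ[ℝ]

instance : DiffeologicalSpace ℍ[ℝ] := linearDiffeology _
instance (k : ℕ) : DiffeologicalSpace (QuatSpace k) := linearDiffeology _
instance (k : ℕ) : DiffeologicalSpace (Matrix (Fin k) (Fin k) ℍ[ℝ]) := linearDiffeology _


/-- The compact symplectic group `Sp(k)`: quaternionic `k × k` matrices with `A* A = A A* = 1`. -/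
abbrev Sp (k : ℕ) : Type := unitary (Matrix (Fin k) (Fin k) ℍ[ℝ])
/-- The group `Sp(1)` of unit quaternions. -/
abbrev Sp1 : Type := unitary ℍ[ℝ]

/-- The subgroup `{(1, 1), (-1, -1)}` of `Sp(k) × Sp(1)`. -/
def spSpCenter (k : ℕ) : Subgroup (Sp k × Sp1) where
  carrier := {z | z = 1 ∨ z = (-1, -1)}
  one_mem' := Or.inl rfl
  mul_mem' := by
    rintro a b (rfl | rfl) (rfl | rfl) <;> simp
  inv_mem' := by
    rintro a (rfl | rfl)
    · simp
    · right
      rw [inv_eq_iff_mul_eq_one]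
      simp

instance (k : ℕ) : (spSpCenter k).Normal where
  conj_mem := by
    rintro a (rfl | rfl) g
    · left; simp
    · right
      ext1 <;> simp

/-- `Sp(k)·Sp(1) = (Sp(k) × Sp(1)) / {±(1, 1)}`. -/
abbrev SpSp (k : ℕ) : Type := (Sp k × Sp1) ⧸ spSpCenter k

/-- The real linear map `v ↦ A v q⁻¹` of `ℍᵏ` (column vectors; `q⁻¹ = star q`). -/
def spSpLinear {k : ℕ} (z : Sp k × Sp1) : QuatSpace k →ₗ[ℝ] QuatSpace k where
  toFun v := WithLp.toLp 2 fun i => (z.1.1.mulVec v.ofLp) i * star z.2.1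
  map_add' v w := by
    ext1 i
    simp [Matrix.mulVec_add, add_mul]
  map_smul' c v := by
    ext1 i
    simp [Matrix.mulVec_smul]

lemma spSpLinear_mul {k : ℕ} (z w : Sp k × Sp1) (v : QuatSpace k) :
    spSpLinear (z * w) v = spSpLinear z (spSpLinear w v) := by
  ext1 i
  simp only [spSpLinear, LinearMap.coe_mk, AddHom.coe_mk, Prod.fst_mul, Prod.snd_mul,
    Submonoid.coe_mul, star_mul, ← mul_assoc, ← Matrix.mulVec_mulVec]
  congr 1
  simp only [Matrix.mulVec, dotProduct, Finset.sum_mul, mul_assoc]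

lemma norm_spSpLinear {k : ℕ} (z : Sp k × Sp1) (v : QuatSpace k) :
    ‖spSpLinear z v‖ = ‖v‖ := by
  have hq : ‖star z.2.1‖ = 1 := by
    rw [norm_star]
    exact CStarRing.norm_coe_unitary z.2
  have hA : star z.1.1 * z.1.1 = 1 := Unitary.coe_star_mul_self z.1
  have aux : ∀ w : Fin k → ℍ[ℝ], ((∑ i, ‖w i‖ ^ 2 : ℝ) : ℍ[ℝ]) = star w ⬝ᵥ w := by
    intro w
    simp only [dotProduct, Pi.star_apply, Quaternion.star_mul_self]
    simp only [Quaternion.normSq_eq_norm_mul_self, sq]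
    exact map_sum (algebraMap ℝ ℍ[ℝ]) (fun i => ‖w i‖ * ‖w i‖) Finset.univ
  rw [PiLp.norm_eq_of_L2, PiLp.norm_eq_of_L2]
  congr 1
  simp only [spSpLinear, LinearMap.coe_mk, AddHom.coe_mk, norm_mul, hq, mul_one]
  apply Quaternion.coe_injective
  rw [aux, aux, Matrix.star_mulVec, ← Matrix.dotProduct_mulVec, Matrix.mulVec_mulVec,
    ← Matrix.star_eq_conjTranspose, hA, Matrix.one_mulVec]

/-- The action `(A, q) • v = A v q⁻¹` of `Sp(k) × Sp(1)` on `ℍᵏ` by linear isometries. -/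
def spSpIsometry {k : ℕ} : Sp k × Sp1 →* (QuatSpace k ≃ₗᵢ[ℝ] QuatSpace k) where
  toFun z :=
    { toLinearEquiv := LinearEquiv.ofLinearMap (spSpLinear z) (spSpLinear z⁻¹)
        (LinearMap.ext fun v => by
          rw [LinearMap.comp_apply, ← spSpLinear_mul, mul_inv_cancel]
          ext1 i; simp [spSpLinear])
        (LinearMap.ext fun v => by
          rw [LinearMap.comp_apply, ← spSpLinear_mul, inv_mul_cancel]
          ext1 i; simp [spSpLinear])
      norm_map' := norm_spSpLinear z }
  map_one' := by
    ext1 v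
    change spSpLinear 1 v = v
    ext1 i; simp [spSpLinear]
  map_mul' z w := by
    ext1 v
    exact spSpLinear_mul z w v

/-- The standard action `[A, q] • v = A v q⁻¹` of `Sp(k)·Sp(1)` on `ℍᵏ`. -/
def spSpRep (k : ℕ) : SpSp k →* (QuatSpace k ≃ₗᵢ[ℝ] QuatSpace k) :=
  QuotientGroup.lift (spSpCenter k) spSpIsometry <| by
    rintro z (rfl | rfl)
    · exact map_one _
    · ext1 v
      change spSpLinear (-1, -1) v = v
      ext1 i
      change ((-1 : Matrix (Fin k) (Fin k) ℍ[ℝ]).mulVec v.ofLp) i * star (-1 : ℍ[ℝ]) = v i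
      simp [Matrix.neg_mulVec]

/-- Coordinates of the imaginary part of a quaternion in the basis `i, j, k`. -/
def imPart (q : ℍ[ℝ]) : Fin 3 → ℝ := ![q.imI, q.imJ, q.imK]
/-- The imaginary units `i, j, k`. -/
def imUnit : Fin 3 → ℍ[ℝ] := ![⟨0, 1, 0, 0⟩, ⟨0, 0, 1, 0⟩, ⟨0, 0, 0, 1⟩]

/-- The matrix of `x ↦ q x q*` on `Im ℍ` in the basis `i, j, k`. -/
def sp1Matrix (q : ℍ[ℝ]) : Matrix (Fin 3) (Fin 3) ℝ :=
  Matrix.of fun i j => imPart (q * imUnit j * star q) i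

lemma sp1Matrix_eq (q : ℍ[ℝ]) : sp1Matrix q =
    !![q.re ^ 2 + q.imI ^ 2 - q.imJ ^ 2 - q.imK ^ 2, 2 * (q.imI * q.imJ - q.re * q.imK),
        2 * (q.imI * q.imK + q.re * q.imJ);
      2 * (q.imI * q.imJ + q.re * q.imK), q.re ^ 2 - q.imI ^ 2 + q.imJ ^ 2 - q.imK ^ 2,
        2 * (q.imJ * q.imK - q.re * q.imI);
      2 * (q.imI * q.imK - q.re * q.imJ), 2 * (q.imJ * q.imK + q.re * q.imI),
        q.re ^ 2 - q.imI ^ 2 - q.imJ ^ 2 + q.imK ^ 2] := by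
  ext i j
  fin_cases i <;> fin_cases j <;>
    simp [sp1Matrix, imPart, imUnit] <;> ring

lemma sp1Matrix_transpose_mul (q : ℍ[ℝ])
    (h : q.re ^ 2 + q.imI ^ 2 + q.imJ ^ 2 + q.imK ^ 2 = 1) :
    (sp1Matrix q).transpose * sp1Matrix q = 1 := by
  rw [sp1Matrix_eq]
  ext i j
  fin_cases i <;> fin_cases j <;> simp [Matrix.mul_apply, Fin.sum_univ_three] <;>
    first
    | ring1
    | linear_combination (q.re ^ 2 + q.imI ^ 2 + q.imJ ^ 2 + q.imK ^ 2 + 1) * h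

lemma sp1Matrix_det (q : ℍ[ℝ]) (h : q.re ^ 2 + q.imI ^ 2 + q.imJ ^ 2 + q.imK ^ 2 = 1) :
    (sp1Matrix q).det = 1 := by
  rw [sp1Matrix_eq, Matrix.det_fin_three]
  simp
  linear_combination ((q.re ^ 2 + q.imI ^ 2 + q.imJ ^ 2 + q.imK ^ 2) ^ 2 +
    (q.re ^ 2 + q.imI ^ 2 + q.imJ ^ 2 + q.imK ^ 2) + 1) * h

lemma sp1Matrix_mul (p q : ℍ[ℝ]) : sp1Matrix (p * q) = sp1Matrix p * sp1Matrix q := by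
  rw [sp1Matrix_eq, sp1Matrix_eq, sp1Matrix_eq]
  ext i j
  fin_cases i <;> fin_cases j <;> simp [Matrix.mul_apply, Fin.sum_univ_three] <;> ring

lemma sp1Matrix_eq_one {q : ℍ[ℝ]} (hq : q = 1 ∨ q = -1) : sp1Matrix q = 1 := by
  ext i j
  rcases hq with rfl | rfl <;> fin_cases i <;> fin_cases j <;>
    simp [sp1Matrix, imPart, imUnit]

lemma sp1_normSq (q : Sp1) :
    q.1.re ^ 2 + q.1.imI ^ 2 + q.1.imJ ^ 2 + q.1.imK ^ 2 = 1 := by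
  rw [← Quaternion.normSq_def', Quaternion.normSq_eq_norm_mul_self, CStarRing.norm_coe_unitary,
    one_mul]

/-- The standard double covering `λ₃ : Sp(1) → SO(3)`, `q ↦ (x ↦ q x q⁻¹)` on `Im ℍ ≅ ℝ³`. -/
def sp1Cover : Sp1 →* Matrix.specialOrthogonalGroup (Fin 3) ℝ where
  toFun q := ⟨sp1Matrix q, by
    rw [Matrix.mem_specialOrthogonalGroup_iff, Matrix.mem_orthogonalGroup_iff']
    exact ⟨sp1Matrix_transpose_mul _ (sp1_normSq q), sp1Matrix_det _ (sp1_normSq q)⟩⟩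
  map_one' := Subtype.ext (sp1Matrix_eq_one (Or.inl rfl))
  map_mul' p q := Subtype.ext (sp1Matrix_mul p q)

/-- The homomorphism `Sp(k)·Sp(1) → SO(3)`, `[A, q] ↦ λ₃(q)`. -/
def spSpAux (k : ℕ) : SpSp k →* Matrix.specialOrthogonalGroup (Fin 3) ℝ :=
  QuotientGroup.lift (spSpCenter k) (sp1Cover.comp (MonoidHom.snd _ _)) <| by
    rintro z (rfl | rfl)
    · exact map_one _
    · exact Subtype.ext (sp1Matrix_eq_one (Or.inr rfl))

/-! ### Principal bundles, spinʳ structures and invariance -/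

/-- A smooth principal `K`-bundle over `M`, with right action `act p k = p · k`. -/
structure PrincipalBundle (K : Type*) [Group K] [DiffeologicalSpace K]
    (M : Type*) [TopologicalSpace M] [DiffeologicalSpace M] where
  Total : Type
  [diffeology : DiffeologicalSpace Total]
  proj : Total → M
  proj_smooth : DSmooth proj
  act : Total → K → Total
  act_smooth : DSmooth fun x : Total × K => act x.1 x.2
  act_one : ∀ p, act p 1 = p
  act_mul : ∀ p k l, act p (k * l) = act (act p k) l
  proj_act : ∀ p k, proj (act p k) = proj p
  /-- Around every point there is an equivariant diffeomorphism `U × K ≅ proj⁻¹(U)` over `U`. -/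
  locally_trivial : ∀ x : M, ∃ U : Set M, IsOpen U ∧ x ∈ U ∧
    ∃ e : U × K ≃ {p : Total // proj p ∈ U}, DSmooth e ∧ DSmooth e.symm ∧
      (∀ u k, proj (e (u, k)).1 = u) ∧
      (∀ u k l, (e (u, k * l)).1 = act (e (u, k)).1 l)

attribute [instance] PrincipalBundle.diffeology

section Sphere

variable {V : Type*} [NormedAddCommGroup V] [InnerProductSpace ℝ V] [DiffeologicalSpace V] {m : ℕ}

/-- The positively oriented orthonormal frames of the unit sphere `S(V)`, of dimension `m`, in an
oriented Euclidean space `V` of dimension `m + 1`: a point `x ∈ S(V)` and an orthonormal basis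
`e₁, …, eₘ` of `TₓS(V) = x^⊥` such that `x, e₁, …, eₘ` is a positive orthonormal basis of `V`. -/
structure SphereFrame (o : Orientation ℝ V (Fin (m + 1))) where
  base : Metric.sphere (0 : V) 1
  vec : Fin m → V
  positive : ∃ b : OrthonormalBasis (Fin (m + 1)) ℝ V,
    b 0 = base ∧ (∀ i : Fin m, b i.succ = vec i) ∧ b.toBasis.orientation = o

instance (o : Orientation ℝ V (Fin (m + 1))) : DiffeologicalSpace (SphereFrame o) :=
  inducedDiffeology SphereFrame.base ⊓ ⨅ i, inducedDiffeology fun f : SphereFrame o => f.vec i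

/-- A spinʳ structure on the oriented round sphere `S(V)`: a principal `Spinʳ(m)`-bundle `P` with
a bundle map `Φ` to the oriented orthonormal frame bundle, over the identity of `S(V)`, such that
`Φ(p · k) = Φ(p) · λʳₘ(k)`, where `SO(m)` acts on frames by `(e · A)ᵢ = ∑ⱼ Aⱼᵢ eⱼ`. -/
structure SpinRStructure (o : Orientation ℝ V (Fin (m + 1))) (r : ℕ) extends
    PrincipalBundle (SpinR r m) (Metric.sphere (0 : V) 1) where
  Φ : Total → SphereFrame o
  Φ_smooth : DSmooth Φ
  base_Φ : ∀ p, (Φ p).base = proj p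
  Φ_act : ∀ p k i, (Φ (act p k)).vec i = ∑ j, (spinRCover r m k).1 j i • (Φ p).vec j

variable {G : Type*} [Group G] [DiffeologicalSpace G]

/-- A `G`-invariant spinʳ structure on `S(V)`, where `G` acts on `S(V)` through linear isometries
`ρ` of `V`: a spinʳ structure with a smooth action `gact g p = g · p` of `G` on `P` by bundle maps,
for which `Φ` is equivariant; `g` acts on frames by the differential of `ρ g`. -/
structure InvariantSpinRStructure (o : Orientation ℝ V (Fin (m + 1))) (ρ : G →* (V ≃ₗᵢ[ℝ] V))
    (r : ℕ) extends SpinRStructure o r where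
  gact : G → Total → Total
  gact_smooth : DSmooth fun x : G × Total => gact x.1 x.2
  gact_one : ∀ p, gact 1 p = p
  gact_mul : ∀ g h p, gact (g * h) p = gact g (gact h p)
  gact_act : ∀ g p k, gact g (act p k) = act (gact g p) k
  base_Φ_gact : ∀ g p, ((Φ (gact g p)).base : V) = ρ g (Φ p).base
  vec_Φ_gact : ∀ g p i, (Φ (gact g p)).vec i = ρ g ((Φ p).vec i)

namespace InvariantSpinRStructure

variable {o : Orientation ℝ V (Fin (m + 1))} {ρ : G →* (V ≃ₗᵢ[ℝ] V)} {r : ℕ}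

/-- `G`-equivariant equivalence of `G`-invariant spinʳ structures. -/
def Equivalent (S T : InvariantSpinRStructure o ρ r) : Prop :=
  ∃ f : S.Total ≃ T.Total, DSmooth f ∧ DSmooth f.symm ∧
    (∀ p k, f (S.act p k) = T.act (f p) k) ∧
    (∀ g p, f (S.gact g p) = T.gact g (f p)) ∧
    (∀ p, T.Φ (f p) = S.Φ p)

end InvariantSpinRStructure

/-- The isotropy group of the point `x`. -/
def isotropy (ρ : G →* (V ≃ₗᵢ[ℝ] V)) (x : Metric.sphere (0 : V) 1) : Subgroup G where
  carrier := {g | ρ g x = x}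
  one_mem' := by simp
  mul_mem' := by
    intro g h hg hh
    change ρ (g * h) x = x
    rw [map_mul]
    change ρ g (ρ h x) = x
    rw [show ρ h x = (x : V) from hh, show ρ g x = (x : V) from hg]
  inv_mem' := by
    intro g hg
    change ρ g⁻¹ x = x
    rw [map_inv]
    change (ρ g).symm x = x
    rw [LinearIsometryEquiv.symm_apply_eq]
    exact (show ρ g x = (x : V) from hg).symm

/-- The invariant spinʳ structure `S` corresponds to the homomorphism `φ : H → SO(r)`, `H` the
isotropy group of `x`: for some `p₀` in the fibre over `x`, the homomorphism `σ' : H → Spinʳ(m)`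
defined by `h · p₀ = p₀ · σ'(h)` satisfies `ξʳₘ ∘ σ' = φ`.  (Other choices of `p₀` change `φ` by
conjugation in `SO(r)`.) -/
def InvariantSpinRStructure.CorrespondsTo {o : Orientation ℝ V (Fin (m + 1))}
    {ρ : G →* (V ≃ₗᵢ[ℝ] V)} {r : ℕ} (S : InvariantSpinRStructure o ρ r)
    (x : Metric.sphere (0 : V) 1)
    (φ : isotropy ρ x →* Matrix.specialOrthogonalGroup (Fin r) ℝ) : Prop :=
  ∃ p₀ : S.Total, S.proj p₀ = x ∧
    ∀ h : isotropy ρ x, ∃ k : SpinR r m, S.gact h p₀ = S.act p₀ k ∧ spinRAux r m k = φ h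

/-- The `G`-invariant spin type of `S(V)` is `s`: the least `r ≥ 1` for which there is a
`G`-invariant spinʳ structure. -/
def HasInvariantSpinType (o : Orientation ℝ V (Fin (m + 1))) (ρ : G →* (V ≃ₗᵢ[ℝ] V))
    (s : ℕ) : Prop :=
  IsLeast {r : ℕ | 1 ≤ r ∧ Nonempty (InvariantSpinRStructure o ρ r)} s

end Sphere

end SphereSpin

end

/-! Let `k` be the quaternionic dimension and `m + 1 = 4k`, so that Sp(k)·Sp(1) acts transitively on
the sphere of dimension `m`. An invariant spinʳ structure on a homogeneous space is determined by
its isotropy homomorphism, a lift of the isotropy representation to Spinʳ(m). The question is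
therefore how the double cover of SO(4k) behaves over Sp(k) × Sp(1).

The action of Sp(k) × Sp(1) on ℍᵏ lifts to a homomorphism `spSpLift` into Spin(4k), and the lift
sends (-1, -1) to (-1)ᵏ (`spSpLift_neg_one`). For the factor Sp(k) the sign of the lift is fixed by
spinors: the Clifford algebra of ℍᵏ acts on the exterior algebra of ℂ²ᵏ, and exactly one of the two
elements over `A` fixes the vacuum vector 1. This is checked on quaternionic reflections with
parameter i, which generate Sp(k) and are products of two quarter turns. Coordinatewise conjugation
carries the construction over to the right action of Sp(1). The lift of the scalar -1 is a product
of volume elements of quaternionic lines; conjugation reverses the sign of each of the `k` factors,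
and this is the source of (-1)ᵏ.

Existence: a homomorphism κ : Sp(1) → Spin(r) with κ(-1) = (-1)ᵏ makes [`spSpLift`, κ] descend to
Sp(k)·Sp(1) → Spinʳ(m + 1). This group acts from the left on the Spinʳ(m)-bundle Spinʳ(m + 1) → Sᵐ
(`homogeneousStructure`). For even `k` take κ trivial and r = 1; for odd `k` take Sp(1) ≅ Spin(3)
and r = 3.

Lower bound: given any invariant structure, compare its isotropy homomorphism over a basis vector
with `spSpLift`. The quotient is a homomorphism ν from the stabilizer in Sp(k) × Sp(1) to Spin(r)
(`exists_lift_isotropyHom`). Since (-1, -1) is trivial in Sp(k)·Sp(1), for odd `k` it follows that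
ν(-1, -1) = -1. But (-1, -1) is the commutator of the diagonal copies of i and j, while Spin(1) and
Spin(2) are commutative (`isEmpty_of_le_two`).

Uniqueness for r = 3: a smooth homomorphism Sp(1) → SO(3) is trivial or conjugate to the double
covering (`eq_one_or_conj_sp1Cover`, by differentiating at 1). On the diagonal Sp(1) it is not
trivial because ν(-1, -1) = -1. On Sp(k - 1) it is trivial: for odd k > 1 this group contains two
commuting conjugate copies of Sp(1), and if one covered SO(3) the other would be mapped to the
centre of SO(3). Hence ν is conjugate to the projection to Sp(1) (`exists_eq_conj_sp1ToSpin`).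
Moving the point of the fibre by [1, R] removes the conjugation without changing the frame, and
structures with the same frame and isotropy homomorphism at one point are equivalent
(`equivalent_of_isotropyHom`). -/

noncomputable section

namespace SphereSpin

open Diffeology CliffordAlgebra
open scoped ContDiff Quaternion

/-! ### Diffeologies -/

section Diffeologies

variable {X Y Z W : Type*} [DiffeologicalSpace X] [DiffeologicalSpace Y] [DiffeologicalSpace Z]
  [DiffeologicalSpace W]

/-- `p` lifts through `π` to plots, locally on its domain. -/
def LocallyLifts (π : X → Y) {n : ℕ} (p : EuclideanSpace ℝ (Fin n) → Y) : Prop :=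
  ∀ t, ∃ u : Set (EuclideanSpace ℝ (Fin n)), IsOpen u ∧ t ∈ u ∧
    ∀ (d : ℕ) (g : EuclideanSpace ℝ (Fin d) → EuclideanSpace ℝ (Fin n)), (∀ s, g s ∈ u) →
      ContDiff ℝ ∞ g → ∃ q : EuclideanSpace ℝ (Fin d) → X, IsPlot q ∧ ∀ s, π (q s) = p (g s)

/-- A map through which all plots lift locally. -/
def Subduction (π : X → Y) : Prop :=
  ∀ (n : ℕ) (p : EuclideanSpace ℝ (Fin n) → Y), IsPlot p → LocallyLifts π p

lemma isPlot_of_locally {n : ℕ} {p : EuclideanSpace ℝ (Fin n) → X}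
    (h : ∀ t, ∃ u : Set (EuclideanSpace ℝ (Fin n)), IsOpen u ∧ t ∈ u ∧
      ∀ (d : ℕ) (g : EuclideanSpace ℝ (Fin d) → EuclideanSpace ℝ (Fin n)), (∀ s, g s ∈ u) →
        ContDiff ℝ ∞ g → IsPlot (fun s => p (g s))) : IsPlot p :=
  DiffeologicalSpace.locality fun t => by
    obtain ⟨u, hu, ht, hg⟩ := h t
    exact ⟨u, hu, ht, fun hf hf' => hg _ _ hf hf'⟩

lemma _root_.Diffeology.IsPlot.comp_contDiff {n d : ℕ} {p : EuclideanSpace ℝ (Fin n) → X} (hp : IsPlot p)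
    {g : EuclideanSpace ℝ (Fin d) → EuclideanSpace ℝ (Fin n)} (hg : ContDiff ℝ ∞ g) :
    IsPlot fun s => p (g s) :=
  isPlot_reparam hp hg

/-- The locally liftable maps form a diffeology. -/
@[reducible]
def liftDiffeology {T : Type*} (π : X → T) (hπ : Function.Surjective π) :
    DiffeologicalSpace T where
  plots n := {p | ∀ t, ∃ u : Set (EuclideanSpace ℝ (Fin n)), IsOpen u ∧ t ∈ u ∧
    ∀ (d : ℕ) (g : EuclideanSpace ℝ (Fin d) → EuclideanSpace ℝ (Fin n)), (∀ s, g s ∈ u) →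
      ContDiff ℝ ∞ g → ∃ q : EuclideanSpace ℝ (Fin d) → X, IsPlot q ∧ ∀ s, π (q s) = p (g s)}
  constant_plots x t := by
    obtain ⟨y, hy⟩ := hπ x
    exact ⟨Set.univ, isOpen_univ, trivial, fun d g _ _ => ⟨fun _ => y, isPlot_const, fun _ => hy⟩⟩
  plot_reparam {n m p f} hp hf t := by
    obtain ⟨u, hu, ht, h⟩ := hp (f t)
    refine ⟨f ⁻¹' u, hu.preimage hf.continuous, ht, fun d g hg hg' => ?_⟩
    exact h d (f ∘ g) hg (hf.comp hg')
  locality {n p} hp t := by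
    obtain ⟨u, hu, ht, h⟩ := hp t
    -- Plots are defined on all of ℝⁿ, so the hypothesis can only be used after a reparametrization
    -- by a whole Euclidean space. A ball in `u` is diffeomorphic to ℝⁿ by `univBall`, and maps into
    -- a smaller neighbourhood are transported through its inverse.
    obtain ⟨ε, hε, hε'⟩ := Metric.isOpen_iff.mp hu t ht
    let B := OpenPartialHomeomorph.univBall t ε
    have hB : ∀ s, B s ∈ Metric.ball t ε := fun s => by
      have := B.map_source (x := s) (by simp [B])
      rwa [OpenPartialHomeomorph.univBall_target t hε] at this
    have hBs : ∀ s, s ∈ Metric.ball t ε → B (B.symm s) = s := fun s hs =>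
      B.right_inv (by rwa [OpenPartialHomeomorph.univBall_target t hε])
    have h1 := @h n B (fun s => hε' (hB s)) OpenPartialHomeomorph.contDiff_univBall
    obtain ⟨w, hw, htw, hw'⟩ := h1 (B.symm t)
    have hsym : ContDiffOn ℝ ∞ B.symm (Metric.ball t ε) :=
      OpenPartialHomeomorph.contDiffOn_univBall_symm
    refine ⟨Metric.ball t ε ∩ B.symm ⁻¹' w, hsym.continuousOn.isOpen_inter_preimage
      Metric.isOpen_ball hw, ⟨Metric.mem_ball_self hε, htw⟩, fun d g hg hg' => ?_⟩
    obtain ⟨q, hq, hq'⟩ := hw' d (fun s => B.symm (g s)) (fun s => (hg s).2)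
      (hsym.comp_contDiff hg' fun s => (hg s).1)
    refine ⟨q, hq, fun s => ?_⟩
    rw [hq' s]
    change p (B (B.symm (g s))) = _
    rw [hBs _ (hg s).1]

lemma dSmooth_quotientMk {K : Type*} [Group K] [DiffeologicalSpace K] (N : Subgroup K) :
    DSmooth fun k : K => (k : K ⧸ N) := by
  intro n p hp
  exact DiffeologicalSpace.isPlot_sInf_iff.2 fun d hd => hd n p hp

/-- The quotient diffeology is the finest one with smooth projection, so its plots are plots of
`liftDiffeology`, for which the projection is smooth as well. -/
lemma subduction_quotientMk {K : Type*} [Group K] [DiffeologicalSpace K] (N : Subgroup K) :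
    Subduction fun k : K => (k : K ⧸ N) := by
  intro n p hp
  refine DiffeologicalSpace.isPlot_sInf_iff.1 hp
    (liftDiffeology (fun k : K => (k : K ⧸ N)) (QuotientGroup.mk_surjective)) ?_
  intro m q hq t
  exact ⟨Set.univ, isOpen_univ, trivial, fun d g _ hg => ⟨_, hq.comp_contDiff hg, fun _ => rfl⟩⟩

lemma isPlot_prod_iff {n : ℕ} {p : EuclideanSpace ℝ (Fin n) → X × Y} :
    IsPlot p ↔ IsPlot (fun t => (p t).1) ∧ IsPlot (fun t => (p t).2) :=
  DiffeologicalSpace.isPlot_inf_iff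

lemma isPlot_subtype_iff {P : X → Prop} {n : ℕ} {p : EuclideanSpace ℝ (Fin n) → Subtype P} :
    IsPlot p ↔ IsPlot fun t => (p t : X) :=
  Iff.rfl

lemma dSmooth_snd : DSmooth (Prod.snd : X × Y → Y) := fun _ _ hp => (isPlot_prod_iff.1 hp).2

lemma _root_.Diffeology.DSmooth.prodMk {f : X → Y} {g : X → Z} (hf : DSmooth f) (hg : DSmooth g) :
    DSmooth fun x => (f x, g x) := fun n p hp => isPlot_prod_iff.2 ⟨hf n p hp, hg n p hp⟩

lemma Subduction.prodMap {π : X → Y} {π' : Z → W} (h : Subduction π) (h' : Subduction π') :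
    Subduction (Prod.map π π') := by
  intro n p hp t
  obtain ⟨u, hu, htu, H⟩ := h n _ (isPlot_prod_iff.1 hp).1 t
  obtain ⟨v, hv, htv, H'⟩ := h' n _ (isPlot_prod_iff.1 hp).2 t
  refine ⟨u ∩ v, hu.inter hv, ⟨htu, htv⟩, fun d g hg hg' => ?_⟩
  obtain ⟨q, hq, hq'⟩ := H d g (fun s => (hg s).1) hg'
  obtain ⟨r, hr, hr'⟩ := H' d g (fun s => (hg s).2) hg'
  exact ⟨fun s => (q s, r s), isPlot_prod_iff.2 ⟨hq, hr⟩, fun s => Prod.ext (hq' s) (hr' s)⟩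

lemma Subduction.dSmooth {π : X → Y} (h : Subduction π) {f : Y → Z}
    (hf : DSmooth fun x => f (π x)) : DSmooth f := by
  intro n p hp
  refine isPlot_of_locally fun t => ?_
  obtain ⟨u, hu, htu, H⟩ := h n p hp t
  refine ⟨u, hu, htu, fun d g hg hg' => ?_⟩
  obtain ⟨q, hq, hq'⟩ := H d g hg hg'
  have := hf d q hq
  simpa only [Function.comp_def, hq'] using this

/-- To be a plot it suffices to be one after restriction to lifts. -/
lemma Subduction.isPlot_of_lifts {π : X → Y} (h : Subduction π) {n : ℕ}
    {p : EuclideanSpace ℝ (Fin n) → Y} (hp : IsPlot p) {r : EuclideanSpace ℝ (Fin n) → Z}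
    (H : ∀ (d : ℕ) (g : EuclideanSpace ℝ (Fin d) → EuclideanSpace ℝ (Fin n)) (q : _ → X),
      ContDiff ℝ ∞ g → IsPlot q → (∀ s, π (q s) = p (g s)) → IsPlot fun s => r (g s)) :
    IsPlot r := by
  refine isPlot_of_locally fun t => ?_
  obtain ⟨u, hu, htu, H'⟩ := h n p hp t
  refine ⟨u, hu, htu, fun d g hg hg' => ?_⟩
  obtain ⟨q, hq, hq'⟩ := H' d g hg hg'
  exact H d g q hg' hq hq'

end Diffeologies

/-! ### Smooth maps into vector spaces without a norm -/

section LinSmooth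

variable {F : Type*} [NormedAddCommGroup F] [NormedSpace ℝ F]
variable {E E' E'' : Type*} [AddCommGroup E] [Module ℝ E] [AddCommGroup E'] [Module ℝ E']
  [AddCommGroup E''] [Module ℝ E'']

/-- Smoothness at a point, tested by linear functionals. -/
def LinSmoothAt (x : F → E) (t : F) : Prop :=
  ∀ f : E →ₗ[ℝ] ℝ, ContDiffAt ℝ ∞ (fun s => f (x s)) t

/-- The plots of `E` are the maps all of whose linear coordinates are smooth. -/
class IsLinearDiffeology (E : Type*) [AddCommGroup E] [Module ℝ E] [DiffeologicalSpace E] :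
    Prop where
  isPlot_iff' : ∀ (n : ℕ) (p : EuclideanSpace ℝ (Fin n) → E),
    IsPlot p ↔ ∀ f : E →ₗ[ℝ] ℝ, ContDiff ℝ ∞ fun s => f (p s)

lemma linearDiffeology_isPlot_iff (n : ℕ) (p : EuclideanSpace ℝ (Fin n) → E) :
    @IsPlot E (linearDiffeology E) n p ↔ ∀ f : E →ₗ[ℝ] ℝ, ContDiff ℝ ∞ fun s => f (p s) := by
  rw [linearDiffeology, DiffeologicalSpace.isPlot_iInf_iff]
  exact forall_congr' fun f => isPlot_iff_contDiff (X := ℝ)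

instance (n : ℕ) : IsLinearDiffeology (Cl n) := ⟨linearDiffeology_isPlot_iff⟩
instance : IsLinearDiffeology ℍ[ℝ] := ⟨linearDiffeology_isPlot_iff⟩
instance (k : ℕ) : IsLinearDiffeology (QuatSpace k) := ⟨linearDiffeology_isPlot_iff⟩
instance (k : ℕ) : IsLinearDiffeology (Matrix (Fin k) (Fin k) ℍ[ℝ]) :=
  ⟨linearDiffeology_isPlot_iff⟩

lemma isPlot_iff_linSmoothAt [DiffeologicalSpace E] [IsLinearDiffeology E] {n : ℕ}
    {p : EuclideanSpace ℝ (Fin n) → E} : IsPlot p ↔ ∀ t, LinSmoothAt p t := by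
  rw [IsLinearDiffeology.isPlot_iff']
  simp only [contDiff_iff_contDiffAt, LinSmoothAt]
  exact forall_comm

lemma linSmoothAt_const (e : E) (t : F) : LinSmoothAt (fun _ : F => e) t :=
  fun _ => contDiffAt_const

lemma LinSmoothAt.congr {x y : F → E} {t : F} (h : LinSmoothAt x t)
    (hy : ∀ᶠ s in nhds t, y s = x s) : LinSmoothAt y t := fun f =>
  (h f).congr_of_eventuallyEq (hy.mono fun s hs => by simp only [hs])

lemma LinSmoothAt.linear {x : F → E} {t : F} (h : LinSmoothAt x t) (L : E →ₗ[ℝ] E') :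
    LinSmoothAt (fun s => L (x s)) t := fun f => h (f ∘ₗ L)

lemma LinSmoothAt.add {x y : F → E} {t : F} (hx : LinSmoothAt x t) (hy : LinSmoothAt y t) :
    LinSmoothAt (fun s => x s + y s) t := fun f => by
  simp only [map_add]
  exact (hx f).add (hy f)

lemma LinSmoothAt.neg {x : F → E} {t : F} (hx : LinSmoothAt x t) :
    LinSmoothAt (fun s => -x s) t := fun f => by
  simp only [map_neg]
  exact (hx f).neg

lemma LinSmoothAt.sub {x y : F → E} {t : F} (hx : LinSmoothAt x t) (hy : LinSmoothAt y t) :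
    LinSmoothAt (fun s => x s - y s) t := fun f => by
  simp only [map_sub]
  exact (hx f).sub (hy f)

lemma LinSmoothAt.smul {a : F → ℝ} {x : F → E} {t : F} (ha : ContDiffAt ℝ ∞ a t)
    (hx : LinSmoothAt x t) : LinSmoothAt (fun s => a s • x s) t := fun f => by
  simp only [map_smul, smul_eq_mul]
  exact ha.mul (hx f)

lemma LinSmoothAt.sum {ι : Type*} {s : Finset ι} {x : ι → F → E} {t : F}
    (hx : ∀ i ∈ s, LinSmoothAt (x i) t) : LinSmoothAt (fun u => ∑ i ∈ s, x i u) t := fun f => by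
  simp only [map_sum]
  exact ContDiffAt.sum fun i hi => hx i hi f

/-- Expanding the first argument in a basis leaves a finite sum of smooth scalars times linear
images of `y`; finite dimension of one factor is enough. -/
lemma LinSmoothAt.bilin [Module.Finite ℝ E] {x : F → E} {y : F → E'}
    {t : F} (hx : LinSmoothAt x t) (hy : LinSmoothAt y t) (B : E →ₗ[ℝ] E' →ₗ[ℝ] E'') :
    LinSmoothAt (fun s => B (x s) (y s)) t := by
  let b := Module.finBasis ℝ E
  have : (fun s => B (x s) (y s)) = fun s => ∑ i, b.coord i (x s) • B (b i) (y s) := by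
    funext s
    have h := congrArg (fun e => B e (y s)) (b.sum_repr (x s))
    simp only [map_sum, map_smul, LinearMap.sum_apply, LinearMap.smul_apply] at h
    exact h.symm
  rw [this]
  exact LinSmoothAt.sum fun i _ => LinSmoothAt.smul (hx _) (hy.linear _)

lemma LinSmoothAt.mul {A : Type*} [Ring A] [Algebra ℝ A] [Module.Finite ℝ A] {x y : F → A} {t : F}
    (hx : LinSmoothAt x t) (hy : LinSmoothAt y t) : LinSmoothAt (fun s => x s * y s) t :=
  hx.bilin hy (LinearMap.mul ℝ A)

lemma linSmoothAt_iff_contDiffAt {E : Type*} [NormedAddCommGroup E] [NormedSpace ℝ E]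
    [FiniteDimensional ℝ E] {x : F → E} {t : F} : LinSmoothAt x t ↔ ContDiffAt ℝ ∞ x t := by
  constructor
  · intro h
    let b := Module.finBasis ℝ E
    have : x = fun s => ∑ i, b.coord i (x s) • b i := by
      funext s
      exact (b.sum_repr (x s)).symm
    rw [this]
    exact ContDiffAt.sum fun i _ => (h (b.coord i)).smul contDiffAt_const
  · intro h f
    exact (LinearMap.toContinuousLinearMap f).contDiff.contDiffAt.comp t h

lemma isPlot_iff_contDiff_of_linear {E : Type*} [NormedAddCommGroup E] [NormedSpace ℝ E]
    [FiniteDimensional ℝ E] [DiffeologicalSpace E] [IsLinearDiffeology E] {n : ℕ}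
    {p : EuclideanSpace ℝ (Fin n) → E} : IsPlot p ↔ ContDiff ℝ ∞ p := by
  simp only [isPlot_iff_linSmoothAt, linSmoothAt_iff_contDiffAt, contDiff_iff_contDiffAt]

lemma linSmoothAt_matrix {ι κ : Type*} [Finite ι] [Finite κ] {x : F → Matrix ι κ E} {t : F}
    (h : ∀ i j, LinSmoothAt (fun s => x s i j) t) : LinSmoothAt x t := by
  classical
  have := Fintype.ofFinite ι
  have := Fintype.ofFinite κ
  intro f
  have hx : ∀ s, x s = ∑ i, ∑ j, Matrix.singleLinearMap ℝ i j (x s i j) := fun s => by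
    simpa using Matrix.matrix_eq_sum_single (x s)
  have : LinSmoothAt (fun s => ∑ i, ∑ j, Matrix.singleLinearMap ℝ i j (x s i j)) t :=
    LinSmoothAt.sum fun i _ => LinSmoothAt.sum fun j _ => (h i j).linear _
  simpa only [← hx] using this f

end LinSmooth

instance (n : ℕ) : Module.Finite ℝ (Cl n) :=
  have := Module.Finite.of_basis (Pi.basisFun ℝ (Fin n)).ExteriorAlgebra
  Module.Finite.equiv (equivExterior (euclideanForm n)).symm

/-! ### The twisted centre of the Clifford algebra and the kernel of the spin covering -/

section Centre

variable {n : ℕ}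

lemma ι_mul_ι_add_swap_dot (v w : Fin n → ℝ) :
    ι (euclideanForm n) v * ι (euclideanForm n) w + ι (euclideanForm n) w * ι (euclideanForm n) v =
      algebraMap ℝ _ (2 * (v ⬝ᵥ w)) := by
  rw [ι_mul_ι_add_swap, euclideanForm_polar]

lemma ι_mul_self_dot (v : Fin n → ℝ) :
    ι (euclideanForm n) v * ι (euclideanForm n) v = algebraMap ℝ _ (v ⬝ᵥ v) := by
  rw [ι_sq_scalar, euclideanForm_apply]

/-- The supercommutator with a vector is a contraction. -/
lemma ι_mul_sub_involute_mul_ι (v : Fin n → ℝ) (z : Cl n) :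
    ι (euclideanForm n) v * z - involute z * ι (euclideanForm n) v =
      contractLeft ((euclideanForm n).polarBilin v) z := by
  induction z using CliffordAlgebra.left_induction with
  | algebraMap r => simp [Algebra.commutes]
  | add x y hx hy => rw [map_add, map_add, ← hx, ← hy]; noncomm_ring
  | ι_mul x m hx =>
    rw [contractLeft_ι_mul, ← hx, map_mul, involute_ι, QuadraticMap.polarBilin_apply_apply,
      Algebra.smul_def, ← ι_mul_ι_add_swap]
    noncomm_ring

/-- The subalgebra generated by the basis vectors with index in `J`. -/
def coordSubalgebra (J : Finset (Fin n)) : Subalgebra ℝ (Cl n) :=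
  Algebra.adjoin ℝ ((fun j => ι (euclideanForm n) (Pi.single j 1)) '' (J : Set (Fin n)))

lemma ι_single_mem {J : Finset (Fin n)} {j : Fin n} (hj : j ∈ J) :
    ι (euclideanForm n) (Pi.single j 1) ∈ coordSubalgebra J :=
  Algebra.subset_adjoin ⟨j, hj, rfl⟩

lemma coordSubalgebra_univ : coordSubalgebra (Finset.univ : Finset (Fin n)) = ⊤ := by
  rw [eq_top_iff, ← adjoin_range_ι, Algebra.adjoin_le_iff]
  rintro _ ⟨v, rfl⟩
  rw [show v = ∑ i, v i • (Pi.single i 1 : Fin n → ℝ) from pi_eq_sum_univ' v, map_sum]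
  exact sum_mem fun i _ => by
    rw [map_smul]
    exact Subalgebra.smul_mem _ (ι_single_mem (Finset.mem_univ i)) _

/-- For `i` outside `J`, an element of the larger subalgebra has the form x + eᵢ y with x and y in
the subalgebra of `J`, and contraction with the i-th coordinate extracts y. The induction multiplies
a word by one generator at a time. -/
lemma contractLeft_mem_coordSubalgebra {J : Finset (Fin n)} {i : Fin n} {z : Cl n}
    (hz : z ∈ coordSubalgebra (insert i J)) :
    contractLeft (LinearMap.proj i) z ∈ coordSubalgebra J ∧
      z - ι (euclideanForm n) (Pi.single i 1) * contractLeft (LinearMap.proj i) z ∈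
        coordSubalgebra J := by
  rw [coordSubalgebra, ← Subalgebra.mem_toSubmodule, Algebra.adjoin_eq_span] at hz
  induction hz using Submodule.span_induction with
  | zero => simp
  | add x y _ _ hx hy =>
    rw [map_add]
    refine ⟨add_mem hx.1 hy.1, ?_⟩
    convert add_mem hx.2 hy.2 using 1
    noncomm_ring
  | smul c x _ hx =>
    rw [map_smul]
    refine ⟨Subalgebra.smul_mem _ hx.1 c, ?_⟩
    convert Subalgebra.smul_mem _ hx.2 c using 1
    rw [smul_sub, mul_smul_comm]
  | mem x hx =>
    induction hx using Submonoid.closure_induction_left with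
    | one => simp
    | mul_left x hx y _ hy =>
      obtain ⟨j, hj, rfl⟩ := hx
      dsimp only at hy ⊢
      rw [contractLeft_ι_mul]
      set e := ι (euclideanForm n) (Pi.single i 1) with he
      set f := ι (euclideanForm n) (Pi.single j 1) with hf
      set c := contractLeft (Q := euclideanForm n) (LinearMap.proj i) y with hc
      by_cases hji : j = i
      · subst hji
        have hee : e * e = 1 := by rw [he, ι_mul_self_dot]; simp
        simp only [LinearMap.proj_apply, Pi.single_eq_same, one_smul]
        refine ⟨hy.2, ?_⟩
        convert hy.1 using 1
        change e * y - e * (y - e * c) = c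
        rw [mul_sub, sub_sub_cancel, ← mul_assoc, hee, one_mul]
      · have hfe : e * f = -(f * e) := by
          rw [eq_neg_iff_add_eq_zero, he, hf, ι_mul_ι_add_swap_dot]; simp [hji]
        have hfm : f ∈ coordSubalgebra J := by
          refine ι_single_mem ?_
          simpa [hji] using hj
        have h0 : (LinearMap.proj i : (Fin n → ℝ) →ₗ[ℝ] ℝ) (Pi.single j 1) = 0 := by
          simp [Ne.symm hji]
        rw [h0, zero_smul, zero_sub]
        refine ⟨neg_mem (mul_mem hfm hy.1), ?_⟩
        convert mul_mem hfm hy.2 using 1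
        rw [mul_neg, sub_neg_eq_add, ← mul_assoc, hfe, mul_sub, neg_mul, mul_assoc, sub_eq_add_neg]

/-- Each vanishing contraction removes one basis vector from the set of generators needed for `z`,
until only scalars are left. -/
lemma mem_bot_of_contractLeft_eq_zero {z : Cl n}
    (h : ∀ i, contractLeft (Q := euclideanForm n) (LinearMap.proj i) z = 0) :
    z ∈ (⊥ : Subalgebra ℝ (Cl n)) := by
  have key : ∀ J : Finset (Fin n), z ∈ coordSubalgebra J → z ∈ (⊥ : Subalgebra ℝ (Cl n)) := by
    intro J
    induction J using Finset.induction_on with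
    | empty =>
      intro hz
      simpa [coordSubalgebra] using hz
    | insert i J hi ih =>
      intro hz
      apply ih
      have := (contractLeft_mem_coordSubalgebra hz).2
      rwa [h i, mul_zero, sub_zero] at this
  exact key Finset.univ (by rw [coordSubalgebra_univ]; trivial)

/-- The supercommutator with eᵢ is twice the contraction with the i-th coordinate, because the polar
form is twice the dot product; this explains the factor 1/2 below. -/
lemma mem_bot_of_twisted_commute {z : Cl n}
    (h : ∀ v, ι (euclideanForm n) v * z = involute z * ι (euclideanForm n) v) :
    z ∈ (⊥ : Subalgebra ℝ (Cl n)) := by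
  refine mem_bot_of_contractLeft_eq_zero fun i => ?_
  have h1 : (LinearMap.proj i : (Fin n → ℝ) →ₗ[ℝ] ℝ) =
      (euclideanForm n).polarBilin ((1 / 2 : ℝ) • Pi.single i 1) := by
    ext j
    simp [QuadraticMap.polarBilin_apply_apply, euclideanForm_polar, Pi.single_apply, eq_comm]
  rw [h1, ← ι_mul_sub_involute_mul_ι, h, sub_self]

/-- Elements of Spin(n) are even, so commuting with vectors is twisted commuting, and such an
element is a real scalar of square 1. This computes the kernel of the spin covering. -/
lemma eq_one_or_neg_one_of_commute {x : Spin n}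
    (h : ∀ v, ι (euclideanForm n) v * x = (x : Cl n) * ι (euclideanForm n) v) :
    (x : Cl n) = 1 ∨ (x : Cl n) = -1 := by
  have hx := mem_bot_of_twisted_commute (z := (x : Cl n)) fun v => by
    rw [h, spinGroup.involute_eq x.2]
  obtain ⟨r, hr⟩ := Algebra.mem_bot.1 hx
  have h1 : star (x : Cl n) * x = 1 := spinGroup.star_mul_self_of_mem x.2
  rw [← hr, star_algebraMap, ← map_mul, ← map_one (algebraMap ℝ (Cl n))] at h1
  rcases mul_self_eq_one_iff.1 (algebraMap_inj n h1) with h | h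
  · left; rw [← hr, h, map_one]
  · right; rw [← hr, h, map_neg, map_one]

end Centre

/-! ### Vectors of a Euclidean space in the Clifford algebra -/

section Gamma

variable {V : Type*} [NormedAddCommGroup V] [InnerProductSpace ℝ V] {N : ℕ}
  (b : OrthonormalBasis (Fin N) ℝ V)

/-- The vector `v`, written in the orthonormal basis `b`, as an element of the Clifford algebra. -/
def gam : V →ₗ[ℝ] Cl N :=
  ι (euclideanForm N) ∘ₗ (WithLp.linearEquiv 2 ℝ (Fin N → ℝ)).toLinearMap ∘ₗ
    b.repr.toLinearEquiv.toLinearMap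

lemma gam_apply (v : V) : gam b v = ι (euclideanForm N) (b.repr v).ofLp := rfl

lemma dotProduct_repr (v w : V) : (b.repr v).ofLp ⬝ᵥ (b.repr w).ofLp = inner ℝ v w := by
  rw [← b.repr.inner_map_map, EuclideanSpace.inner_eq_star_dotProduct, dotProduct_comm]
  simp

lemma gam_injective : Function.Injective (gam b) := by
  intro v w h
  apply b.repr.injective
  ext i
  exact congrFun (ι_inj N h) i

lemma gam_mul_add_swap (v w : V) :
    gam b v * gam b w + gam b w * gam b v = algebraMap ℝ _ (2 * inner ℝ v w) := by
  rw [gam_apply, gam_apply, ι_mul_ι_add_swap_dot, dotProduct_repr]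

lemma gam_mul_self (v : V) : gam b v * gam b v = algebraMap ℝ _ (‖v‖ ^ 2) := by
  rw [gam_apply, ι_mul_self_dot, dotProduct_repr, real_inner_self_eq_norm_sq]

lemma gam_mul_self_of_norm {v : V} (hv : ‖v‖ = 1) : gam b v * gam b v = 1 := by
  rw [gam_mul_self, hv, one_pow, map_one]

lemma gam_anticomm {v w : V} (h : inner ℝ v w = 0) : gam b v * gam b w = -(gam b w * gam b v) := by
  rw [eq_neg_iff_add_eq_zero, gam_mul_add_swap, h, mul_zero, map_zero]

lemma exists_gam_eq (w : Fin N → ℝ) : ∃ v, gam b v = ι (euclideanForm N) w :=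
  ⟨b.repr.symm (WithLp.toLp 2 w), by rw [gam_apply, LinearIsometryEquiv.apply_symm_apply]⟩

lemma gam_isUnit {v : V} (hv : ‖v‖ = 1) : ∃ u : (Cl N)ˣ, (u : Cl N) = gam b v ∧
    u ∈ lipschitzGroup (euclideanForm N) :=
  ⟨⟨gam b v, gam b v, gam_mul_self_of_norm b hv, gam_mul_self_of_norm b hv⟩, rfl,
    Subgroup.subset_closure ⟨_, rfl⟩⟩

lemma gam_mul_gam_mem {v w : V} (hv : ‖v‖ = 1) (hw : ‖w‖ = 1) :
    gam b v * gam b w ∈ spinGroup (euclideanForm N) := by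
  obtain ⟨x, hx, hx'⟩ := gam_isUnit b hv
  obtain ⟨y, hy, hy'⟩ := gam_isUnit b hw
  rw [spinGroup.mem_iff, pinGroup.mem_iff]
  have hs : star (gam b v * gam b w) = gam b w * gam b v := by
    rw [star_mul, gam_apply, gam_apply, star_ι, star_ι, neg_mul_neg]
  refine ⟨⟨⟨x * y, mul_mem hx' hy', by rw [← hx, ← hy]; rfl⟩, Unitary.mem_iff.2 ⟨?_, ?_⟩⟩,
    ι_mul_ι_mem_evenOdd_zero _ _ _⟩
  · rw [hs, mul_assoc, ← mul_assoc (gam b v), gam_mul_self_of_norm b hv, one_mul,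
      gam_mul_self_of_norm b hw]
  · rw [hs, mul_assoc, ← mul_assoc (gam b w), gam_mul_self_of_norm b hw, one_mul,
      gam_mul_self_of_norm b hv]

/-- The product of two unit vectors. -/
def gamPair (v w : V) (hv : ‖v‖ = 1) (hw : ‖w‖ = 1) : Spin N :=
  ⟨gam b v * gam b w, gam_mul_gam_mem b hv hw⟩

/-- `x` covers the transformation `T`: `x v x⁻¹ = T v` for all vectors `v`. -/
def Covers (x : Cl N) (T : V → V) : Prop := ∀ v, gam b (T v) * x = x * gam b v

variable {b}

lemma Covers.one : Covers b 1 (fun v => v) := fun v => by simp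

lemma Covers.mul {x y : Cl N} {S T : V → V} (hx : Covers b x S) (hy : Covers b y T) :
    Covers b (x * y) (fun v => S (T v)) := fun v => by
  rw [← mul_assoc, hx, mul_assoc, hy, mul_assoc]

lemma Covers.congr {x : Cl N} {S T : V → V} (hx : Covers b x S) (h : ∀ v, S v = T v) :
    Covers b x T := fun v => by rw [← h, hx]

@[simp] lemma spin_star_mul (x : Spin N) : star (x : Cl N) * x = 1 :=
  spinGroup.star_mul_self_of_mem x.2

@[simp] lemma spin_mul_star (x : Spin N) : (x : Cl N) * star (x : Cl N) = 1 :=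
  spinGroup.mul_star_self_of_mem x.2

lemma spin_coe_inv (x : Spin N) : ((x⁻¹ : Spin N) : Cl N) = star (x : Cl N) := by
  rw [← spinGroup.star_eq_inv]; rfl

lemma Covers.inv {x : Spin N} {S T : V → V} (hx : Covers b x S) (h : ∀ v, S (T v) = v) :
    Covers b (x⁻¹ : Spin N) T := fun v => by
  rw [spin_coe_inv]
  have := hx (T v)
  rw [h] at this
  calc gam b (T v) * star (x : Cl N) =
      star (x : Cl N) * (x * gam b (T v)) * star (x : Cl N) := by
        rw [← mul_assoc (star (x : Cl N)), spin_star_mul, one_mul]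
    _ = star (x : Cl N) * gam b v := by
        rw [← this, mul_assoc, mul_assoc, spin_mul_star, mul_one]

lemma Covers.unique {x : Spin N} {S T : V → V} (hx : Covers b x S) (hx' : Covers b x T) (v : V) :
    S v = T v := by
  apply gam_injective b
  calc gam b (S v) = gam b (S v) * x * star (x : Cl N) := by
        rw [mul_assoc, spin_mul_star, mul_one]
    _ = gam b (T v) * x * star (x : Cl N) := by rw [hx, hx']
    _ = _ := by rw [mul_assoc, spin_mul_star, mul_one]

/-- The quotient x⁻¹y commutes with all vectors. Every later sign argument rests on this
two-valuedness. -/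
lemma Covers.eq_or_eq_neg {x y : Spin N} {T : V → V} (hx : Covers b x T) (hy : Covers b y T) :
    (x : Cl N) = y ∨ (x : Cl N) = -y := by
  have h : ∀ v, ι (euclideanForm N) v * (x⁻¹ * y : Spin N) =
      ((x⁻¹ * y : Spin N) : Cl N) * ι (euclideanForm N) v := by
    intro w
    obtain ⟨v, hv⟩ := exists_gam_eq b w
    rw [← hv, Submonoid.coe_mul, spin_coe_inv, mul_assoc, ← hy, ← mul_assoc, ← mul_assoc]
    congr 1
    calc gam b v * star (x : Cl N) =
        star (x : Cl N) * (x * gam b v) * star (x : Cl N) := by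
          rw [← mul_assoc (star (x : Cl N)), spin_star_mul, one_mul]
      _ = star (x : Cl N) * gam b (T v) := by
          rw [← hx, mul_assoc, mul_assoc, spin_mul_star, mul_one]
  have h2 : (y : Cl N) = x * (x⁻¹ * y : Spin N) := by
    rw [← Submonoid.coe_mul, mul_inv_cancel_left]
  rcases eq_one_or_neg_one_of_commute h with h1 | h1 <;> rw [h1] at h2
  · left; rw [h2, mul_one]
  · right; rw [h2, mul_neg, mul_one, neg_neg]

/-- Conjugation by a product of two unit vectors is a product of two reflections. -/
lemma covers_gamPair {v w : V} (hv : ‖v‖ = 1) (hw : ‖w‖ = 1) :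
    Covers b (gamPair b v w hv hw) (fun z => z - (2 * inner ℝ w z) • w
      - (2 * inner ℝ v (z - (2 * inner ℝ w z) • w)) • v) := by
  have key : ∀ {u : V}, ‖u‖ = 1 → ∀ z : V,
      gam b (z - (2 * inner ℝ u z) • u) * gam b u = -(gam b u * gam b z) := by
    intro u hu z
    rw [map_sub, map_smul, sub_mul, smul_mul_assoc, gam_mul_self_of_norm b hu,
      ← Algebra.algebraMap_eq_smul_one, ← gam_mul_add_swap]
    abel
  intro z
  change _ * (gam b v * gam b w) = gam b v * gam b w * gam b z
  rw [← mul_assoc, key hv, neg_mul, mul_assoc, key hw, mul_neg, neg_neg, mul_assoc]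

/-- Translates between the coordinate-free relation `Covers` and the matrix λ(x), whose columns are
the images of the basis vectors. -/
lemma covers_matrix_iff {x : Spin N} {T : V →ₗ[ℝ] V} :
    Covers b x T ↔ ∀ i, T (b i) = ∑ j, (spinCover N x).1 j i • b j := by
  have hc : ∀ v, gam b v = ι (euclideanForm N) (b.repr v).ofLp := gam_apply b
  have h1 : ∀ v, gam b (b.repr.symm (WithLp.toLp 2 (spinConj x (b.repr v).ofLp))) * x
      = x * gam b v := by
    intro v
    rw [hc, hc, LinearIsometryEquiv.apply_symm_apply, ι_spinConj, mul_assoc, mul_assoc,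
      spin_star_mul, mul_one]
  have h2 : ∀ i, b.repr.symm (WithLp.toLp 2 (spinConj x (b.repr (b i)).ofLp)) =
      ∑ j, (spinCover N x).1 j i • b j := by
    intro i
    rw [← b.sum_repr_symm]
    refine Finset.sum_congr rfl fun j _ => ?_
    congr 1
    simp only [spinCover, MonoidHom.coe_mk, OneHom.coe_mk, LinearMap.toMatrix'_apply]
    rw [b.repr_self]
    rfl
  constructor
  · intro h i
    rw [← h2]
    exact Covers.unique (x := x) h h1 (b i)
  · intro h
    refine Covers.congr h1 fun v => ?_
    let L : V →ₗ[ℝ] V := b.repr.symm.toLinearEquiv.toLinearMap ∘ₗ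
      (WithLp.linearEquiv 2 ℝ (Fin N → ℝ)).symm.toLinearMap ∘ₗ spinConj x ∘ₗ
      (WithLp.linearEquiv 2 ℝ (Fin N → ℝ)).toLinearMap ∘ₗ b.repr.toLinearEquiv.toLinearMap
    have : L = T := by
      refine b.toBasis.ext fun i => ?_
      rw [OrthonormalBasis.coe_toBasis, h i, ← h2]
      rfl
    exact LinearMap.congr_fun this v

end Gamma

/-! ### Surjectivity of the spin covering -/

section Surjective

variable {V : Type*} [NormedAddCommGroup V] [InnerProductSpace ℝ V] {N : ℕ}
  (b : OrthonormalBasis (Fin N) ℝ V)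

/-- By the Cartan–Dieudonné theorem reflections generate the orthogonal group, and a reflection is
covered, in the twisted sense, by its unit normal. The normalization uses `reverse` and not `star`
because a unit vector `v` satisfies `star v * v = -1`. -/
lemma exists_lipschitz_of_isometry (φ : V ≃ₗᵢ[ℝ] V) :
    ∃ x : (Cl N)ˣ, x ∈ lipschitzGroup (euclideanForm N) ∧ reverse (x : Cl N) * x = 1 ∧
      ∀ v, gam b (φ v) * x = involute (x : Cl N) * gam b v := by
  have : FiniteDimensional ℝ V := b.toBasis.finiteDimensional_of_finite
  have hφ : φ ∈ Subgroup.closure (Set.range fun v : V => (ℝ ∙ v)ᗮ.reflection) := by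
    rw [LinearIsometryEquiv.reflections_generate]; trivial
  have gen : ∀ v : V, ∃ x : (Cl N)ˣ, x ∈ lipschitzGroup (euclideanForm N) ∧
      reverse (x : Cl N) * x = 1 ∧
      ∀ w, gam b ((ℝ ∙ v)ᗮ.reflection w) * x = involute (x : Cl N) * gam b w := by
    intro v
    by_cases hv : v = 0
    · subst hv
      refine ⟨1, one_mem _, by simp, fun w => ?_⟩
      have : (ℝ ∙ (0 : V))ᗮ.reflection w = w :=
        Submodule.reflection_mem_subspace_eq_self (by simp)
      rw [this]
      simp
    · have hu : ‖(‖v‖⁻¹ • v)‖ = 1 := by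
        rw [norm_smul, norm_inv, norm_norm, inv_mul_cancel₀ (norm_ne_zero_iff.2 hv)]
      obtain ⟨x, hx, hx'⟩ := gam_isUnit b hu
      refine ⟨x, hx', ?_, fun w => ?_⟩
      · rw [hx, gam_apply, reverse_ι, ← gam_apply, gam_mul_self_of_norm b hu]
      · rw [hx]
        have h1 : (ℝ ∙ v)ᗮ.reflection w =
            w - (2 * inner ℝ (‖v‖⁻¹ • v) w) • (‖v‖⁻¹ • v) := by
          rw [Submodule.reflection_orthogonal_apply, Submodule.reflection_singleton_apply,
            neg_sub, real_inner_smul_left, smul_smul, ← Nat.cast_smul_eq_nsmul ℝ, smul_smul]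
          congr 2
          simp only [RCLike.ofReal_real_eq_id, id_eq, Nat.cast_ofNat]
          field_simp
        rw [h1]
        generalize ‖v‖⁻¹ • v = u at *
        rw [map_sub, map_smul, sub_mul, smul_mul_assoc, gam_mul_self_of_norm b hu,
          ← Algebra.algebraMap_eq_smul_one, ← gam_mul_add_swap]
        have : involute (gam b u) = -gam b u := by rw [gam_apply, involute_ι]
        rw [this]
        noncomm_ring
  induction hφ using Subgroup.closure_induction with
  | mem φ h =>
    obtain ⟨v, rfl⟩ := h
    exact gen v
  | one => exact ⟨1, one_mem _, by simp, fun v => by simp⟩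
  | mul φ ψ _ _ hφ hψ =>
    obtain ⟨x, hx, hx1, hx2⟩ := hφ
    obtain ⟨y, hy, hy1, hy2⟩ := hψ
    refine ⟨x * y, mul_mem hx hy, ?_, fun v => ?_⟩
    · rw [Units.val_mul, reverse.map_mul, mul_assoc, ← mul_assoc _ (x : Cl N), hx1, one_mul, hy1]
    · change gam b (φ (ψ v)) * _ = _
      rw [Units.val_mul, ← mul_assoc, hx2, mul_assoc, hy2, map_mul, mul_assoc]
  | inv φ _ hφ =>
    obtain ⟨x, hx, hx1, hx2⟩ := hφ
    have hx3 : reverse (x : Cl N) = (x⁻¹ : (Cl N)ˣ) := Units.eq_inv_of_mul_eq_one_right hx1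
    refine ⟨x⁻¹, inv_mem hx, ?_, fun v => ?_⟩
    · rw [← hx3, reverse_reverse, hx3, Units.mul_inv]
    · have h := hx2 (φ⁻¹ v)
      have h' : φ (φ⁻¹ v) = v := φ.apply_symm_apply v
      rw [h'] at h
      have h4 : involute ((x⁻¹ : (Cl N)ˣ) : Cl N) * involute (x : Cl N) = 1 := by
        rw [← map_mul, Units.inv_mul, map_one]
      calc gam b (φ⁻¹ v) * (x⁻¹ : (Cl N)ˣ) = involute ((x⁻¹ : (Cl N)ˣ) : Cl N) *
            (involute (x : Cl N) * gam b (φ⁻¹ v)) * (x⁻¹ : (Cl N)ˣ) := by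
              rw [← mul_assoc (involute _), h4, one_mul]
        _ = _ := by rw [← h, mul_assoc, mul_assoc, Units.mul_inv, mul_one]

/-- Every rotation is covered by an element of the spin group. -/
lemma exists_spin_covers (φ : V ≃ₗᵢ[ℝ] V) (hφ : LinearMap.det (φ.toLinearEquiv : V →ₗ[ℝ] V) = 1) :
    ∃ x : Spin N, Covers b x φ := by
  obtain ⟨x, hx, hx1, hx2⟩ := exists_lipschitz_of_isometry b φ
  obtain ⟨T, hT, hT'⟩ := exists_adjoint x hx
  let e : V ≃ₗ[ℝ] (Fin N → ℝ) := b.repr.toLinearEquiv.trans (WithLp.linearEquiv 2 ℝ (Fin N → ℝ))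
  have hg : ∀ v, gam b v = ι (euclideanForm N) (e v) := fun v => rfl
  have hdet : LinearMap.det T = 1 := by
    have : T = e.toLinearMap ∘ₗ (φ.toLinearEquiv : V →ₗ[ℝ] V) ∘ₗ e.symm.toLinearMap := by
      refine LinearMap.ext fun w => ι_inj N ?_
      rw [hT]
      have := hx2 (e.symm w)
      rw [hg, hg, LinearEquiv.apply_symm_apply] at this
      rw [← this, mul_assoc, Units.mul_inv, mul_one]
      rfl
    rw [this, LinearMap.det_conj, hφ]
  -- Parity and determinant are correlated, so determinant 1 excludes odd elements. On even elements
  -- `involute` is the identity and `star` agrees with `reverse`.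
  have heven : (x : Cl N) ∈ evenOdd (euclideanForm N) 0 := by
    rcases hT' with h | h
    · exact h.1
    · rw [hdet] at h
      norm_num at h
  have hinv : involute (x : Cl N) = x := involute_eq_of_mem_even heven
  have hstar : star (x : Cl N) = reverse (x : Cl N) := by
    rw [star_def, hinv]
  have hx3 : reverse (x : Cl N) = (x⁻¹ : (Cl N)ˣ) := Units.eq_inv_of_mul_eq_one_right hx1
  refine ⟨⟨x, spinGroup.mem_iff.2 ⟨pinGroup.mem_iff.2 ⟨⟨x, hx, rfl⟩, Unitary.mem_iff.2 ⟨?_, ?_⟩⟩,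
    heven⟩⟩, fun v => ?_⟩
  · rw [hstar, hx1]
  · rw [hstar, hx3, Units.mul_inv]
  · rw [hx2, hinv]

lemma orthonormal_of_specialOrthogonal (A : Matrix.specialOrthogonalGroup (Fin N) ℝ) :
    Orthonormal ℝ fun i => ∑ j, A.1 j i • b j := by
  have hA := (Matrix.mem_orthogonalGroup_iff' _ _).1 (Matrix.mem_specialOrthogonalGroup_iff.1 A.2).1
  rw [orthonormal_iff_ite]
  intro i j
  have h := congrFun (congrFun hA i) j
  rw [Matrix.mul_apply, Matrix.one_apply] at h
  rw [b.orthonormal.inner_sum, ← h]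
  rfl

/-- The rotation with a given matrix in the basis `b`. -/
lemma exists_isometry_of_specialOrthogonal (A : Matrix.specialOrthogonalGroup (Fin N) ℝ) :
    ∃ φ : V ≃ₗᵢ[ℝ] V, LinearMap.det (φ.toLinearEquiv : V →ₗ[ℝ] V) = 1 ∧
      ∀ i, φ (b i) = ∑ j, A.1 j i • b j := by
  have : FiniteDimensional ℝ V := b.toBasis.finiteDimensional_of_finite
  have ho := orthonormal_of_specialOrthogonal b A
  have hspan : ⊤ ≤ Submodule.span ℝ (Set.range fun i => ∑ j, A.1 j i • b j) := by
    rw [LinearIndependent.span_eq_top_of_card_eq_finrank' ho.linearIndependent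
      (Module.finrank_eq_card_basis b.toBasis).symm]
  let c : OrthonormalBasis (Fin N) ℝ V := OrthonormalBasis.mk ho hspan
  have hc : ∀ i, c i = ∑ j, A.1 j i • b j := fun i => by simp [c]
  have hφ : ∀ i, b.equiv c (Equiv.refl _) (b i) = ∑ j, A.1 j i • b j := fun i => by
    rw [← hc]; simp
  refine ⟨b.equiv c (Equiv.refl _), ?_, hφ⟩
  rw [← LinearMap.det_toMatrix b.toBasis, ← (Matrix.mem_specialOrthogonalGroup_iff.1 A.2).2]
  congr 1
  ext i j
  rw [LinearMap.toMatrix_apply, OrthonormalBasis.coe_toBasis]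
  change (b.toBasis.repr (b.equiv c (Equiv.refl _) (b j))) i = _
  rw [hφ, OrthonormalBasis.coe_toBasis_repr_apply, map_sum]
  simp [Pi.single_apply]

lemma eq_of_sum_smul_eq {A B : Matrix (Fin N) (Fin N) ℝ}
    (h : ∀ i, ∑ j, A j i • b j = ∑ j, B j i • b j) : A = B := by
  ext i j
  have h2 := congrArg (fun v => b.repr v i) (h j)
  simpa [Pi.single_apply] using h2


lemma exists_spinCover_eq (b : OrthonormalBasis (Fin N) ℝ V) (A : Matrix.specialOrthogonalGroup (Fin N) ℝ) :
    ∃ x, spinCover N x = A := by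
  obtain ⟨φ, hdet, hφ⟩ := exists_isometry_of_specialOrthogonal b A
  obtain ⟨x, hx⟩ := exists_spin_covers b φ hdet
  have h := (covers_matrix_iff (x := x) (T := (φ.toLinearEquiv : V →ₗ[ℝ] V))).1 hx
  have h2 : (spinCover N x).1 = A.1 := eq_of_sum_smul_eq b fun i => (h i).symm.trans (hφ i)
  exact ⟨x, Subtype.ext h2⟩

lemma spinCover_surjective : Function.Surjective (spinCover N) :=
  exists_spinCover_eq (EuclideanSpace.basisFun (Fin N) ℝ)

end Surjective

/-! ### Spin groups in low dimensions -/

section LowDim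

lemma even_mem_adjoin {n : ℕ} {A : Subalgebra ℝ (Cl n)}
    (h : ∀ i j, ι (euclideanForm n) (Pi.single i 1) * ι (euclideanForm n) (Pi.single j 1) ∈ A)
    {x : Cl n} (hx : x ∈ evenOdd (euclideanForm n) 0) : x ∈ A := by
  have h2 : ∀ v w, ι (euclideanForm n) v * ι (euclideanForm n) w ∈ A := by
    intro v w
    rw [show v = ∑ i, v i • (Pi.single i 1 : Fin n → ℝ) from pi_eq_sum_univ' v,
      show w = ∑ i, w i • (Pi.single i 1 : Fin n → ℝ) from pi_eq_sum_univ' w, map_sum, map_sum,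
      Finset.sum_mul_sum]
    refine sum_mem fun i _ => sum_mem fun j _ => ?_
    rw [map_smul, map_smul, smul_mul_smul_comm]
    exact Subalgebra.smul_mem _ (h i j) _
  induction x, hx using even_induction with
  | algebraMap r => exact A.algebraMap_mem r
  | add x y _ _ hx hy => exact add_mem hx hy
  | ι_mul_ι_mul v w x _ hx => exact mul_mem (h2 v w) hx

/-- `Spin(1)` and `Spin(2)` are commutative. -/
lemma spin_comm_of_le_two {r : ℕ} (hr : r ≤ 2) (x y : Spin r) :
    (x : Cl r) * y = (y : Cl r) * x := by
  -- In these dimensions the even subalgebra is generated by one element: nothing beyond scalars for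
  -- r ≤ 1, and the product of the two basis vectors for r = 2.
  obtain ⟨B, hB⟩ : ∃ B : Cl r, ∀ i j, ι (euclideanForm r) (Pi.single i 1) *
      ι (euclideanForm r) (Pi.single j 1) ∈ Algebra.adjoin ℝ {B} := by
    have hdiag : ∀ i : Fin r, ι (euclideanForm r) (Pi.single i 1) *
        ι (euclideanForm r) (Pi.single i 1) = 1 := fun i => by rw [ι_mul_self_dot]; simp
    interval_cases r
    · exact ⟨0, fun i => i.elim0⟩
    · refine ⟨0, fun i j => ?_⟩
      rw [Subsingleton.elim i j, hdiag]
      exact one_mem _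
    · refine ⟨ι (euclideanForm 2) (Pi.single 0 1) * ι (euclideanForm 2) (Pi.single 1 1), ?_⟩
      have hs : ι (euclideanForm 2) (Pi.single 1 1) * ι (euclideanForm 2) (Pi.single 0 1) =
          -(ι (euclideanForm 2) (Pi.single 0 1) * ι (euclideanForm 2) (Pi.single 1 1)) := by
        rw [eq_neg_iff_add_eq_zero, ι_mul_ι_add_swap_dot]; simp
      intro i j
      fin_cases i <;> fin_cases j
      · exact (hdiag 0).symm ▸ one_mem _
      · exact Algebra.subset_adjoin rfl
      · exact hs.symm ▸ neg_mem (Algebra.subset_adjoin rfl)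
      · exact (hdiag 1).symm ▸ one_mem _
  have hx := even_mem_adjoin hB (spinGroup.mem_even x.2)
  have hy := even_mem_adjoin hB (spinGroup.mem_even y.2)
  exact Algebra.commute_of_mem_adjoin_singleton_of_commute hx
    (Algebra.commute_of_mem_adjoin_singleton_of_commute hy (Commute.refl B)).symm |>.symm.eq

end LowDim

/-! ### The inclusion `Spin(m) ⊂ Spin(m + 1)` -/

section Inclusion

variable {m : ℕ}

lemma contractLeft_map {M M' : Type*} [AddCommGroup M] [Module ℝ M] [AddCommGroup M']
    [Module ℝ M'] {Q : QuadraticForm ℝ M} {Q' : QuadraticForm ℝ M'} (f : Q →qᵢ Q')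
    (d : Module.Dual ℝ M') (x : CliffordAlgebra Q) :
    contractLeft d (CliffordAlgebra.map f x) =
      CliffordAlgebra.map f (contractLeft (d ∘ₗ f.toLinearMap) x) := by
  induction x using CliffordAlgebra.left_induction with
  | algebraMap r => simp
  | add x y hx hy => simp only [map_add, hx, hy]
  | ι_mul x a hx =>
    rw [map_mul, map_apply_ι, contractLeft_ι_mul, contractLeft_ι_mul, hx, map_sub, map_smul,
      map_mul, map_apply_ι]
    rfl

lemma involute_map {M M' : Type*} [AddCommGroup M] [Module ℝ M] [AddCommGroup M']
    [Module ℝ M'] {Q : QuadraticForm ℝ M} {Q' : QuadraticForm ℝ M'} (f : Q →qᵢ Q')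
    (x : CliffordAlgebra Q) :
    involute (CliffordAlgebra.map f x) = CliffordAlgebra.map f (involute x) := by
  induction x using CliffordAlgebra.left_induction with
  | algebraMap r => simp
  | add x y hx hy => simp only [map_add, hx, hy]
  | ι_mul x a hx => simp [hx]

lemma reverse_map {M M' : Type*} [AddCommGroup M] [Module ℝ M] [AddCommGroup M']
    [Module ℝ M'] {Q : QuadraticForm ℝ M} {Q' : QuadraticForm ℝ M'} (f : Q →qᵢ Q')
    (x : CliffordAlgebra Q) :
    reverse (CliffordAlgebra.map f x) = CliffordAlgebra.map f (reverse x) := by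
  induction x using CliffordAlgebra.left_induction with
  | algebraMap r => simp
  | add x y hx hy => simp only [map_add, hx, hy]
  | ι_mul x a hx => simp [hx]

/-- The inclusion `ℝᵐ → ℝᵐ⁺¹`, `v ↦ (0, v)`. -/
def inclIsometry (m : ℕ) : euclideanForm m →qᵢ euclideanForm (m + 1) where
  toFun v := Fin.cons 0 v
  map_add' v w := by ext i; refine Fin.cases ?_ (fun i => ?_) i <;> simp
  map_smul' c v := by ext i; refine Fin.cases ?_ (fun i => ?_) i <;> simp
  map_app' v := by simp [euclideanForm_apply, dotProduct, Fin.sum_univ_succ]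

/-- The inclusion of Clifford algebras induced by `ℝᵐ → ℝᵐ⁺¹`. -/
def inclCl (m : ℕ) : Cl m →ₐ[ℝ] Cl (m + 1) := CliffordAlgebra.map (inclIsometry m)

lemma inclCl_ι (v : Fin m → ℝ) : inclCl m (ι _ v) = ι (euclideanForm (m + 1)) (Fin.cons 0 v) :=
  map_apply_ι _ _

/-- As a vector space the Clifford algebra is the exterior algebra, and there the inclusion becomes
the map induced by an injective linear map over a field. The contraction terms match because ℝᵐ →
ℝᵐ⁺¹ preserves the bilinear form. -/
lemma inclCl_injective : Function.Injective (inclCl m) := by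
  have hf : Function.Injective (inclIsometry m).toLinearMap := by
    intro v w h
    ext i
    exact congrFun h i.succ
  have h0 : ∀ v : Fin m → ℝ, (0 : QuadraticForm ℝ (Fin (m + 1) → ℝ))
      ((inclIsometry m).toLinearMap v) = (0 : QuadraticForm ℝ (Fin m → ℝ)) v := fun _ => rfl
  let F : (0 : QuadraticForm ℝ (Fin m → ℝ)) →qᵢ (0 : QuadraticForm ℝ (Fin (m + 1) → ℝ)) :=
    { (inclIsometry m).toLinearMap with map_app' := h0 }
  have hF : Function.Injective (CliffordAlgebra.map F) :=
    ExteriorAlgebra.map_injective_field (f := (inclIsometry m).toLinearMap)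
      (LinearMap.ker_eq_bot.2 hf)
  have key : ∀ x, equivExterior (euclideanForm (m + 1)) (inclCl m x) =
      CliffordAlgebra.map F (equivExterior (euclideanForm m) x) := by
    intro x
    simp only [equivExterior, changeFormEquiv_apply]
    induction x using CliffordAlgebra.left_induction with
    | algebraMap r =>
      rw [AlgHom.commutes, changeForm_algebraMap, changeForm_algebraMap, AlgHom.commutes]
    | add x y hx hy => simp only [map_add, hx, hy]
    | ι_mul x a hx =>
      rw [map_mul, inclCl_ι, changeForm_ι_mul, changeForm_ι_mul, hx, contractLeft_map, map_sub,
        map_mul, map_apply_ι]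
      have hd : ∀ d d' : Module.Dual ℝ (Fin m → ℝ), d = d' → ∀ z : ExteriorAlgebra ℝ (Fin m → ℝ),
          contractLeft d z = contractLeft d' z := fun d d' h z => by rw [h]
      congr 2
      refine hd _ _ ?_ _
      ext i
      simp [F, inclIsometry, QuadraticMap.associated_apply, euclideanForm_apply, dotProduct,
        Fin.sum_univ_succ]
  intro x y h
  apply (equivExterior (euclideanForm m)).injective
  apply hF
  rw [← key, ← key, h]

/-- A linear retraction of the inclusion of Clifford algebras. -/
def retrCl (m : ℕ) : Cl (m + 1) →ₗ[ℝ] Cl m :=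
  (LinearMap.exists_leftInverse_of_injective (inclCl m).toLinearMap
    (LinearMap.ker_eq_bot.2 inclCl_injective)).choose

lemma retrCl_inclCl (x : Cl m) : retrCl m (inclCl m x) = x :=
  LinearMap.congr_fun (LinearMap.exists_leftInverse_of_injective (inclCl m).toLinearMap
    (LinearMap.ker_eq_bot.2 inclCl_injective)).choose_spec x

lemma inclCl_mem_spin {x : Cl m} (hx : x ∈ spinGroup (euclideanForm m)) :
    inclCl m x ∈ spinGroup (euclideanForm (m + 1)) := by
  have hs : ∀ y, star (inclCl m y) = inclCl m (star y) := fun y => by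
    rw [star_def, star_def, inclCl, involute_map, reverse_map]
  obtain ⟨⟨⟨u, hu, rfl⟩, -⟩, he⟩ := id hx
  refine spinGroup.mem_iff.2 ⟨pinGroup.mem_iff.2 ⟨⟨Units.map (inclCl m) u, ?_, rfl⟩,
    Unitary.mem_iff.2 ⟨?_, ?_⟩⟩, ?_⟩
  · have : lipschitzGroup (euclideanForm m) ≤
        (lipschitzGroup (euclideanForm (m + 1))).comap (Units.map (inclCl m : Cl m →* _)) := by
      refine (Subgroup.closure_le _).2 ?_
      rintro y ⟨v, hv⟩
      refine Subgroup.subset_closure ⟨Fin.cons 0 v, ?_⟩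
      rw [← inclCl_ι, hv]
      rfl
    exact this hu
  · rw [hs, ← map_mul, spinGroup.star_mul_self_of_mem hx, map_one]
  · rw [hs, ← map_mul, spinGroup.mul_star_self_of_mem hx, map_one]
  · change inclCl m _ ∈ evenOdd (euclideanForm (m + 1)) 0
    have he : (Units.coeHom (Cl m) u) ∈ evenOdd (euclideanForm m) 0 := he
    generalize Units.coeHom (Cl m) u = z at he
    induction z, he using even_induction with
    | algebraMap r =>
      rw [AlgHom.commutes]
      exact (even (euclideanForm (m + 1))).algebraMap_mem r
    | add x y _ _ hx hy => rw [map_add]; exact add_mem hx hy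
    | ι_mul_ι_mul v w x _ hx =>
      rw [map_mul, map_mul, inclCl_ι, inclCl_ι]
      have := SetLike.mul_mem_graded (ι_mul_ι_mem_evenOdd_zero (euclideanForm (m + 1))
        (Fin.cons 0 v) (Fin.cons 0 w)) hx
      rwa [add_zero] at this

/-- The inclusion `Spin(m) → Spin(m + 1)`. -/
def inclSpin (m : ℕ) : Spin m →* Spin (m + 1) where
  toFun x := ⟨inclCl m x, inclCl_mem_spin x.2⟩
  map_one' := Subtype.ext (map_one _)
  map_mul' _ _ := Subtype.ext (map_mul _ _ _)

lemma coe_inclSpin (x : Spin m) : (inclSpin m x : Cl (m + 1)) = inclCl m x := rfl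

/-- The new basis vector anticommutes with all old vectors. Hence it commutes with even elements,
and Spin(m) fixes it. -/
lemma inclCl_mul_ι_zero (x : Cl m) :
    inclCl m x * ι _ (Pi.single 0 1) = ι _ (Pi.single 0 1) * inclCl m (involute x) := by
  induction x using CliffordAlgebra.left_induction with
  | algebraMap r => simp [Algebra.commutes]
  | add x y hx hy => simp only [map_add, add_mul, mul_add, hx, hy]
  | ι_mul x a hx =>
    have : ι (euclideanForm (m + 1)) (Fin.cons 0 a) * ι (euclideanForm (m + 1)) (Pi.single 0 1) =
        -(ι (euclideanForm (m + 1)) (Pi.single 0 1) *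
          ι (euclideanForm (m + 1)) (Fin.cons 0 a)) := by
      rw [eq_neg_iff_add_eq_zero, ι_mul_ι_add_swap_dot]; simp
    rw [map_mul, map_mul, map_mul, inclCl_ι, mul_assoc, hx, ← mul_assoc, this, involute_ι, map_neg,
      inclCl_ι]
    noncomm_ring

lemma spinConj_inclSpin_zero (x : Spin m) :
    spinConj (inclSpin m x) (Pi.single 0 1) = Pi.single 0 1 := by
  apply ι_inj
  rw [ι_spinConj, ← mul_assoc, coe_inclSpin, inclCl_mul_ι_zero, spinGroup.involute_eq x.2,
    mul_assoc, ← coe_inclSpin, spin_mul_star, mul_one]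

lemma spinConj_inclSpin_cons (x : Spin m) (v : Fin m → ℝ) :
    spinConj (inclSpin m x) (Fin.cons 0 v) = Fin.cons 0 (spinConj x v) := by
  apply ι_inj
  have hs : star (inclCl m (x : Cl m)) = inclCl m (star (x : Cl m)) := by
    rw [star_def, star_def, inclCl, involute_map, reverse_map]
  rw [ι_spinConj, coe_inclSpin, hs, ← inclCl_ι, ← inclCl_ι, ι_spinConj, map_mul, map_mul]

lemma spinCover_apply {n : ℕ} (x : Spin n) (i j : Fin n) :
    (spinCover n x).1 i j = spinConj x (Pi.single j 1) i := by
  simp only [spinCover, MonoidHom.coe_mk, OneHom.coe_mk, LinearMap.toMatrix'_apply]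

lemma spinCover_inclSpin_zero (x : Spin m) (i : Fin (m + 1)) :
    (spinCover (m + 1) (inclSpin m x)).1 i 0 = if i = 0 then 1 else 0 := by
  rw [spinCover_apply, spinConj_inclSpin_zero, Pi.single_apply]

lemma single_succ_eq_cons (j : Fin m) :
    (Pi.single j.succ 1 : Fin (m + 1) → ℝ) = Fin.cons 0 (Pi.single j 1 : Fin m → ℝ) := by
  ext i
  refine Fin.cases ?_ (fun i => ?_) i <;> simp [Pi.single_apply, Fin.succ_ne_zero, eq_comm]

lemma spinCover_inclSpin_succ (x : Spin m) (j : Fin m) :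
    (spinCover (m + 1) (inclSpin m x)).1 0 j.succ = 0 ∧
      ∀ i, (spinCover (m + 1) (inclSpin m x)).1 i.succ j.succ = (spinCover m x).1 i j := by
  simp only [spinCover_apply, single_succ_eq_cons, spinConj_inclSpin_cons, Fin.cons_zero,
    Fin.cons_succ, implies_true, and_self]

lemma eq_or_eq_neg_of_spinCover_eq {n : ℕ} {x y : Spin n} (h : spinCover n x = spinCover n y) :
    (x : Cl n) = y ∨ (x : Cl n) = -y := by
  have h1 : spinConj x = spinConj y := LinearMap.toMatrix'.injective (congrArg Subtype.val h)
  have h2 : ∀ v, ι (euclideanForm n) v * ((y⁻¹ * x : Spin n) : Cl n) =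
      ((y⁻¹ * x : Spin n) : Cl n) * ι (euclideanForm n) v := by
    intro v
    have h3 := congrArg (ι (euclideanForm n)) (LinearMap.congr_fun h1 v)
    rw [ι_spinConj, ι_spinConj] at h3
    rw [Submonoid.coe_mul, spin_coe_inv]
    calc ι (euclideanForm n) v * (star (y : Cl n) * x) =
        star (y : Cl n) * (y * (ι (euclideanForm n) v * star (y : Cl n))) * x := by
          rw [← mul_assoc (star (y : Cl n)), spin_star_mul, one_mul, mul_assoc]
      _ = _ := by rw [← h3]; simp only [mul_assoc, spin_star_mul, mul_one]
  have h4 : (x : Cl n) = y * (y⁻¹ * x : Spin n) := by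
    rw [← Submonoid.coe_mul, mul_inv_cancel_left]
  rcases eq_one_or_neg_one_of_commute h2 with h5 | h5 <;> rw [h5] at h4
  · left; rw [h4, mul_one]
  · right; rw [h4, mul_neg, mul_one]

/-- For a unit vector e one has -1 = e · (-e); positivity of `n` supplies e. -/
lemma neg_one_mem_spin {n : ℕ} (hn : 0 < n) : (-1 : Cl n) ∈ spinGroup (euclideanForm n) := by
  let b := EuclideanSpace.basisFun (Fin n) ℝ
  have h := gam_mul_gam_mem b (v := b ⟨0, hn⟩) (w := -b ⟨0, hn⟩) (by simp) (by simp)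
  rwa [map_neg, mul_neg, gam_mul_self_of_norm b (by simp)] at h

/-- The element `-1` of `Spin(n)`, `n > 0`. -/
def negOneSpin {n : ℕ} (hn : 0 < n) : Spin n := ⟨-1, neg_one_mem_spin hn⟩

/-- `Spin(m)` is the stabilizer of the first basis vector in `Spin(m + 1)`. -/
lemma exists_inclSpin_eq (hm : 0 < m) {y : Spin (m + 1)}
    (hy : ∀ i, (spinCover (m + 1) y).1 i 0 = if i = 0 then 1 else 0) :
    ∃ x, inclSpin m x = y := by
  set A := (spinCover (m + 1) y).1 with hA
  have hAA : A.transpose * A = 1 := (Matrix.mem_orthogonalGroup_iff' _ _).1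
    (Matrix.mem_specialOrthogonalGroup_iff.1 (spinCover (m + 1) y).2).1
  have hdet : A.det = 1 := (Matrix.mem_specialOrthogonalGroup_iff.1 (spinCover (m + 1) y).2).2
  -- The first column is the first basis vector and the columns are orthogonal, so the first row
  -- vanishes off the diagonal.
  have hrow : ∀ j : Fin m, A 0 j.succ = 0 := by
    intro j
    have h := congrFun (congrFun hAA 0) j.succ
    rw [Matrix.mul_apply, Fin.sum_univ_succ] at h
    simpa [hy, Fin.succ_ne_zero, Matrix.one_apply, eq_comm] using h
  let B : Matrix (Fin m) (Fin m) ℝ := A.submatrix Fin.succ Fin.succ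
  have hB : B ∈ Matrix.specialOrthogonalGroup (Fin m) ℝ := by
    rw [Matrix.mem_specialOrthogonalGroup_iff, Matrix.mem_orthogonalGroup_iff']
    constructor
    · ext i j
      have h := congrFun (congrFun hAA i.succ) j.succ
      rw [Matrix.mul_apply, Fin.sum_univ_succ] at h
      simpa [hrow, Matrix.mul_apply, Matrix.one_apply, B] using h
    · rw [Matrix.det_succ_column_zero, Fin.sum_univ_succ] at hdet
      simpa [hy, Fin.succ_ne_zero, B] using hdet
  obtain ⟨x, hx⟩ := spinCover_surjective ⟨B, hB⟩
  have hxy : spinCover (m + 1) (inclSpin m x) = spinCover (m + 1) y := by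
    apply Subtype.ext
    ext i j
    refine Fin.cases ?_ (fun j => ?_) j
    · rw [spinCover_inclSpin_zero, ← hy i]
    · refine Fin.cases ?_ (fun i => ?_) i
      · rw [(spinCover_inclSpin_succ x j).1, ← hA, hrow]
      · rw [(spinCover_inclSpin_succ x j).2, hx]; rfl
  rcases eq_or_eq_neg_of_spinCover_eq hxy with h | h
  · exact ⟨x, Subtype.ext h⟩
  -- The preimage of the lower block is known only up to sign; since -1 already lies in Spin(m), the
  -- other sign is also in the image.
  · refine ⟨negOneSpin hm * x, Subtype.ext ?_⟩
    rw [map_mul, Submonoid.coe_mul, h, coe_inclSpin, negOneSpin]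
    simp

end Inclusion

/-! ### Unit quaternions and `Spin(3)` -/

section Kappa

/-- The imaginary quaternion with given coordinates. -/
def imQuat : (Fin 3 → ℝ) →ₗ[ℝ] ℍ[ℝ] where
  toFun v := ⟨0, v 0, v 1, v 2⟩
  map_add' _ _ := QuaternionAlgebra.ext (add_zero (0 : ℝ)).symm rfl rfl rfl
  map_smul' c _ := QuaternionAlgebra.ext (mul_zero c).symm rfl rfl rfl

@[simp] lemma imQuat_re (v : Fin 3 → ℝ) : (imQuat v).re = 0 := rfl
@[simp] lemma imQuat_imI (v : Fin 3 → ℝ) : (imQuat v).imI = v 0 := rfl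
@[simp] lemma imQuat_imJ (v : Fin 3 → ℝ) : (imQuat v).imJ = v 1 := rfl
@[simp] lemma imQuat_imK (v : Fin 3 → ℝ) : (imQuat v).imK = v 2 := rfl

lemma imQuat_single (j : Fin 3) : imQuat (Pi.single j 1) = imUnit j := by
  fin_cases j <;> ext <;> simp [imUnit]

lemma imQuat_imPart {q : ℍ[ℝ]} (hq : q.re = 0) : imQuat (imPart q) = q := by
  ext <;> simp [imPart, hq]

lemma imQuat_mul_self (v : Fin 3 → ℝ) : imQuat v * imQuat v = -((v ⬝ᵥ v : ℝ) : ℍ[ℝ]) := by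
  ext <;> simp [dotProduct, Fin.sum_univ_three] <;> ring

/-- Every unit quaternion is a product of two imaginary ones. -/
lemma exists_eq_imQuat_mul (q : Sp1) :
    ∃ v w : Fin 3 → ℝ, v ⬝ᵥ v = 1 ∧ w ⬝ᵥ w = 1 ∧ q.1 = imQuat v * imQuat w := by
  -- Choose a unit imaginary v orthogonal to the imaginary part of q. Then vq is imaginary, and q =
  -- v · (-vq).
  obtain ⟨v, hv, hq⟩ : ∃ v : Fin 3 → ℝ, v ⬝ᵥ v = 1 ∧
      v 0 * q.1.imI + v 1 * q.1.imJ + v 2 * q.1.imK = 0 := by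
    by_cases h : q.1.imI ^ 2 + q.1.imJ ^ 2 = 0
    · have h1 : q.1.imI = 0 := by nlinarith [sq_nonneg q.1.imI, sq_nonneg q.1.imJ]
      exact ⟨![1, 0, 0], by simp [dotProduct, Fin.sum_univ_three], by simp [h1]⟩
    · have hpos : 0 < q.1.imI ^ 2 + q.1.imJ ^ 2 :=
        lt_of_le_of_ne (by positivity) (Ne.symm h)
      set s := √(q.1.imI ^ 2 + q.1.imJ ^ 2) with hs
      have hs2 : s * s = q.1.imI ^ 2 + q.1.imJ ^ 2 := Real.mul_self_sqrt hpos.le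
      have hs0 : s ≠ 0 := (Real.sqrt_pos.2 hpos).ne'
      refine ⟨![-q.1.imJ / s, q.1.imI / s, 0], ?_, ?_⟩
      · simp [dotProduct, Fin.sum_univ_three]
        field_simp
        linarith
      · simp
        field_simp
        ring
  have hre : (-(imQuat v * q.1)).re = 0 := by
    simp
    linarith
  have hvv : imQuat v * imQuat v = -1 := by rw [imQuat_mul_self, hv]; simp
  have hmul : q.1 = imQuat v * imQuat (imPart (-(imQuat v * q.1))) := by
    rw [imQuat_imPart hre, mul_neg, ← mul_assoc, hvv]; simp
  refine ⟨v, imPart (-(imQuat v * q.1)), hv, ?_, hmul⟩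
  have hn : ∀ u : Fin 3 → ℝ, Quaternion.normSq (imQuat u) = u ⬝ᵥ u := fun u => by
    rw [Quaternion.normSq_def']; simp [dotProduct, Fin.sum_univ_three]; ring
  have := congrArg Quaternion.normSq hmul
  rw [map_mul, hn, hn, hv, one_mul, Quaternion.normSq_def', sp1_normSq] at this
  exact this.symm

/-- The basis vectors in the Clifford algebra of `ℝ³`. -/
def cl3e (i : Fin 3) : Cl 3 := ι (euclideanForm 3) (Pi.single i 1)

lemma cl3e_mul_self (i : Fin 3) : cl3e i * cl3e i = 1 := by
  rw [cl3e, ι_mul_self_dot]; simp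

lemma cl3e_anticomm {i j : Fin 3} (h : i ≠ j) : cl3e i * cl3e j = -(cl3e j * cl3e i) := by
  rw [eq_neg_iff_add_eq_zero, cl3e, cl3e, ι_mul_ι_add_swap_dot]; simp [h]

lemma cl3e_anticomm_assoc {i j : Fin 3} (h : i ≠ j) (x : Cl 3) :
    cl3e i * (cl3e j * x) = -(cl3e j * (cl3e i * x)) := by
  rw [← mul_assoc, cl3e_anticomm h, neg_mul, mul_assoc]

lemma cl3e_mul_self_assoc (i : Fin 3) (x : Cl 3) : cl3e i * (cl3e i * x) = x := by
  rw [← mul_assoc, cl3e_mul_self, one_mul]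

lemma cl3e_10 : cl3e 1 * cl3e 0 = -(cl3e 0 * cl3e 1) := cl3e_anticomm (by decide)
lemma cl3e_20 : cl3e 2 * cl3e 0 = -(cl3e 0 * cl3e 2) := cl3e_anticomm (by decide)
lemma cl3e_21 : cl3e 2 * cl3e 1 = -(cl3e 1 * cl3e 2) := cl3e_anticomm (by decide)
lemma cl3e_10' (x : Cl 3) : cl3e 1 * (cl3e 0 * x) = -(cl3e 0 * (cl3e 1 * x)) :=
  cl3e_anticomm_assoc (by decide) x
lemma cl3e_20' (x : Cl 3) : cl3e 2 * (cl3e 0 * x) = -(cl3e 0 * (cl3e 2 * x)) :=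
  cl3e_anticomm_assoc (by decide) x
lemma cl3e_21' (x : Cl 3) : cl3e 2 * (cl3e 1 * x) = -(cl3e 1 * (cl3e 2 * x)) :=
  cl3e_anticomm_assoc (by decide) x

/-- The volume element of `Cl(3)`. -/
def cl3vol : Cl 3 := cl3e 0 * (cl3e 1 * cl3e 2)

lemma cl3vol_comm_e (i : Fin 3) : cl3vol * cl3e i = cl3e i * cl3vol := by
  fin_cases i <;> simp [cl3vol, mul_assoc, cl3e_mul_self_assoc, cl3e_mul_self, cl3e_20,
    cl3e_21, cl3e_10', cl3e_20', cl3e_21']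

lemma ι_eq_sum_cl3e (v : Fin 3 → ℝ) :
    ι (euclideanForm 3) v = v 0 • cl3e 0 + v 1 • cl3e 1 + v 2 • cl3e 2 := by
  conv_lhs => rw [show v = ∑ i, v i • (Pi.single i 1 : Fin 3 → ℝ) from pi_eq_sum_univ' v, map_sum,
    Fin.sum_univ_three]
  simp [cl3e]

lemma cl3vol_comm (v : Fin 3 → ℝ) :
    cl3vol * ι (euclideanForm 3) v = ι (euclideanForm 3) v * cl3vol := by
  simp only [ι_eq_sum_cl3e, mul_add, add_mul, mul_smul_comm, smul_mul_assoc, cl3vol_comm_e]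

lemma cl3vol_mul_self : cl3vol * cl3vol = -1 := by
  simp [cl3vol, mul_assoc, cl3e_mul_self, cl3e_10', cl3e_20', cl3e_21']

/-- The isomorphism of `ℍ` with the even part of `Cl(3)`, as an algebra homomorphism. -/
def quatToCl : ℍ[ℝ] →ₐ[ℝ] Cl 3 :=
  QuaternionAlgebra.Basis.liftHom
    { i := -(cl3e 1 * cl3e 2)
      j := cl3e 0 * cl3e 2
      k := -(cl3e 0 * cl3e 1)
      i_mul_i := by
        simp [mul_assoc, cl3e_mul_self, cl3e_21']
      j_mul_j := by
        simp [mul_assoc, cl3e_mul_self, cl3e_20']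
      i_mul_j := by
        simp [mul_assoc, cl3e_mul_self, cl3e_20', cl3e_10]
      j_mul_i := by
        simp [mul_assoc, cl3e_mul_self, cl3e_21'] }

/-- The volume element is central of square -1, so multiplication by it identifies vectors with
imaginary quaternions. Conjugation on ℝ³ ⊂ Cl(3) thereby becomes conjugation on Im ℍ, which is why
the two coverings of SO(3) agree. -/
lemma quatToCl_imQuat (v : Fin 3 → ℝ) :
    quatToCl (imQuat v) = -(cl3vol * ι (euclideanForm 3) v) := by
  rw [ι_eq_sum_cl3e]
  change algebraMap ℝ _ 0 + v 0 • (-(cl3e 1 * cl3e 2)) + v 1 • (cl3e 0 * cl3e 2) +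
    v 2 • (-(cl3e 0 * cl3e 1)) = _
  simp [cl3vol, mul_add, mul_assoc, cl3e_mul_self_assoc, cl3e_mul_self, cl3e_10', cl3e_20,
    cl3e_21]
  abel

lemma quatToCl_imQuat_mul (v w : Fin 3 → ℝ) : quatToCl (imQuat v * imQuat w) =
    -(ι (euclideanForm 3) v * ι (euclideanForm 3) w) := by
  rw [map_mul, quatToCl_imQuat, quatToCl_imQuat, neg_mul_neg, cl3vol_comm, mul_assoc,
    ← mul_assoc cl3vol, cl3vol_mul_self]
  simp

lemma quatToCl_mem_spin (q : Sp1) : quatToCl q.1 ∈ spinGroup (euclideanForm 3) := by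
  obtain ⟨v, w, hv, hw, hq⟩ := exists_eq_imQuat_mul q
  let b := EuclideanSpace.basisFun (Fin 3) ℝ
  have hn : ∀ u : Fin 3 → ℝ, u ⬝ᵥ u = 1 → ‖(WithLp.toLp 2 u : EuclideanSpace ℝ (Fin 3))‖ = 1 := by
    intro u hu
    rw [EuclideanSpace.norm_eq, Real.sqrt_eq_one]
    simpa [dotProduct, sq] using hu
  have := gam_mul_gam_mem b (v := -WithLp.toLp 2 v) (w := WithLp.toLp 2 w)
    (by rw [norm_neg, hn v hv]) (hn w hw)
  rw [map_neg, neg_mul] at this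
  rw [hq, quatToCl_imQuat_mul]
  exact this

/-- The isomorphism `Sp(1) ≅ Spin(3)`. -/
def sp1ToSpin : Sp1 →* Spin 3 where
  toFun q := ⟨quatToCl q.1, quatToCl_mem_spin q⟩
  map_one' := Subtype.ext (map_one _)
  map_mul' _ _ := Subtype.ext (map_mul _ _ _)

lemma coe_sp1ToSpin (q : Sp1) : (sp1ToSpin q : Cl 3) = quatToCl q.1 := rfl

lemma conj_re_zero (q : ℍ[ℝ]) (v : Fin 3 → ℝ) : (q * imQuat v * star q).re = 0 := by
  simp
  ring

lemma spinConj_sp1ToSpin (q : Sp1) (v : Fin 3 → ℝ) :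
    spinConj (sp1ToSpin q) v = imPart (q.1 * imQuat v * star q.1) := by
  apply ι_inj
  have hst : star (sp1ToSpin q : Cl 3) = quatToCl (star q.1) := by
    rw [← spin_coe_inv, ← map_inv]; rfl
  have hinj : ∀ x y : Cl 3, -(cl3vol * x) = -(cl3vol * y) → x = y := by
    intro x y h
    have := congrArg (cl3vol * ·) h
    simpa [← mul_assoc, cl3vol_mul_self] using this
  apply hinj
  have hcomm : cl3vol * quatToCl q.1 = quatToCl q.1 * cl3vol := by
    obtain ⟨v, w, hv, hw, hq⟩ := exists_eq_imQuat_mul q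
    rw [hq, quatToCl_imQuat_mul, mul_neg, ← mul_assoc, cl3vol_comm, mul_assoc, cl3vol_comm]
    noncomm_ring
  rw [← quatToCl_imQuat (imPart _), imQuat_imPart (conj_re_zero _ _), map_mul, map_mul, quatToCl_imQuat,
    ι_spinConj, hst, coe_sp1ToSpin, ← mul_assoc, ← mul_assoc, hcomm]
  noncomm_ring

/-- Under `Sp(1) ≅ Spin(3)` the two double coverings of `SO(3)` agree. -/
lemma spinCover_sp1ToSpin (q : Sp1) : spinCover 3 (sp1ToSpin q) = sp1Cover q := by
  apply Subtype.ext
  ext i j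
  rw [spinCover_apply, spinConj_sp1ToSpin, imQuat_single]
  rfl

lemma sp1ToSpin_neg_one : (sp1ToSpin (-1) : Cl 3) = -1 := by
  rw [coe_sp1ToSpin, show ((-1 : Sp1) : ℍ[ℝ]) = -1 from rfl, map_neg, map_one]

lemma dSmooth_sp1ToSpin : DSmooth sp1ToSpin := by
  intro n p hp
  refine isPlot_subtype_iff.2 (isPlot_iff_linSmoothAt.2 fun t => ?_)
  have := isPlot_iff_linSmoothAt.1 (isPlot_subtype_iff.1 hp) t
  exact this.linear quatToCl.toLinearMap

end Kappa

/-! ### Local smooth lifts of rotations -/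

section LocalLift

variable {V : Type*} [NormedAddCommGroup V] [InnerProductSpace ℝ V] {N : ℕ}
  (b : OrthonormalBasis (Fin N) ℝ V)

lemma reflection_orthogonal_singleton_apply (v w : V) :
    (ℝ ∙ v)ᗮ.reflection w = w - (2 * inner ℝ v w / ‖v‖ ^ 2) • v := by
  rw [Submodule.reflection_orthogonal_apply, Submodule.reflection_singleton_apply,
    neg_sub, ← Nat.cast_smul_eq_nsmul ℝ, smul_smul]
  congr 2
  simp only [RCLike.ofReal_real_eq_id, id_eq, Nat.cast_ofNat]
  ring

/-- The rotation in the plane of `v` and `w` taking `v` to `w`, for unit vectors `w ≠ -v`. -/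
def rotor (v w : V) : V ≃ₗᵢ[ℝ] V := (ℝ ∙ (v + w))ᗮ.reflection * (ℝ ∙ v)ᗮ.reflection

lemma norm_add_sq_unit {v w : V} (hv : ‖v‖ = 1) (hw : ‖w‖ = 1) :
    ‖v + w‖ ^ 2 = 2 + 2 * inner ℝ v w := by
  rw [norm_add_sq_real, hv, hw]; ring

lemma rotor_apply_self {v w : V} (hv : ‖v‖ = 1) (hw : ‖w‖ = 1) (h : v + w ≠ 0) :
    rotor v w v = w := by
  change (ℝ ∙ (v + w))ᗮ.reflection ((ℝ ∙ v)ᗮ.reflection v) = w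
  have h2 : ‖v + w‖ ^ 2 ≠ 0 := by simpa using h
  rw [reflection_orthogonal_singleton_apply, reflection_orthogonal_singleton_apply v,
    real_inner_self_eq_norm_sq, hv]
  have : v - (2 * 1 ^ 2 / 1 ^ 2 : ℝ) • v = -v := by
    norm_num [two_smul]
  rw [this, inner_neg_right, inner_add_left, real_inner_self_eq_norm_sq, hv,
    real_inner_comm v w, show (2 * -(1 ^ 2 + inner ℝ v w) / ‖v + w‖ ^ 2 : ℝ) = -1 by
      rw [norm_add_sq_unit hv hw] at h2 ⊢
      have h3 : 1 + inner ℝ v w ≠ 0 := fun h0 => h2 (by linear_combination 2 * h0)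
      field_simp]
  simp

lemma rotor_apply_of_orthogonal {v w z : V} (hv : inner ℝ v z = 0) (hw : inner ℝ w z = 0) :
    rotor v w z = z := by
  change (ℝ ∙ (v + w))ᗮ.reflection ((ℝ ∙ v)ᗮ.reflection z) = z
  rw [reflection_orthogonal_singleton_apply v, hv, reflection_orthogonal_singleton_apply]
  simp [inner_add_left, hv, hw]

/-- The element of the spin group covering `rotor v w`. -/
def rotorCl (v w : V) : Cl N := gam b (‖v + w‖⁻¹ • (v + w)) * gam b v

lemma rotorCl_mem {v w : V} (hv : ‖v‖ = 1) (h : v + w ≠ 0) :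
    rotorCl b v w ∈ spinGroup (euclideanForm N) :=
  gam_mul_gam_mem b (by rw [norm_smul, norm_inv, norm_norm,
    inv_mul_cancel₀ (norm_ne_zero_iff.2 h)]) hv

lemma covers_rotorCl {v w : V} (hv : ‖v‖ = 1) (h : v + w ≠ 0) :
    Covers b (rotorCl b v w) (rotor v w) := by
  have h1 : ‖(‖v + w‖⁻¹ • (v + w))‖ = 1 := by
    rw [norm_smul, norm_inv, norm_norm, inv_mul_cancel₀ (norm_ne_zero_iff.2 h)]
  refine (covers_gamPair (b := b) h1 hv).congr fun z => ?_
  change _ = (ℝ ∙ (v + w))ᗮ.reflection ((ℝ ∙ v)ᗮ.reflection z)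
  rw [reflection_orthogonal_singleton_apply v, hv, one_pow, div_one,
    reflection_orthogonal_singleton_apply, real_inner_smul_left, smul_smul]
  congr 2
  field_simp

variable {F : Type*} [NormedAddCommGroup F] [NormedSpace ℝ F]

lemma linSmoothAt_rotorCl [FiniteDimensional ℝ V] {v w : F → V} {t : F} (hv : ContDiffAt ℝ ∞ v t)
    (hw : ContDiffAt ℝ ∞ w t) (h : v t + w t ≠ 0) :
    LinSmoothAt (fun s => rotorCl b (v s) (w s)) t := by
  refine LinSmoothAt.mul (LinSmoothAt.linear (x := fun s => ‖v s + w s‖⁻¹ • (v s + w s))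
    (linSmoothAt_iff_contDiffAt.2 ?_) _)
    (LinSmoothAt.linear (linSmoothAt_iff_contDiffAt.2 hv) _)
  exact (((hv.add hw).norm ℝ h).inv (norm_ne_zero_iff.2 h)).smul (hv.add hw)

/-- A smooth family of isometries through the identity lifts locally to the spin group. -/
lemma exists_local_spin_lift (A : F → V ≃ₗᵢ[ℝ] V) (t₀ : F)
    (hA : ∀ v, ContDiffAt ℝ ∞ (fun t => A t v) t₀) (h0 : A t₀ = 1) :
    ∃ s : F → Cl N, LinSmoothAt s t₀ ∧
      ∀ᶠ t in nhds t₀, ∃ x : Spin N, (x : Cl N) = s t ∧ Covers b x (A t) := by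
  have : FiniteDimensional ℝ V := b.toBasis.finiteDimensional_of_finite
  -- Induction on the basis vectors not yet fixed: dividing by the rotor that takes `b i` to its
  -- image fixes `b i`. The rotor is the identity on vectors orthogonal to both, so those fixed
  -- before remain fixed.
  have key : ∀ (J : Finset (Fin N)) (A : F → V ≃ₗᵢ[ℝ] V),
      (∀ v, ContDiffAt ℝ ∞ (fun t => A t v) t₀) → A t₀ = 1 →
      (∀ᶠ t in nhds t₀, ∀ i ∉ J, A t (b i) = b i) →
      ∃ s : F → Cl N, LinSmoothAt s t₀ ∧
        ∀ᶠ t in nhds t₀, ∃ x : Spin N, (x : Cl N) = s t ∧ Covers b x (A t) := by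
    intro J
    induction J using Finset.induction_on with
    | empty =>
      intro A _ _ hfix
      refine ⟨fun _ => 1, linSmoothAt_const _ _, hfix.mono fun t ht => ⟨1, rfl, ?_⟩⟩
      have h1 : (A t).toLinearEquiv.toLinearMap = LinearMap.id :=
        b.toBasis.ext fun i => by simpa using ht i (by simp)
      exact Covers.one.congr fun v => (LinearMap.congr_fun h1 v).symm
    | insert i J hi ih =>
      intro A hA h0 hfix
      have hb : ‖b i‖ = 1 := b.orthonormal.1 i
      have hw : ∀ t, ‖A t (b i)‖ = 1 := fun t => by rw [LinearIsometryEquiv.norm_map, hb]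
      -- The rotor is singular only for antipodal vectors; at the identity the image of `b i` is `b
      -- i` itself, so nearby rotors exist and depend smoothly on the parameter.
      have hne0 : b i + A t₀ (b i) ≠ 0 := by
        rw [h0, LinearIsometryEquiv.coe_one, id_eq, ← two_smul ℝ]
        exact smul_ne_zero two_ne_zero (norm_ne_zero_iff.1 (by rw [hb]; exact one_ne_zero))
      have hcont : ContDiffAt ℝ ∞ (fun t => b i + A t (b i)) t₀ := contDiffAt_const.add (hA _)
      have hne : ∀ᶠ t in nhds t₀, b i + A t (b i) ≠ 0 :=
        hcont.continuousAt.eventually_ne hne0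
      have hrefl : ∀ (n : F → V) (z : F → V), ContDiffAt ℝ ∞ n t₀ → ContDiffAt ℝ ∞ z t₀ →
          n t₀ ≠ 0 → ContDiffAt ℝ ∞ (fun t => (ℝ ∙ n t)ᗮ.reflection (z t)) t₀ := by
        intro n z hn hz hn0
        simp only [reflection_orthogonal_singleton_apply]
        exact hz.sub (((contDiffAt_const.mul (hn.inner ℝ hz)).div (hn.norm_sq ℝ)
          (by simpa using hn0)).smul hn)
      let A' : F → V ≃ₗᵢ[ℝ] V := fun t => (rotor (b i) (A t (b i)))⁻¹ * A t
      have hA' : ∀ v, ContDiffAt ℝ ∞ (fun t => A' t v) t₀ := by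
        intro v
        have hb0 : b i ≠ 0 := norm_ne_zero_iff.1 (by rw [hb]; exact one_ne_zero)
        have := hrefl (fun _ => b i) _ contDiffAt_const
          (hrefl (fun t => b i + A t (b i)) (fun t => A t v) hcont (hA v) hne0) hb0
        refine this.congr_of_eventuallyEq (Filter.Eventually.of_forall fun t => ?_)
        simp only [A', rotor, mul_inv_rev]
        rfl
      have h0' : A' t₀ = 1 := by
        change _ * _ = _
        rw [inv_mul_eq_one, h0]
        ext v
        change (ℝ ∙ (b i + b i))ᗮ.reflection ((ℝ ∙ b i)ᗮ.reflection v) = v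
        have h3 : (ℝ ∙ (b i + b i)) = ℝ ∙ b i := by
          rw [← two_smul ℝ]
          exact Submodule.span_singleton_smul_eq (IsUnit.mk0 _ two_ne_zero) _
        simp only [h3]
        exact Submodule.reflection_reflection _ _
      have hfix' : ∀ᶠ t in nhds t₀, ∀ j ∉ J, A' t (b j) = b j := by
        filter_upwards [hfix, hne] with t ht hnet j hj
        change (rotor (b i) (A t (b i))).symm (A t (b j)) = b j
        rw [LinearIsometryEquiv.symm_apply_eq]
        by_cases hji : j = i
        · subst hji
          rw [rotor_apply_self hb (hw t) hnet]
        · have hAj := ht j (by simp [hji, hj])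
          have hij : inner ℝ (b i) (b j) = 0 := b.orthonormal.2 (Ne.symm hji)
          rw [hAj, rotor_apply_of_orthogonal hij]
          rw [← hAj, LinearIsometryEquiv.inner_map_map, hij]
      obtain ⟨s, hs, hs'⟩ := ih A' hA' h0' hfix'
      refine ⟨fun t => rotorCl b (b i) (A t (b i)) * s t,
        (linSmoothAt_rotorCl b contDiffAt_const (hA _) hne0).mul hs, ?_⟩
      filter_upwards [hs', hne] with t ⟨x, hx, hx'⟩ ht
      refine ⟨⟨_, rotorCl_mem b hb ht⟩ * x, by rw [← hx]; rfl, ?_⟩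
      refine ((covers_rotorCl b hb ht).mul hx').congr fun v => ?_
      change (rotor (b i) (A t (b i))) ((rotor (b i) (A t (b i))).symm (A t v)) = A t v
      rw [LinearIsometryEquiv.apply_symm_apply]
  exact key Finset.univ A hA h0 (Filter.Eventually.of_forall fun t i hi => by simp at hi)

end LocalLift

/-! ### Quaternionic reflections and generation of `Sp(k)` -/

section Symplectic

variable {k : ℕ}

/-- Right multiplication of a vector by a quaternion. -/
def rmul (q : ℍ[ℝ]) : QuatSpace k →ₗ[ℝ] QuatSpace k where
  toFun v := WithLp.toLp 2 fun i => v i * q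
  map_add' v w := by ext1 i; simp [add_mul]
  map_smul' c v := by ext1 i; simp

@[simp] lemma rmul_apply (q : ℍ[ℝ]) (v : QuatSpace k) (i : Fin k) : rmul q v i = v i * q := rfl

lemma rmul_rmul (p q : ℍ[ℝ]) (v : QuatSpace k) : rmul q (rmul p v) = rmul (p * q) v := by
  ext1 i; simp [mul_assoc]

@[simp] lemma rmul_one (v : QuatSpace k) : rmul 1 v = v := by ext1 i; simp

lemma rmul_add (p q : ℍ[ℝ]) (v : QuatSpace k) : rmul (p + q) v = rmul p v + rmul q v := by
  ext1 i; simp [mul_add]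

lemma rmul_neg (p : ℍ[ℝ]) (v : QuatSpace k) : rmul (-p) v = -rmul p v := by
  ext1 i; simp

lemma rmul_smul (r : ℝ) (p : ℍ[ℝ]) (v : QuatSpace k) : rmul (r • p) v = r • rmul p v := by
  ext1 i; simp

@[simp] lemma rmul_zero (v : QuatSpace k) : rmul 0 v = 0 := by ext1 i; simp

/-- The quaternionic inner product `u* v`. -/
def herm (u v : QuatSpace k) : ℍ[ℝ] := ∑ i, star (u i) * v i

lemma herm_add_right (u v w : QuatSpace k) : herm u (v + w) = herm u v + herm u w := by
  simp [herm, mul_add, Finset.sum_add_distrib]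

lemma herm_sub_right (u v w : QuatSpace k) : herm u (v - w) = herm u v - herm u w := by
  simp [herm, mul_sub, Finset.sum_sub_distrib]

lemma herm_sub_left (u v w : QuatSpace k) : herm (u - v) w = herm u w - herm v w := by
  simp [herm, sub_mul, Finset.sum_sub_distrib]

lemma herm_rmul_right (u v : QuatSpace k) (q : ℍ[ℝ]) : herm u (rmul q v) = herm u v * q := by
  simp [herm, Finset.sum_mul, mul_assoc]

lemma herm_rmul_left (u v : QuatSpace k) (q : ℍ[ℝ]) :
    herm (rmul q u) v = star q * herm u v := by
  simp [herm, Finset.mul_sum, mul_assoc]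

lemma herm_smul_left (u v : QuatSpace k) (r : ℝ) : herm (r • u) v = r • herm u v := by
  simp [herm, Finset.smul_sum]

lemma herm_smul_right (u v : QuatSpace k) (r : ℝ) : herm u (r • v) = r • herm u v := by
  simp [herm, Finset.smul_sum]

lemma star_herm (u v : QuatSpace k) : star (herm u v) = herm v u := by
  simp [herm]

lemma inner_eq_re_herm (u v : QuatSpace k) : inner ℝ u v = (herm u v).re := by
  rw [PiLp.inner_apply]
  have : ∀ f : Fin k → ℍ[ℝ], (∑ i, f i).re = ∑ i, (f i).re := fun f =>
    map_sum (⟨⟨fun q => q.re, rfl⟩, fun _ _ => rfl⟩ : ℍ[ℝ] →+ ℝ) f Finset.univ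
  rw [herm, this]
  refine Finset.sum_congr rfl fun i _ => ?_
  rw [Quaternion.inner_def]
  simp

lemma herm_self (u : QuatSpace k) : herm u u = ((‖u‖ ^ 2 : ℝ) : ℍ[ℝ]) := by
  have h1 : star (herm u u) = herm u u := star_herm u u
  have h2 : (herm u u).re = ‖u‖ ^ 2 := by
    rw [← inner_eq_re_herm, real_inner_self_eq_norm_sq]
  rw [← h2]
  exact Quaternion.star_eq_self.1 h1

lemma herm_self_of_norm {u : QuatSpace k} (hu : ‖u‖ = 1) : herm u u = 1 := by
  rw [herm_self, hu]; simp

/-- The action of `Sp(k)` on `ℍᵏ`. -/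
def spAct : Sp k →* (QuatSpace k ≃ₗᵢ[ℝ] QuatSpace k) :=
  spSpIsometry.comp (MonoidHom.inl _ _)

lemma spAct_apply (A : Sp k) (v : QuatSpace k) (i : Fin k) :
    spAct A v i = ∑ j, A.1 i j * v j := by
  change ((A.1.mulVec v.ofLp) i) * star (1 : ℍ[ℝ]) = _
  rw [star_one, mul_one]
  rfl

lemma spSpIsometry_eq (A : Sp k) (q : Sp1) (v : QuatSpace k) :
    spSpIsometry (A, q) v = rmul (star q.1) (spAct A v) := by
  ext1 i
  rw [rmul_apply, spAct_apply]
  rfl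

lemma spAct_rmul (A : Sp k) (q : ℍ[ℝ]) (v : QuatSpace k) :
    spAct A (rmul q v) = rmul q (spAct A v) := by
  ext1 i
  simp [spAct_apply, Finset.sum_mul, mul_assoc]

/-- The standard basis vectors of `ℍᵏ`. -/
def qe (l : Fin k) : QuatSpace k := WithLp.toLp 2 (Pi.single l 1)

lemma qe_apply (l i : Fin k) : qe l i = if i = l then 1 else 0 := by
  simp [qe]

lemma norm_qe (l : Fin k) : ‖qe l‖ = 1 := by
  have h : herm (qe l) (qe l) = 1 := by simp [herm, qe_apply]
  have h2 := inner_eq_re_herm (qe l) (qe l)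
  rw [h, real_inner_self_eq_norm_sq] at h2
  exact (pow_eq_one_iff_of_nonneg (norm_nonneg _) two_ne_zero).1 h2

lemma herm_qe_left (l : Fin k) (v : QuatSpace k) : herm (qe l) v = v l := by
  simp [herm, qe_apply, apply_ite star]

lemma spAct_qe (A : Sp k) (l i : Fin k) : spAct A (qe l) i = A.1 i l := by
  simp [spAct_apply, qe_apply]

lemma sp_ext {A B : Sp k} (h : ∀ l, spAct A (qe l) = spAct B (qe l)) : A = B := by
  apply Subtype.ext
  ext1 i j
  rw [← spAct_qe, ← spAct_qe, h]

lemma herm_spAct (A : Sp k) (u v : QuatSpace k) : herm (spAct A u) (spAct A v) = herm u v := by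
  have hA : star A.1 * A.1 = 1 := Unitary.coe_star_mul_self A
  change star (fun i => spAct A u i) ⬝ᵥ (fun i => spAct A v i) = star u.ofLp ⬝ᵥ v.ofLp
  have h : ∀ w : QuatSpace k, (fun i => spAct A w i) = A.1.mulVec w.ofLp := fun w => by
    funext i; rw [spAct_apply]; rfl
  rw [h, h, Matrix.star_mulVec, ← Matrix.dotProduct_mulVec, Matrix.mulVec_mulVec,
    ← Matrix.star_eq_conjTranspose, hA, Matrix.one_mulVec]

/-- The matrix `1 + u s u*`. -/
def qreflMat (u : QuatSpace k) (s : ℍ[ℝ]) : Matrix (Fin k) (Fin k) ℍ[ℝ] :=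
  1 + Matrix.of fun i j => u i * s * star (u j)

lemma star_qreflMat (u : QuatSpace k) (s : ℍ[ℝ]) :
    star (qreflMat u s) = qreflMat u (star s) := by
  rw [qreflMat, star_add, star_one]
  congr 1
  ext1 i j
  simp [Matrix.star_apply, mul_assoc]

lemma qreflMat_mul (u : QuatSpace k) (s t : ℍ[ℝ]) :
    qreflMat u s * qreflMat u t = qreflMat u (s + t + (‖u‖ ^ 2) • (s * t)) := by
  have h : (Matrix.of fun i j => u i * s * star (u j)) * (Matrix.of fun i j => u i * t * star (u j))
      = Matrix.of fun i j => u i * ((‖u‖ ^ 2) • (s * t)) * star (u j) := by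
    ext1 i j
    rw [Matrix.mul_apply]
    simp only [Matrix.of_apply]
    calc ∑ l, u i * s * star (u l) * (u l * t * star (u j))
        = u i * s * (∑ l, star (u l) * u l) * (t * star (u j)) := by
          simp only [Finset.mul_sum, Finset.sum_mul, mul_assoc]
      _ = u i * s * ((‖u‖ ^ 2 : ℝ) : ℍ[ℝ]) * (t * star (u j)) := by
          rw [← herm_self]; rfl
      _ = _ := by
          rw [← Quaternion.coe_mul_eq_smul, ← mul_assoc (u i) _ (s * t),
            ← Quaternion.coe_commutes _ (u i), ← Quaternion.coe_commutes _ (u i * s)]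
          simp only [mul_assoc]
  rw [qreflMat, qreflMat, add_mul, mul_add, mul_add, one_mul, mul_one, one_mul, h, qreflMat, add_assoc]
  congr 1
  ext1 i j
  simp only [Matrix.add_apply, Matrix.of_apply]
  noncomm_ring

/-- The condition on `s` under which `1 + u s u*` is symplectic. -/
def IsReflParam (u : QuatSpace k) (s : ℍ[ℝ]) : Prop :=
  s + star s + (‖u‖ ^ 2) • (s * star s) = 0

/-- The quaternionic reflection `v ↦ v + u s (u* v)`. -/
def qrefl (u : QuatSpace k) (s : ℍ[ℝ]) (h : IsReflParam u s) : Sp k :=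
  ⟨qreflMat u s, Unitary.mem_iff.2 ⟨by
    have h' : star s + s + (‖u‖ ^ 2) • (star s * s) = 0 := by
      rw [Quaternion.star_mul_self, ← Quaternion.self_mul_star, add_comm (star s)]
      exact h
    rw [star_qreflMat, qreflMat_mul, h']
    ext1 i j; simp [qreflMat], by
    rw [star_qreflMat, qreflMat_mul, show _ = _ from h]
    ext1 i j; simp [qreflMat]⟩⟩

lemma spAct_qrefl (u : QuatSpace k) (s : ℍ[ℝ]) (h : IsReflParam u s) (v : QuatSpace k) :
    spAct (qrefl u s h) v = v + rmul (s * herm u v) u := by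
  ext1 i
  rw [spAct_apply]
  simp only [qrefl, qreflMat, Matrix.add_apply, Matrix.of_apply, add_mul, Finset.sum_add_distrib,
    PiLp.add_apply, rmul_apply, herm, Finset.mul_sum, mul_assoc]
  simp [Matrix.one_apply]

lemma isReflParam_of_unit {u : QuatSpace k} (hu : ‖u‖ = 1) (q : Sp1) :
    IsReflParam u (q.1 - 1) := by
  have hq : q.1 * star q.1 = 1 := Unitary.coe_mul_star_self q
  rw [IsReflParam, hu, one_pow, one_smul, star_sub, star_one, sub_mul, mul_sub, hq]
  noncomm_ring

/-- The quaternionic reflection which is left multiplication by `q` on `uℍ` and the identity on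
the orthogonal complement. -/
def urefl (u : QuatSpace k) (hu : ‖u‖ = 1) : Sp1 →* Sp k where
  toFun q := qrefl u (q.1 - 1) (isReflParam_of_unit hu q)
  map_one' := Subtype.ext (by ext1 i j; simp [qrefl, qreflMat])
  map_mul' p q := Subtype.ext (by
    change qreflMat u _ = qreflMat u _ * qreflMat u _
    rw [qreflMat_mul, hu, one_pow, one_smul]
    congr 1
    rw [Submonoid.coe_mul]
    noncomm_ring)

lemma spAct_urefl {u : QuatSpace k} (hu : ‖u‖ = 1) (q : Sp1) (v : QuatSpace k) :
    spAct (urefl u hu q) v = v + rmul ((q.1 - 1) * herm u v) u :=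
  spAct_qrefl u _ (isReflParam_of_unit hu q) v

lemma spAct_urefl_self {u : QuatSpace k} (hu : ‖u‖ = 1) (q : Sp1) (p : ℍ[ℝ]) :
    spAct (urefl u hu q) (rmul p u) = rmul (q.1 * p) u := by
  rw [spAct_urefl, herm_rmul_right, herm_self_of_norm hu, ← rmul_add]
  congr 2
  noncomm_ring

lemma spAct_urefl_of_orthogonal {u v : QuatSpace k} (hu : ‖u‖ = 1) (q : Sp1)
    (h : herm u v = 0) : spAct (urefl u hu q) v = v := by
  rw [spAct_urefl, h]; simp

lemma norm_rmul {p : ℍ[ℝ]} (hp : ‖p‖ = 1) (u : QuatSpace k) : ‖rmul p u‖ = ‖u‖ := by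
  rw [PiLp.norm_eq_of_L2, PiLp.norm_eq_of_L2]
  simp [hp]

lemma norm_sp1 (q : Sp1) : ‖q.1‖ = 1 := CStarRing.norm_coe_unitary q

/-- Another generator of the same quaternionic line conjugates the parameter. Thus the reflections
with parameter i, along all unit vectors, include those with any imaginary unit parameter. -/
lemma urefl_rmul {u : QuatSpace k} (hu : ‖u‖ = 1) (p q : Sp1)
    (h : ‖rmul p.1 u‖ = 1) : urefl (rmul p.1 u) h q = urefl u hu (p * q * p⁻¹) := by
  refine sp_ext fun l => ?_
  rw [spAct_urefl, spAct_urefl, rmul_rmul, herm_rmul_left]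
  congr 2
  have hp : p.1 * star p.1 = 1 := Unitary.coe_mul_star_self p
  have hi : ((p⁻¹ : Sp1) : ℍ[ℝ]) = star p.1 := rfl
  rw [Submonoid.coe_mul, Submonoid.coe_mul, hi]
  simp only [sub_mul, mul_sub, ← mul_assoc, mul_one, hp]

lemma conj_urefl (A : Sp k) {u : QuatSpace k} (hu : ‖u‖ = 1) (q : Sp1) (h : ‖spAct A u‖ = 1) :
    A * urefl u hu q * A⁻¹ = urefl (spAct A u) h q := by
  rw [mul_inv_eq_iff_eq_mul]
  refine sp_ext fun l => ?_
  rw [map_mul, map_mul]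
  change spAct A (spAct (urefl u hu q) (qe l)) = spAct (urefl (spAct A u) h q) (spAct A (qe l))
  rw [spAct_urefl, spAct_urefl, map_add, spAct_rmul, herm_spAct]

/-- The quaternionic reflection taking the unit vector `v` to the unit vector `w`. -/
def householder (v w : QuatSpace k) (hv : ‖v‖ = 1) (hw : ‖w‖ = 1) : Sp k :=
  -- With d = v - w, the parameter -(d*v)⁻¹ gives v + d s (d*v) = v - d = w. It is admissible
  -- because d*v plus its conjugate is ‖d‖². For v = w the inverse of 0 is 0, and the reflection is
  -- the identity.
  qrefl (v - w) (-(herm (v - w) v)⁻¹) (by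
    have h1 : herm (v - w) v + star (herm (v - w) v) = ((‖v - w‖ ^ 2 : ℝ) : ℍ[ℝ]) := by
      rw [← herm_self, star_herm]
      simp only [herm_sub_left, herm_sub_right, herm_self_of_norm hv, herm_self_of_norm hw]
      noncomm_ring
    by_cases h0 : herm (v - w) v = 0
    · simp [h0, IsReflParam]
    · generalize herm (v - w) v = α at *
      rw [IsReflParam, star_neg, neg_mul_neg, star_inv₀, ← Quaternion.coe_mul_eq_smul, ← h1]
      have hs : star α ≠ 0 := by simpa using h0
      have hc : α * star α = star α * α := by
        rw [Quaternion.self_mul_star, Quaternion.star_mul_self]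
      have : (α + star α) * (α⁻¹ * (star α)⁻¹) = (star α)⁻¹ + α⁻¹ := by
        rw [add_mul, ← mul_assoc, mul_inv_cancel₀ h0, one_mul, ← mul_inv_rev, ← hc,
          mul_inv_rev, ← mul_assoc, mul_inv_cancel₀ hs, one_mul]
      rw [this]
      abel)

/-- The real part is 1 - ⟨w, v⟩, which vanishes for unit vectors only when they coincide. -/
lemma herm_sub_self_ne_zero {v w : QuatSpace k} (hv : ‖v‖ = 1) (hw : ‖w‖ = 1) (h : v ≠ w) :
    herm (v - w) v ≠ 0 := by
  intro h0
  have h1 := inner_eq_re_herm (v - w) v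
  rw [h0] at h1
  replace h1 : inner ℝ (v - w) v = 0 := h1
  rw [inner_sub_left, real_inner_self_eq_norm_sq, hv, sub_eq_zero, real_inner_comm] at h1
  have h2 : inner ℝ v w = 1 := by rw [← h1]; norm_num
  exact h ((inner_eq_one_iff_of_norm_eq_one hv hw).1 h2)

lemma spAct_householder {v w : QuatSpace k} (hv : ‖v‖ = 1) (hw : ‖w‖ = 1) :
    spAct (householder v w hv hw) v = w := by
  rw [householder, spAct_qrefl]
  by_cases h : v = w
  · subst h; simp
  · rw [neg_mul, inv_mul_cancel₀ (herm_sub_self_ne_zero hv hw h), rmul_neg, rmul_one]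
    abel

lemma spAct_householder_of_orthogonal {v w z : QuatSpace k} (hv : ‖v‖ = 1) (hw : ‖w‖ = 1)
    (h : herm v z = 0) (h' : herm w z = 0) : spAct (householder v w hv hw) z = z := by
  have h0 : herm (v - w) z = 0 := by rw [herm_sub_left, h, h', sub_zero]
  rw [householder, spAct_qrefl, h0]
  simp

/-- Rescaling the axis d to unit length turns 1 + d s d* into a reflection with parameter q = 1 +
‖d‖² s. The condition on s says precisely that q is a unit quaternion. -/
lemma householder_eq_urefl {v w : QuatSpace k} (hv : ‖v‖ = 1) (hw : ‖w‖ = 1) (h : v ≠ w) :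
    ∃ (hu : ‖(‖v - w‖⁻¹ • (v - w))‖ = 1) (q : Sp1),
      householder v w hv hw = urefl (‖v - w‖⁻¹ • (v - w)) hu q := by
  have hd : ‖v - w‖ ≠ 0 := norm_ne_zero_iff.2 (sub_ne_zero.2 h)
  have hu : ‖(‖v - w‖⁻¹ • (v - w))‖ = 1 := by
    rw [norm_smul, norm_inv, norm_norm, inv_mul_cancel₀ hd]
  have key : ∀ (d : QuatSpace k) (s : ℍ[ℝ]) (hs : IsReflParam d s), ‖d‖ ≠ 0 →
      ∀ hu : ‖(‖d‖⁻¹ • d)‖ = 1, ∃ q : Sp1, qrefl d s hs = urefl (‖d‖⁻¹ • d) hu q := by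
    intro d s hs hd hu
    have hq : ∀ t : ℍ[ℝ], t + star t + (‖d‖ ^ 2) • (t * star t) = 0 →
        (1 + ‖d‖ ^ 2 • t) * star (1 + ‖d‖ ^ 2 • t) = 1 := by
      intro t ht
      rw [star_add, star_one, Quaternion.star_smul]
      calc (1 + ‖d‖ ^ 2 • t) * (1 + ‖d‖ ^ 2 • star t) =
          1 + ‖d‖ ^ 2 • (t + star t + (‖d‖ ^ 2) • (t * star t)) := by
            simp only [add_mul, mul_add, one_mul, mul_one, smul_mul_assoc, mul_smul_comm,
              smul_add]
            abel
        _ = 1 := by rw [ht, smul_zero, add_zero]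
    have h1 := hq s hs
    have h2 : star (1 + ‖d‖ ^ 2 • s) * (1 + ‖d‖ ^ 2 • s) = 1 := by
      rw [Quaternion.star_mul_self, ← Quaternion.self_mul_star, h1]
    refine ⟨⟨1 + ‖d‖ ^ 2 • s, Unitary.mem_iff.2 ⟨h2, h1⟩⟩, sp_ext fun l => ?_⟩
    rw [spAct_qrefl, spAct_urefl, herm_smul_left, add_sub_cancel_left, map_smul, ← rmul_smul,
      smul_mul_smul_comm, smul_smul]
    congr 3
    rw [show ‖d‖⁻¹ * (‖d‖ ^ 2 * ‖d‖⁻¹) = 1 by field_simp, one_smul]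
  obtain ⟨q, hq⟩ := key (v - w) _ _ hd hu
  exact ⟨hu, q, hq⟩

/-- The stabilizer of a set of basis vectors in `Sp(k)` is generated by quaternionic reflections. -/
lemma mem_of_urefl_mem {C : Subgroup (Sp k)} (s₀ : Finset (Fin k))
    (hC : ∀ (u : QuatSpace k) (hu : ‖u‖ = 1), (∀ l ∈ s₀, herm (qe l) u = 0) →
      ∀ q, urefl u hu q ∈ C) {A : Sp k} (hA : ∀ l ∈ s₀, spAct A (qe l) = qe l) : A ∈ C := by
  -- Induction on the number of basis vectors outside `s`. A reflection takes the image of one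
  -- further vector back to it; its axis is orthogonal to the vectors in `s`, which therefore stay
  -- fixed.
  have key : ∀ (n : ℕ) (s : Finset (Fin k)), s₀ ⊆ s → sᶜ.card = n → ∀ A : Sp k,
      (∀ l ∈ s, spAct A (qe l) = qe l) → A ∈ C := by
    intro n
    induction n with
    | zero =>
      intro s _ hs A hA
      have : A = 1 := sp_ext fun l => by
        rw [hA l (by
          by_contra h
          have := Finset.card_eq_zero.1 hs ▸ Finset.mem_compl.2 h
          simp at this)]
        simp
      rw [this]
      exact one_mem _
    | succ n ih =>
      intro s hs₀ hs A hA
      obtain ⟨l, hl⟩ : sᶜ.Nonempty := by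
        rw [← Finset.card_pos]; omega
      rw [Finset.mem_compl] at hl
      have hw : ‖spAct A (qe l)‖ = 1 := by rw [LinearIsometryEquiv.norm_map, norm_qe]
      let H := householder (spAct A (qe l)) (qe l) hw (norm_qe l)
      have horth : ∀ j ∈ s, herm (qe j) (qe l) = 0 ∧ herm (qe j) (spAct A (qe l)) = 0 := by
        intro j hj
        have h1 : herm (qe j) (qe l) = 0 := by
          rw [herm_qe_left, qe_apply, if_neg]
          rintro rfl
          exact hl hj
        refine ⟨h1, ?_⟩
        nth_rewrite 1 [← hA j hj]
        rw [herm_spAct, h1]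
      have hHC : H ∈ C := by
        by_cases h : spAct A (qe l) = qe l
        · have : H = 1 := sp_ext fun j => by
            change spAct (qrefl _ _ _) _ = _
            rw [spAct_qrefl, h]; simp
          rw [this]; exact one_mem _
        · obtain ⟨hu, q, hq⟩ := householder_eq_urefl hw (norm_qe l) h
          change householder _ _ _ _ ∈ C
          rw [hq]
          refine hC _ hu (fun j hj => ?_) q
          rw [herm_smul_right, herm_sub_right, (horth j (hs₀ hj)).1, (horth j (hs₀ hj)).2]
          simp
      have hswap : ∀ u v : QuatSpace k, herm u v = 0 → herm v u = 0 := fun u v h => by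
        rw [← star_herm, h, star_zero]
      have hHA : H * A ∈ C := by
        refine ih (insert l s) (hs₀.trans (Finset.subset_insert _ _)) ?_ _ ?_
        · rw [Finset.card_compl, Finset.card_insert_of_notMem hl, ← Nat.sub_sub,
            ← Finset.card_compl, hs]
          rfl
        · intro j hj
          rw [map_mul]
          change spAct H (spAct A (qe j)) = qe j
          rcases Finset.mem_insert.1 hj with rfl | hj
          · exact spAct_householder hw (norm_qe j)
          · rw [hA j hj]
            exact spAct_householder_of_orthogonal _ _ (hswap _ _ (horth j hj).2)
              (hswap _ _ (horth j hj).1)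
      have := mul_mem (inv_mem hHC) hHA
      rwa [inv_mul_cancel_left] at this
  exact key _ s₀ le_rfl rfl A hA

/-- The unit quaternion `i`. -/
def qI : Sp1 := ⟨imQuat (Pi.single 0 1), Unitary.mem_iff.2 (by
  constructor <;> ext <;> simp)⟩

/-- The unit quaternion `j`. -/
def qJ : Sp1 := ⟨imQuat (Pi.single 1 1), Unitary.mem_iff.2 (by
  constructor <;> ext <;> simp)⟩

lemma mem_sp1_of_normSq {q : ℍ[ℝ]} (h : Quaternion.normSq q = 1) : q ∈ unitary ℍ[ℝ] :=
  Unitary.mem_iff.2 ⟨by rw [Quaternion.star_mul_self, h]; simp,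
    by rw [Quaternion.self_mul_star, h]; simp⟩

/-- Normalization of a nonzero quaternion. -/
def qnormalize (q : ℍ[ℝ]) (hq : q ≠ 0) : Sp1 :=
  ⟨‖q‖⁻¹ • q, mem_sp1_of_normSq (by
    rw [Quaternion.normSq_eq_norm_mul_self, norm_smul, norm_inv, norm_norm,
      inv_mul_cancel₀ (norm_ne_zero_iff.2 hq), one_mul])⟩

lemma sp1_mul_star (q : Sp1) : q.1 * star q.1 = 1 := Unitary.coe_mul_star_self q

/-- All imaginary unit quaternions are conjugate. -/
lemma exists_conj_qI (n : Sp1) (hn : n.1 * n.1 = -1) : ∃ p : Sp1, n = p * qI * p⁻¹ := by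
  have hI : qI.1 * qI.1 = -1 := by ext <;> simp [qI]
  -- From n(i + n) = (i + n)i, the normalized sum i + n conjugates i to n. It vanishes only for n =
  -- -i, and there j does the job.
  by_cases h : qI.1 + n.1 = 0
  · refine ⟨qJ, ?_⟩
    rw [eq_mul_inv_iff_mul_eq]
    apply Subtype.ext
    have : n.1 = -qI.1 := by rw [eq_neg_iff_add_eq_zero, add_comm]; exact h
    rw [Submonoid.coe_mul, Submonoid.coe_mul, this]
    ext <;> simp [qI, qJ]
  · refine ⟨qnormalize _ h, ?_⟩
    rw [eq_mul_inv_iff_mul_eq]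
    apply Subtype.ext
    simp only [Submonoid.coe_mul, qnormalize, mul_smul_comm, smul_mul_assoc, mul_add, add_mul, hn,
      hI]
    congr 1
    exact add_comm _ _

/-- Every unit quaternion is a square. -/
lemma exists_sq_eq (q : Sp1) : ∃ p : Sp1, p * p = q := by
  -- Apart from -1 = i², a square root is the normalization of 1 + q, because (1 + q)² = ‖1 + q‖² q.
  by_cases h : 1 + q.1 = 0
  · refine ⟨qI, Subtype.ext ?_⟩
    rw [Submonoid.coe_mul, ← (neg_eq_of_add_eq_zero_right h)]
    ext <;> simp [qI]
  · refine ⟨qnormalize _ h, Subtype.ext ?_⟩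
    have hq := sp1_mul_star q
    have h1 : (1 + q.1) * (1 + q.1) = (‖1 + q.1‖ ^ 2) • q.1 := by
      rw [← Quaternion.mul_coe_eq_smul, sq, ← Quaternion.normSq_eq_norm_mul_self,
        ← Quaternion.star_mul_self, ← mul_assoc, star_add, star_one, mul_add q.1, hq]
      noncomm_ring
    have h2 : ‖1 + q.1‖ ≠ 0 := norm_ne_zero_iff.2 h
    rw [Submonoid.coe_mul]
    simp only [qnormalize]
    rw [smul_mul_smul_comm, h1, smul_smul]
    rw [show ‖1 + q.1‖⁻¹ * ‖1 + q.1‖⁻¹ * ‖1 + q.1‖ ^ 2 = 1 by field_simp, one_smul]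

lemma imQuat_mem_sp1 {v : Fin 3 → ℝ} (hv : v ⬝ᵥ v = 1) : imQuat v ∈ unitary ℍ[ℝ] :=
  mem_sp1_of_normSq (by
    have : Quaternion.normSq (imQuat v) = v ⬝ᵥ v := by
      rw [Quaternion.normSq_def']; simp [dotProduct, Fin.sum_univ_three]; ring
    rw [this, hv])

/-- `Sp(k)` is generated by the quaternionic reflections with parameter `i`. -/
lemma mem_of_urefl_qI_mem {C : Subgroup (Sp k)}
    (hC : ∀ (u : QuatSpace k) (hu : ‖u‖ = 1), urefl u hu qI ∈ C) (A : Sp k) : A ∈ C := by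
  refine mem_of_urefl_mem ∅ (fun u hu _ q => ?_) (by simp)
  obtain ⟨v, w, hv, hw, hq⟩ := exists_eq_imQuat_mul q
  have key : ∀ (v : Fin 3 → ℝ) (hv : v ⬝ᵥ v = 1), urefl u hu ⟨imQuat v, imQuat_mem_sp1 hv⟩ ∈ C := by
    intro v hv
    obtain ⟨p, hp⟩ := exists_conj_qI ⟨imQuat v, imQuat_mem_sp1 hv⟩ (by
      rw [imQuat_mul_self, hv]; simp)
    have hn : ‖rmul p.1 u‖ = 1 := by rw [norm_rmul (norm_sp1 p), hu]
    rw [hp, ← urefl_rmul hu p qI hn]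
    exact hC _ hn
  have : q = ⟨imQuat v, imQuat_mem_sp1 hv⟩ * ⟨imQuat w, imQuat_mem_sp1 hw⟩ := Subtype.ext hq
  rw [this, map_mul]
  exact mul_mem (key v hv) (key w hw)

/-- A homomorphism from `Sp(k)` killing squares is trivial. -/
lemma sp_mem_of_sq_mem {C : Subgroup (Sp k)} (hC : ∀ A : Sp k, A * A ∈ C) (A : Sp k) : A ∈ C := by
  refine mem_of_urefl_mem ∅ (fun u hu _ q => ?_) (by simp)
  obtain ⟨p, rfl⟩ := exists_sq_eq q
  rw [map_mul]
  exact hC _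

end Symplectic

/-! ### The Fock representation and the lift of `Sp(k)` to the spin group -/

section Fock

variable {k : ℕ}

/-- The complex exterior algebra on `ℂ²ᵏ`, on which the Clifford algebra of `ℍᵏ` acts. -/
abbrev Fock (k : ℕ) : Type := ExteriorAlgebra ℂ (Fin k × Fin 2 → ℂ)

/-- Complex coordinates on `ℍᵏ` for right multiplication by `i`. -/
def complexCoord : QuatSpace k →ₗ[ℝ] (Fin k × Fin 2 → ℂ) where
  -- Each coordinate is written z + jw with z and w complex; the minus sign comes from k = -ji.
  -- Right multiplication by i then multiplies z and w by i.
  toFun u p := ![⟨(u p.1).re, (u p.1).imI⟩, ⟨(u p.1).imJ, -(u p.1).imK⟩] p.2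
  map_add' u v := by
    ext1 ⟨i, j⟩
    fin_cases j <;> apply Complex.ext <;> simp [add_comm]
  map_smul' r v := by
    ext1 ⟨i, j⟩
    fin_cases j <;> apply Complex.ext <;> simp

lemma complexCoord_rmul_qI (u : QuatSpace k) :
    complexCoord (rmul qI.1 u) = Complex.I • complexCoord u := by
  ext1 ⟨i, j⟩
  fin_cases j <;> apply Complex.ext <;> simp [complexCoord, qI]

/-- The Hermitian dual of `complexCoord u`. -/
def complexDual : QuatSpace k →ₗ[ℝ] Module.Dual ℂ (Fin k × Fin 2 → ℂ) where
  toFun u := ∑ p, star (complexCoord u p) • LinearMap.proj p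
  map_add' u v := by
    rw [← Finset.sum_add_distrib]
    refine Finset.sum_congr rfl fun p _ => ?_
    rw [map_add, Pi.add_apply, star_add, add_smul]
  map_smul' r v := by
    rw [RingHom.id_apply, Finset.smul_sum]
    refine Finset.sum_congr rfl fun p _ => ?_
    rw [map_smul, Pi.smul_apply, StarModule.star_smul, star_trivial, smul_assoc]

lemma complexDual_complexCoord (u : QuatSpace k) :
    complexDual u (complexCoord u) = ((‖u‖ ^ 2 : ℝ) : ℂ) := by
  have h : complexDual u (complexCoord u) =
      ∑ p, star (complexCoord u p) * complexCoord u p := by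
    simp [complexDual]
  rw [h, Fintype.sum_prod_type, PiLp.norm_sq_eq_of_L2, Complex.ofReal_sum]
  refine Finset.sum_congr rfl fun i _ => ?_
  rw [Fin.sum_univ_two, sq ‖u i‖, ← Quaternion.normSq_eq_norm_mul_self, Quaternion.normSq_def']
  apply Complex.ext <;> simp [complexCoord, ← sq, -Complex.ofReal_pow] <;> ring

/-- Clifford multiplication on the Fock space. -/
def fock : QuatSpace k →ₗ[ℝ] Module.End ℂ (Fock k) where
  toFun u := LinearMap.mulLeft ℂ (ExteriorAlgebra.ι ℂ (complexCoord u)) +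
    contractLeft (complexDual u)
  map_add' u v := by
    refine LinearMap.ext fun x => ?_
    simp only [map_add, LinearMap.add_apply, LinearMap.mulLeft_apply, add_mul]
    abel
  map_smul' r u := by
    refine LinearMap.ext fun x => ?_
    have h1 : (r • complexCoord u) = (r : ℂ) • complexCoord u := rfl
    have h2 : (r • complexDual u) = (r : ℂ) • complexDual u := by
      ext; simp
    rw [map_smul complexCoord, map_smul complexDual, h1, h2, map_smul, map_smul]
    simp only [LinearMap.add_apply, LinearMap.smul_apply, LinearMap.mulLeft_apply, smul_mul_assoc,
      RingHom.id_apply, smul_add]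
    rfl

lemma fock_apply (u : QuatSpace k) (x : Fock k) :
    fock u x = ExteriorAlgebra.ι ℂ (complexCoord u) * x + contractLeft (complexDual u) x := rfl

/-- Creation and annihilation operators square to zero, and their anticommutator is the pairing of
`u` with its Hermitian dual, that is, ‖u‖². -/
lemma fock_mul_self (u : QuatSpace k) :
    fock u * fock u = algebraMap ℝ (Module.End ℂ (Fock k)) (‖u‖ ^ 2) := by
  refine LinearMap.ext fun x => ?_
  rw [Module.End.mul_apply, fock_apply, fock_apply, mul_add, ← mul_assoc,
    ExteriorAlgebra.ι_sq_zero, zero_mul, zero_add, map_add, contractLeft_contractLeft, add_zero]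
  erw [contractLeft_ι_mul]
  rw [complexDual_complexCoord]
  exact add_sub_cancel _ _

lemma fock_one (u : QuatSpace k) : fock u 1 = ExteriorAlgebra.ι ℂ (complexCoord u) := by
  rw [fock_apply, mul_one, contractLeft_one, add_zero]

/-- The vacuum is annihilated by contractions, so only the creation operator remains, and it is
complex linear for right multiplication by i. -/
lemma fock_rmul_qI_one (u : QuatSpace k) :
    fock (rmul qI.1 u) 1 = Complex.I • fock u (1 : Fock k) := by
  rw [fock_one, fock_one, complexCoord_rmul_qI, map_smul]

variable {N : ℕ} (b : OrthonormalBasis (Fin N) ℝ (QuatSpace k))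

/-- The representation of the Clifford algebra on the Fock space. -/
def fockRep : Cl N →ₐ[ℝ] Module.End ℂ (Fock k) :=
  CliffordAlgebra.lift (euclideanForm N)
    ⟨fock ∘ₗ b.repr.symm.toLinearEquiv.toLinearMap ∘ₗ
      (WithLp.linearEquiv 2 ℝ (Fin N → ℝ)).symm.toLinearMap, fun v => by
      obtain ⟨w, rfl⟩ : ∃ w, (b.repr w).ofLp = v :=
        ⟨b.repr.symm (WithLp.toLp 2 v), by rw [LinearIsometryEquiv.apply_symm_apply]⟩
      change fock (b.repr.symm (b.repr w)) * fock (b.repr.symm (b.repr w)) = _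
      rw [LinearIsometryEquiv.symm_apply_apply, fock_mul_self, euclideanForm_apply,
        dotProduct_repr, real_inner_self_eq_norm_sq]⟩

lemma fockRep_gam (v : QuatSpace k) : fockRep b (gam b v) = fock v := by
  rw [gam_apply, fockRep, lift_ι_apply]
  change fock (b.repr.symm (b.repr v)) = _
  rw [LinearIsometryEquiv.symm_apply_apply]

lemma rotor_apply_orthonormal {V : Type*} [NormedAddCommGroup V] [InnerProductSpace ℝ V]
    {v w : V} (hv : ‖v‖ = 1) (hw : ‖w‖ = 1) (h : inner ℝ v w = 0) (z : V) :
    rotor v w z = z - (inner ℝ v z + inner ℝ w z) • v + (inner ℝ v z - inner ℝ w z) • w := by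
  change (ℝ ∙ (v + w))ᗮ.reflection ((ℝ ∙ v)ᗮ.reflection z) = _
  rw [reflection_orthogonal_singleton_apply, reflection_orthogonal_singleton_apply v,
    norm_add_sq_unit hv hw, h, hv]
  simp only [inner_sub_right, inner_smul_right, inner_add_left, real_inner_self_eq_norm_sq, hv,
    real_inner_comm v w, h]
  module

lemma rotorCl_orthonormal {V : Type*} [NormedAddCommGroup V] [InnerProductSpace ℝ V]
    (b : OrthonormalBasis (Fin N) ℝ V) {v w : V} (hv : ‖v‖ = 1) (hw : ‖w‖ = 1)
    (h : inner ℝ v w = 0) :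
    rotorCl b v w = (√2)⁻¹ • (1 + gam b w * gam b v) := by
  have h2 : ‖v + w‖ = √2 := by
    rw [← Real.sqrt_sq (norm_nonneg _), norm_add_sq_unit hv hw, h]; simp
  rw [rotorCl, h2, map_smul, smul_mul_assoc, map_add, add_mul, gam_mul_self_of_norm b hv]

lemma inner_rmul_rmul {u : QuatSpace k} (hu : ‖u‖ = 1) (p q : ℍ[ℝ]) :
    inner ℝ (rmul p u) (rmul q u) = (star p * q).re := by
  rw [inner_eq_re_herm, herm_rmul_left, herm_rmul_right, herm_self_of_norm hu, one_mul]

/-- The unit quaternion `k`. -/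
def qK : Sp1 := ⟨imQuat (Pi.single 2 1), Unitary.mem_iff.2 (by
  constructor <;> ext <;> simp)⟩

lemma qI_coords : qI.1.re = 0 ∧ qI.1.imI = 1 ∧ qI.1.imJ = 0 ∧ qI.1.imK = 0 := by simp [qI]
lemma qJ_coords : qJ.1.re = 0 ∧ qJ.1.imI = 0 ∧ qJ.1.imJ = 1 ∧ qJ.1.imK = 0 := by simp [qJ]
lemma qK_coords : qK.1.re = 0 ∧ qK.1.imI = 0 ∧ qK.1.imJ = 0 ∧ qK.1.imK = 1 := by simp [qK]

lemma rotor_rmul {u : QuatSpace k} (hu : ‖u‖ = 1) (p q : Sp1) (h : (star p.1 * q.1).re = 0)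
    (z : QuatSpace k) : rotor (rmul p.1 u) (rmul q.1 u) z = z + rmul
      (((star p.1 * herm u z).re - (star q.1 * herm u z).re) • q.1 -
        ((star p.1 * herm u z).re + (star q.1 * herm u z).re) • p.1) u := by
  have hn : ∀ q : Sp1, ‖rmul q.1 u‖ = 1 := fun q => by rw [norm_rmul (norm_sp1 q), hu]
  rw [rotor_apply_orthonormal (hn p) (hn q) (by rw [inner_rmul_rmul hu, h]), inner_eq_re_herm,
    inner_eq_re_herm, herm_rmul_left, herm_rmul_left, sub_eq_add_neg (_ • q.1), rmul_add, rmul_neg,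
    rmul_smul, rmul_smul]
  abel

/-- On uℍ the reflection is left multiplication by i: it sends u to ui and uj to uk. It is thus a
quarter turn in each of the planes (u, ui) and (uj, uk). -/
lemma urefl_qI_eq {u : QuatSpace k} (hu : ‖u‖ = 1) (z : QuatSpace k) :
    spAct (urefl u hu qI) z =
      rotor u (rmul qI.1 u) (rotor (rmul qJ.1 u) (rmul qK.1 u) z) := by
  have h := rotor_rmul hu 1 qI (by simp [qI_coords])
  rw [show ((1 : Sp1) : ℍ[ℝ]) = 1 from rfl, rmul_one] at h
  rw [h, rotor_rmul hu qJ qK (by simp [qJ_coords, qK_coords]), spAct_urefl, add_assoc, ← rmul_add,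
    herm_add_right, herm_rmul_right, herm_self_of_norm hu, one_mul]
  refine congrArg (fun q => z + rmul q u) ?_
  ext <;> simp [qI_coords, qJ_coords, qK_coords] <;> ring

lemma fock_mul_swap {u v : QuatSpace k} (h : inner ℝ u v = 0) :
    fock v * fock u = -(fock u * fock v) := by
  have := fock_mul_self (u + v)
  rw [map_add, norm_add_sq_real, h, mul_zero, add_zero, map_add, ← fock_mul_self, ← fock_mul_self,
    add_mul, mul_add, mul_add] at this
  rw [eq_neg_iff_add_eq_zero]
  have h2 := sub_eq_zero.2 this
  rw [← h2]
  abel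

/-- The spinor of a quarter turn is (1 + wv)/√2, and wv·1 = -vw·1 = -c v²·1 = -c·1. -/
lemma fockRep_rotorCl_one {v w : QuatSpace k} (hv : ‖v‖ = 1) (hw : ‖w‖ = 1)
    (h : inner ℝ v w = 0) {c : ℂ} (hc : fock w (1 : Fock k) = c • fock v (1 : Fock k)) :
    fockRep b (rotorCl b v w) 1 = (((√2)⁻¹ : ℝ) * (1 - c)) • (1 : Fock k) := by
  have h1 : fock v (fock v (1 : Fock k)) = 1 := by
    rw [← Module.End.mul_apply, fock_mul_self, hv]; simp
  rw [rotorCl_orthonormal b hv hw h, map_smul, map_add, map_one (fockRep b), map_mul (fockRep b), fockRep_gam,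
    fockRep_gam,
    fock_mul_swap h, LinearMap.smul_apply, LinearMap.add_apply, LinearMap.neg_apply,
    Module.End.mul_apply, hc, map_smul, h1, mul_smul, sub_smul, one_smul, ← sub_eq_add_neg]
  rfl

/-- The element of the spin group covering the quaternionic reflection with parameter `i`. -/
def ureflCl (u : QuatSpace k) : Cl N :=
  rotorCl b u (rmul qI.1 u) * rotorCl b (rmul qJ.1 u) (rmul qK.1 u)

lemma ureflCl_facts {u : QuatSpace k} (hu : ‖u‖ = 1) :
    ‖rmul qI.1 u‖ = 1 ∧ ‖rmul qJ.1 u‖ = 1 ∧ ‖rmul qK.1 u‖ = 1 ∧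
    inner ℝ u (rmul qI.1 u) = 0 ∧ inner ℝ (rmul qJ.1 u) (rmul qK.1 u) = 0 ∧
    inner ℝ u (rmul qJ.1 u) = 0 ∧ inner ℝ u (rmul qK.1 u) = 0 ∧
    inner ℝ (rmul qI.1 u) (rmul qJ.1 u) = 0 ∧ inner ℝ (rmul qI.1 u) (rmul qK.1 u) = 0 := by
  have hn : ∀ q : Sp1, ‖rmul q.1 u‖ = 1 := fun q => by rw [norm_rmul (norm_sp1 q), hu]
  have h1 : ∀ q : ℍ[ℝ], inner ℝ u (rmul q u) = q.re := fun q => by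
    have := inner_rmul_rmul hu 1 q
    rwa [rmul_one, star_one, one_mul] at this
  refine ⟨hn _, hn _, hn _, ?_⟩
  simp only [h1, inner_rmul_rmul hu]
  simp [qI_coords, qJ_coords, qK_coords]

lemma add_ne_zero_of_orthonormal {V : Type*} [NormedAddCommGroup V] [InnerProductSpace ℝ V]
    {v w : V} (hv : ‖v‖ = 1) (hw : ‖w‖ = 1) (h : inner ℝ v w = 0) : v + w ≠ 0 := by
  intro h0
  have := norm_add_sq_unit hv hw
  rw [h0, h] at this
  norm_num at this

lemma ureflCl_mem {u : QuatSpace k} (hu : ‖u‖ = 1) :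
    ureflCl b u ∈ spinGroup (euclideanForm N) := by
  obtain ⟨h1, h2, h3, h4, h5, -⟩ := ureflCl_facts hu
  exact mul_mem (rotorCl_mem b hu (add_ne_zero_of_orthonormal hu h1 h4))
    (rotorCl_mem b h2 (add_ne_zero_of_orthonormal h2 h3 h5))

lemma covers_ureflCl {u : QuatSpace k} (hu : ‖u‖ = 1) :
    Covers b (ureflCl b u) (spAct (urefl u hu qI)) := by
  obtain ⟨h1, h2, h3, h4, h5, -⟩ := ureflCl_facts hu
  exact ((covers_rotorCl b hu (add_ne_zero_of_orthonormal hu h1 h4)).mul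
    (covers_rotorCl b h2 (add_ne_zero_of_orthonormal h2 h3 h5))).congr
      fun z => (urefl_qI_eq hu z).symm

/-- Since uk = -(uj)i, the two quarter turns multiply the vacuum by the mutually inverse scalars (1
- i)/√2 and (1 + i)/√2. -/
lemma fockRep_ureflCl_one {u : QuatSpace k} (hu : ‖u‖ = 1) :
    fockRep b (ureflCl b u) (1 : Fock k) = 1 := by
  obtain ⟨h1, h2, h3, h4, h5, -⟩ := ureflCl_facts hu
  have hk : rmul qK.1 u = -rmul qI.1 (rmul qJ.1 u) := by
    rw [rmul_rmul, ← rmul_neg]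
    congr 2
    ext <;> simp [qI_coords, qJ_coords, qK_coords]
  rw [ureflCl, map_mul, Module.End.mul_apply, fockRep_rotorCl_one b h2 h3 h5 (c := -Complex.I),
    map_smul, fockRep_rotorCl_one b hu h1 h4 (fock_rmul_qI_one u), smul_smul]
  · have h0 : (((√2)⁻¹ : ℝ) : ℂ) * (((√2)⁻¹ : ℝ) : ℂ) = 1 / 2 := by
      rw [← Complex.ofReal_mul, ← mul_inv, Real.mul_self_sqrt (by norm_num)]; simp
    rw [show (((√2)⁻¹ : ℝ) : ℂ) * (1 - -Complex.I) * ((((√2)⁻¹ : ℝ) : ℂ) * (1 - Complex.I)) = 1 by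
      linear_combination (1 - Complex.I ^ 2) * h0 - (1 / 2) * Complex.I_sq, one_smul]
  · rw [hk, map_neg, LinearMap.neg_apply, fock_rmul_qI_one, neg_smul]

/-- The two quarter turns live in orthogonal planes, so their spinors commute, and each squares to
the product of two vectors. As -1 = i², this is the lift of -1 on one quaternionic line. -/
lemma ureflCl_mul_self {u : QuatSpace k} (hu : ‖u‖ = 1) :
    ureflCl b u * ureflCl b u = gam b (rmul qI.1 u) * gam b u *
      (gam b (rmul qK.1 u) * gam b (rmul qJ.1 u)) := by
  obtain ⟨h1, h2, h3, h4, h5, h6, h7, h8, h9⟩ := ureflCl_facts hu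
  have hsq : ∀ {v w : QuatSpace k}, ‖v‖ = 1 → ‖w‖ = 1 → inner ℝ v w = 0 →
      rotorCl b v w * rotorCl b v w = gam b w * gam b v := by
    intro v w hv hw h
    have hwv : inner ℝ w v = 0 := by rw [real_inner_comm, h]
    have h4 : gam b w * gam b v * (gam b w * gam b v) = -1 := by
      rw [gam_anticomm b hwv, neg_mul_neg, mul_assoc, ← mul_assoc (gam b w), gam_anticomm b hwv]
      rw [neg_mul, mul_neg, ← mul_assoc, ← mul_assoc, gam_mul_self_of_norm b hv, one_mul,
        gam_mul_self_of_norm b hw]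
    rw [rotorCl_orthonormal b hv hw h, smul_mul_smul_comm, ← mul_inv,
      Real.mul_self_sqrt (by norm_num), add_mul, mul_add, mul_add, h4, mul_one, one_mul]
    rw [show (1 : Cl N) + gam b w * gam b v + (gam b w * gam b v * 1 + -1) =
      (2 : ℝ) • (gam b w * gam b v) by rw [two_smul, mul_one]; abel, smul_smul]
    norm_num
  have hcomm : rotorCl b (rmul qJ.1 u) (rmul qK.1 u) * rotorCl b u (rmul qI.1 u) =
      rotorCl b u (rmul qI.1 u) * rotorCl b (rmul qJ.1 u) (rmul qK.1 u) := by
    rw [rotorCl_orthonormal b hu h1 h4, rotorCl_orthonormal b h2 h3 h5, smul_mul_smul_comm,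
      smul_mul_smul_comm]
    congr 1
    have hc : gam b (rmul qK.1 u) * gam b (rmul qJ.1 u) * (gam b (rmul qI.1 u) * gam b u) =
        gam b (rmul qI.1 u) * gam b u * (gam b (rmul qK.1 u) * gam b (rmul qJ.1 u)) := by
      have e6 := gam_anticomm b h6
      have e7 := gam_anticomm b h7
      have e8 := gam_anticomm b h8
      have e9 := gam_anticomm b h9
      generalize gam b u = x at *
      generalize gam b (rmul qI.1 u) = y at *
      generalize gam b (rmul qJ.1 u) = z at *
      generalize gam b (rmul qK.1 u) = w at *
      calc w * z * (y * x) = w * (z * y) * x := by noncomm_ring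
        _ = -(w * y * (z * x)) := by
            rw [show z * y = -(y * z) by rw [e8, neg_neg]]; noncomm_ring
        _ = y * w * (z * x) := by rw [e9]; noncomm_ring
        _ = y * w * -(x * z) := by rw [e6, neg_neg]
        _ = -(y * (w * x) * z) := by noncomm_ring
        _ = y * (x * w) * z := by rw [e7]; noncomm_ring
        _ = _ := by noncomm_ring
    rw [add_mul, mul_add, mul_add, add_mul, mul_add, mul_add, hc]
    simp only [mul_one, one_mul]
    abel
  rw [ureflCl, ← hsq hu h1 h4, ← hsq h2 h3 h5, mul_assoc, ← mul_assoc _ (rotorCl b u _), hcomm]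
  noncomm_ring


/-- The vacuum component of `x · 1`. -/
def vacuumPart : Cl N →ₗ[ℝ] ℝ :=
  Complex.reLm ∘ₗ (ExteriorAlgebra.algebraMapInv (R := ℂ) (M := Fin k × Fin 2 → ℂ)).toLinearMap.restrictScalars ℝ ∘ₗ
    (LinearMap.applyₗ (R := ℂ) (1 : Fock k)).restrictScalars ℝ ∘ₗ (fockRep b).toLinearMap

lemma vacuumPart_of_fix {x : Cl N} (h : fockRep b x (1 : Fock k) = 1) : vacuumPart b x = 1 := by
  change (ExteriorAlgebra.algebraMapInv (fockRep b x (1 : Fock k))).re = 1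
  rw [h, map_one, Complex.one_re]

/-- The elements with a lift fixing the vacuum form a subgroup, and it contains the generating
reflections. The opposite lift sends the vacuum to its negative, so the choice is unique and hence
multiplicative. -/
lemma exists_spLift (A : Sp k) :
    ∃ x : Spin N, Covers b x (spAct A) ∧ fockRep b x (1 : Fock k) = 1 := by
  let C : Subgroup (Sp k) :=
    { carrier := {A | ∃ x : Spin N, Covers b x (spAct A) ∧ fockRep b x (1 : Fock k) = 1}
      one_mem' := ⟨1, Covers.one.congr fun v => by simp, by simp⟩
      mul_mem' := by
        rintro A B ⟨x, hx, hx'⟩ ⟨y, hy, hy'⟩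
        refine ⟨x * y, (hx.mul hy).congr fun v => by rw [map_mul]; rfl, ?_⟩
        rw [Submonoid.coe_mul, map_mul, Module.End.mul_apply, hy', hx']
      inv_mem' := by
        rintro A ⟨x, hx, hx'⟩
        refine ⟨x⁻¹, hx.inv fun v => ?_, ?_⟩
        · rw [map_inv]; exact LinearIsometryEquiv.apply_symm_apply _ _
        · nth_rewrite 1 [← hx']
          rw [← Module.End.mul_apply, ← map_mul, spin_coe_inv, spin_star_mul, map_one (fockRep b)]
          rfl }
  exact mem_of_urefl_qI_mem (C := C)
    (fun u hu => ⟨⟨_, ureflCl_mem b hu⟩, covers_ureflCl b hu, fockRep_ureflCl_one b hu⟩) A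

lemma spLift_unique {A : Sp k} {x y : Spin N} (hx : Covers b x (spAct A))
    (hx' : fockRep b x (1 : Fock k) = 1) (hy : Covers b y (spAct A))
    (hy' : fockRep b y (1 : Fock k) = 1) : x = y := by
  rcases hx.eq_or_eq_neg hy with h | h
  · exact Subtype.ext h
  · have h1 := vacuumPart_of_fix b hx'
    rw [h, map_neg, vacuumPart_of_fix b hy'] at h1
    norm_num at h1

/-- The lift of the action of `Sp(k)` on `ℍᵏ` to the spin group. -/
def spLift : Sp k →* Spin N where
  toFun A := (exists_spLift b A).choose
  map_one' := by
    obtain ⟨h1, h2⟩ := (exists_spLift b (1 : Sp k)).choose_spec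
    exact spLift_unique b h1 h2 (Covers.one.congr fun v => by simp) (by simp)
  map_mul' A B := by
    obtain ⟨h1, h2⟩ := (exists_spLift b (A * B)).choose_spec
    obtain ⟨h3, h4⟩ := (exists_spLift b A).choose_spec
    obtain ⟨h5, h6⟩ := (exists_spLift b B).choose_spec
    refine spLift_unique b h1 h2 ((h3.mul h5).congr fun v => by rw [map_mul]; rfl) ?_
    rw [Submonoid.coe_mul, map_mul, Module.End.mul_apply, h6, h4]

lemma covers_spLift (A : Sp k) : Covers b (spLift b A) (spAct A) := (exists_spLift b A).choose_spec.1

lemma fockRep_spLift (A : Sp k) : fockRep b (spLift b A) (1 : Fock k) = 1 :=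
  (exists_spLift b A).choose_spec.2

lemma coe_neg_one_sp1 : ((-1 : Sp1) : ℍ[ℝ]) = -1 := rfl

lemma coe_neg_one_sp : ((-1 : Sp k) : Matrix (Fin k) (Fin k) ℍ[ℝ]) = -1 := rfl

lemma spLift_urefl_neg_one {u : QuatSpace k} (hu : ‖u‖ = 1) :
    (spLift b (urefl u hu (-1)) : Cl N) = gam b (rmul qI.1 u) * gam b u *
      (gam b (rmul qK.1 u) * gam b (rmul qJ.1 u)) := by
  have h : (-1 : Sp1) = qI * qI := Subtype.ext (by
    rw [coe_neg_one_sp1]; ext <;> simp [qI_coords])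
  have h1 : spLift b (urefl u hu qI) = ⟨_, ureflCl_mem b hu⟩ :=
    spLift_unique b (covers_spLift b _) (fockRep_spLift b _) (covers_ureflCl b hu)
      (fockRep_ureflCl_one b hu)
  rw [h, map_mul, map_mul, h1, ← ureflCl_mul_self b hu]
  rfl

lemma linSmoothAt_sp {F : Type*} [NormedAddCommGroup F] [NormedSpace ℝ F] {A : F → Sp k} {t : F}
    (hA : LinSmoothAt (fun s => (A s).1) t) (B : Sp k) (v : QuatSpace k) :
    ContDiffAt ℝ ∞ (fun s => spAct (B * A s) v) t := by
  let L : Matrix (Fin k) (Fin k) ℍ[ℝ] →ₗ[ℝ] QuatSpace k :=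
    { toFun := fun M => WithLp.toLp 2 ((B.1 * M).mulVec v.ofLp)
      map_add' := fun M M' => by rw [mul_add, Matrix.add_mulVec]; rfl
      map_smul' := fun c M => by rw [mul_smul_comm, Matrix.smul_mulVec]; rfl }
  refine linSmoothAt_iff_contDiffAt.1 ((hA.linear L).congr (Filter.Eventually.of_forall fun s => ?_))
  ext1 i
  rw [spAct_apply]
  rfl

/-- Near a parameter value the homomorphism agrees with a smooth local lift up to sign. -/
lemma dSmooth_spLift : DSmooth (spLift b : Sp k → Spin N) := by
  intro n p hp
  refine isPlot_subtype_iff.2 (isPlot_iff_linSmoothAt.2 fun t₀ => ?_)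
  have hp' := isPlot_iff_linSmoothAt.1 (isPlot_subtype_iff.1 hp) t₀
  obtain ⟨s, hs, hs'⟩ := exists_local_spin_lift b (fun t => spAct ((p t₀)⁻¹ * p t)) t₀
    (fun v => linSmoothAt_sp hp' _ v) (by simp)
  -- The vacuum component of the local lift is exactly the sign to be corrected, and it depends
  -- smoothly on the parameter, being a linear functional.
  have h1 : LinSmoothAt (fun t => (spLift b (p t₀) : Cl N) * (vacuumPart b (s t) • s t)) t₀ :=
    (linSmoothAt_const _ _).mul (LinSmoothAt.smul (hs (vacuumPart b)) hs)
  refine h1.congr (hs'.mono ?_)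
  rintro t ⟨x, hx, hx'⟩
  change (spLift b (p t) : Cl N) = _
  rw [show p t = p t₀ * ((p t₀)⁻¹ * p t) by group, map_mul, Submonoid.coe_mul, ← hx]
  congr 1
  have hv := vacuumPart_of_fix b (fockRep_spLift b ((p t₀)⁻¹ * p t))
  rcases (covers_spLift b ((p t₀)⁻¹ * p t)).eq_or_eq_neg hx' with h | h
  · rw [h] at hv ⊢; rw [hv, one_smul]
  · rw [h] at hv ⊢
    rw [map_neg] at hv
    rw [show vacuumPart b x = -1 by linarith, neg_smul, one_smul]

/-! ### The lift of `Sp(k) × Sp(1)` -/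

/-- Coordinatewise quaternionic conjugation. -/
def quatStar : QuatSpace k ≃ₗᵢ[ℝ] QuatSpace k where
  toFun v := WithLp.toLp 2 fun i => star (v i)
  invFun v := WithLp.toLp 2 fun i => star (v i)
  map_add' v w := by ext1 i; simp
  map_smul' r v := by ext1 i; simp
  left_inv v := by ext1 i; simp
  right_inv v := by ext1 i; simp
  norm_map' v := by
    rw [PiLp.norm_eq_of_L2, PiLp.norm_eq_of_L2]
    simp

lemma quatStar_apply (v : QuatSpace k) (i : Fin k) : quatStar v i = star (v i) := rfl

lemma gam_map_quatStar (v : QuatSpace k) : gam (b.map quatStar) v = gam b (quatStar v) := rfl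

lemma covers_map_quatStar {x : Cl N} {T : QuatSpace k → QuatSpace k}
    (h : Covers (b.map quatStar) x T) : Covers b x (fun v => quatStar (T (quatStar v))) := by
  intro v
  have := h (quatStar v)
  rw [gam_map_quatStar, gam_map_quatStar] at this
  rw [this]
  congr 2
  ext1 i
  simp [quatStar_apply]

/-- The diagonal embedding of `Sp(1)` in `Sp(k)`. -/
def diagSp : Sp1 →* Sp k where
  toFun q := ⟨Matrix.scalar (Fin k) q.1, Unitary.mem_iff.2 (by
    have h1 := Unitary.coe_star_mul_self q
    have h2 : q.1 * star q.1 = 1 := Unitary.coe_mul_star_self q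
    rw [Matrix.star_eq_conjTranspose, Matrix.scalar_apply, Matrix.diagonal_conjTranspose,
      Matrix.diagonal_mul_diagonal, Matrix.diagonal_mul_diagonal]
    simp only [Pi.star_apply, h1, h2, Matrix.diagonal_one, and_self])⟩
  map_one' := Subtype.ext (map_one _)
  map_mul' _ _ := Subtype.ext (map_mul _ _ _)

lemma spAct_diagSp (q : Sp1) (v : QuatSpace k) (i : Fin k) : spAct (diagSp q) v i = q.1 * v i := by
  rw [spAct_apply]
  simp [diagSp, Matrix.diagonal_apply]

lemma diagSp_neg_one : diagSp (k := k) (-1) = -1 := Subtype.ext (by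
  change Matrix.scalar (Fin k) ((-1 : Sp1) : ℍ[ℝ]) = _
  rw [coe_neg_one_sp1, map_neg, map_one, coe_neg_one_sp])

/-- The lift of the right action of `Sp(1)` on `ℍᵏ` to the spin group. -/
def sp1Lift : Sp1 →* Spin N := (spLift (b.map quatStar)).comp diagSp

/-- Conjugating every coordinate turns right multiplication by q̄ into left multiplication by the
scalar matrix q, which lies in Sp(k). -/
lemma covers_sp1Lift (q : Sp1) : Covers b (sp1Lift b q) (fun v => rmul (star q.1) v) :=
  (covers_map_quatStar b (covers_spLift (b.map quatStar) (diagSp q))).congr fun v => by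
    ext1 i
    rw [quatStar_apply, spAct_diagSp, quatStar_apply, star_mul, star_star, rmul_apply]

lemma dSmooth_diagSp : DSmooth (diagSp : Sp1 → Sp k) := by
  intro n p hp
  refine isPlot_subtype_iff.2 (isPlot_iff_linSmoothAt.2 fun t => ?_)
  have h := isPlot_iff_linSmoothAt.1 (isPlot_subtype_iff.1 hp) t
  refine linSmoothAt_matrix fun i j => ?_
  change LinSmoothAt (fun s => Matrix.diagonal (fun _ => (p s).1) i j) t
  by_cases hij : i = j
  · subst hij
    simpa using h
  · simpa [hij] using linSmoothAt_const (0 : ℍ[ℝ]) t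

lemma dSmooth_sp1Lift : DSmooth (sp1Lift b : Sp1 → Spin N) :=
  (dSmooth_spLift (b.map quatStar)).comp dSmooth_diagSp

/-- The two lifts cover commuting transformations, so they commute up to sign. The sign disappears
for squares, and squares generate Sp(k). -/
lemma sp1Lift_commute (A : Sp k) (q : Sp1) : Commute (spLift b A) (sp1Lift b q) := by
  have key : ∀ A : Sp k, (sp1Lift b q * spLift b A : Cl N) = spLift b A * sp1Lift b q ∨
      (sp1Lift b q * spLift b A : Cl N) = -(spLift b A * sp1Lift b q) := by
    intro A
    refine Covers.eq_or_eq_neg (b := b) (x := sp1Lift b q * spLift b A)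
      (y := spLift b A * sp1Lift b q)
      ((covers_sp1Lift b q).mul (covers_spLift b A))
      (((covers_spLift b A).mul (covers_sp1Lift b q)).congr fun v => spAct_rmul _ _ _)
  refine Commute.symm (Subgroup.mem_centralizer_singleton_iff.1 (sp_mem_of_sq_mem
    (C := (Subgroup.centralizer {sp1Lift b q}).comap (spLift b)) (fun A => ?_) A)).symm
  rw [Subgroup.mem_comap, Subgroup.mem_centralizer_singleton_iff]
  apply Subtype.ext
  rw [map_mul]
  simp only [Submonoid.coe_mul]
  rcases key A with h | h
  · rw [mul_assoc, ← h, ← mul_assoc, ← h, mul_assoc]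
  · rw [mul_assoc, ← neg_eq_iff_eq_neg.2 h, mul_neg, ← mul_assoc, ← neg_eq_iff_eq_neg.2 h, neg_mul,
      neg_neg, mul_assoc]

/-- The lift of -1 is the product over the coordinates of (ei)(e)(ek)(ej). Conjugation fixes e and
negates the other three vectors, so each coordinate contributes a factor -1. -/
lemma spLift_map_quatStar_neg_one :
    (spLift (b.map quatStar) (-1) : Cl N) = (-1) ^ k * spLift b (-1) := by
  -- The induction follows the element that is -1 on the coordinates in `s` and 1 on the others.
  have key : ∀ s : Finset (Fin k), ∃ A : Sp k,
      (∀ l, spAct A (qe l) = if l ∈ s then -qe l else qe l) ∧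
      (spLift (b.map quatStar) A : Cl N) = (-1) ^ s.card * spLift b A := by
    intro s
    induction s using Finset.induction_on with
    | empty => exact ⟨1, by simp, by simp⟩
    | insert i s hi ih =>
      obtain ⟨A, hA, hA'⟩ := ih
      refine ⟨urefl (qe i) (norm_qe i) (-1) * A, fun l => ?_, ?_⟩
      · rw [map_mul]
        change spAct (urefl (qe i) (norm_qe i) (-1)) (spAct A (qe l)) = _
        by_cases hl : l = i
        · subst hl
          have := spAct_urefl_self (norm_qe l) (-1) 1
          rw [rmul_one] at this
          rw [hA, if_neg hi, this, if_pos (Finset.mem_insert_self _ _)]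
          ext1 j
          simp [coe_neg_one_sp1]
        · have h0 : herm (qe i) (qe l) = 0 := by
            rw [herm_qe_left, qe_apply, if_neg (Ne.symm hl)]
          rw [hA, apply_ite (spAct _), map_neg, spAct_urefl_of_orthogonal _ _ h0]
          simp [hl]
      · rw [map_mul, map_mul, Submonoid.coe_mul, Submonoid.coe_mul, hA', spLift_urefl_neg_one,
          spLift_urefl_neg_one, Finset.card_insert_of_notMem hi, pow_succ]
        simp only [gam_map_quatStar]
        have hu : quatStar (qe i) = qe i := by
          ext1 j; rw [quatStar_apply, qe_apply]; split_ifs <;> simp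
        have hq : ∀ q : Sp1, star q.1 = -q.1 →
            quatStar (rmul q.1 (qe i)) = -rmul q.1 (qe i) := by
          intro q hq
          ext1 j
          rw [quatStar_apply, rmul_apply, star_mul, hq, PiLp.neg_apply, rmul_apply, qe_apply]
          split_ifs <;> simp
        rw [hu, hq qI (by ext <;> simp [qI_coords]), hq qJ (by ext <;> simp [qJ_coords]),
          hq qK (by ext <;> simp [qK_coords])]
        have hc : ∀ x : Cl N, x * (-1) ^ s.card = (-1) ^ s.card * x := fun x =>
          ((Commute.one_right x).neg_right.pow_right _).eq
        simp only [map_neg]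
        rw [← mul_assoc _ ((-1) ^ s.card), hc]
        noncomm_ring
  obtain ⟨A, hA, hA'⟩ := key Finset.univ
  have : A = -1 := sp_ext fun l => by
    rw [hA, if_pos (Finset.mem_univ _)]
    ext1 i
    rw [spAct_qe, coe_neg_one_sp, Matrix.neg_apply, Matrix.one_apply, PiLp.neg_apply, qe_apply]
  rw [this] at hA'
  simpa using hA'

/-- The lift of `Sp(k) × Sp(1)` to the spin group. -/
def spSpLift : Sp k × Sp1 →* Spin N :=
  (spLift b).noncommCoprod (sp1Lift b) (sp1Lift_commute b)

lemma covers_spSpLift (z : Sp k × Sp1) : Covers b (spSpLift b z) (spSpIsometry z) :=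
  ((covers_sp1Lift b z.2).mul (covers_spLift b z.1)).congr (fun v => (spSpIsometry_eq _ _ _).symm)
    |> fun h => by
      rw [← Submonoid.coe_mul, ← (sp1Lift_commute b z.1 z.2).eq] at h
      exact h

/-- The two lifts of the scalar -1 differ by (-1)ᵏ, and each has square 1. Since (-1, -1) dies in
Sp(k)·Sp(1), the parity of `k` decides whether the lift descends. -/
lemma spSpLift_neg_one : (spSpLift b (-1, -1) : Cl N) = (-1) ^ k := by
  have h2 : (spLift b (-1 : Sp k) : Cl N) * spLift b (-1 : Sp k) = 1 := by
    rw [← Submonoid.coe_mul, ← map_mul]; simp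
  change (spLift b (-1) : Cl N) * (spLift (b.map quatStar) (diagSp (-1)) : Cl N) = _
  rw [diagSp_neg_one, spLift_map_quatStar_neg_one, ← mul_assoc,
    ((Commute.one_right (spLift b (-1 : Sp k) : Cl N)).neg_right.pow_right k).eq, mul_assoc, h2,
    mul_one]

lemma dSmooth_spSpLift : DSmooth (spSpLift b : Sp k × Sp1 → Spin N) := by
  intro n p hp
  refine isPlot_subtype_iff.2 (isPlot_iff_linSmoothAt.2 fun t => ?_)
  have h1 := isPlot_iff_linSmoothAt.1 (isPlot_subtype_iff.1
    (dSmooth_spLift b n _ (isPlot_prod_iff.1 hp).1)) t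
  have h2 := isPlot_iff_linSmoothAt.1 (isPlot_subtype_iff.1
    (dSmooth_sp1Lift b n _ (isPlot_prod_iff.1 hp).2)) t
  exact h1.mul h2

end Fock

/-! ### Diffeological groups -/

/-- A group with smooth multiplication and inversion. -/
class IsDiffeologicalGroup (K : Type*) [Group K] [DiffeologicalSpace K] : Prop where
  dSmooth_mul : DSmooth fun x : K × K => x.1 * x.2
  dSmooth_inv : DSmooth fun x : K => x⁻¹

section DiffeologicalGroup

variable {K : Type*} [Group K] [DiffeologicalSpace K]

lemma isPlot_mul [IsDiffeologicalGroup K] {n : ℕ} {p q : EuclideanSpace ℝ (Fin n) → K}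
    (hp : IsPlot p) (hq : IsPlot q) : IsPlot fun t => p t * q t :=
  IsDiffeologicalGroup.dSmooth_mul n (fun t => (p t, q t)) (isPlot_prod_iff.2 ⟨hp, hq⟩)

lemma isPlot_inv [IsDiffeologicalGroup K] {n : ℕ} {p : EuclideanSpace ℝ (Fin n) → K}
    (hp : IsPlot p) : IsPlot fun t => (p t)⁻¹ :=
  IsDiffeologicalGroup.dSmooth_inv n p hp

instance {L : Type*} [Group L] [DiffeologicalSpace L] [IsDiffeologicalGroup K]
    [IsDiffeologicalGroup L] : IsDiffeologicalGroup (K × L) where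
  dSmooth_mul n p hp := by
    obtain ⟨h1, h2⟩ := isPlot_prod_iff.1 hp
    obtain ⟨h3, h4⟩ := isPlot_prod_iff.1 h1
    obtain ⟨h5, h6⟩ := isPlot_prod_iff.1 h2
    exact isPlot_prod_iff.2 ⟨isPlot_mul h3 h5, isPlot_mul h4 h6⟩
  dSmooth_inv n p hp := by
    obtain ⟨h1, h2⟩ := isPlot_prod_iff.1 hp
    exact isPlot_prod_iff.2 ⟨isPlot_inv h1, isPlot_inv h2⟩

instance [IsDiffeologicalGroup K] (N : Subgroup K) [N.Normal] : IsDiffeologicalGroup (K ⧸ N) where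
  dSmooth_mul := by
    refine ((subduction_quotientMk N).prodMap (subduction_quotientMk N)).dSmooth ?_
    exact (dSmooth_quotientMk N).comp IsDiffeologicalGroup.dSmooth_mul
  dSmooth_inv := by
    refine (subduction_quotientMk N).dSmooth ?_
    exact (dSmooth_quotientMk N).comp IsDiffeologicalGroup.dSmooth_inv

lemma isPlot_spin_iff {N n : ℕ} {p : EuclideanSpace ℝ (Fin n) → Spin N} :
    IsPlot p ↔ ∀ t, LinSmoothAt (fun s => (p s : Cl N)) t :=
  isPlot_subtype_iff.trans isPlot_iff_linSmoothAt

lemma LinSmoothAt.star_cl {F : Type*} [NormedAddCommGroup F] [NormedSpace ℝ F] {N : ℕ}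
    {x : F → Cl N} {t : F} (hx : LinSmoothAt x t) : LinSmoothAt (fun s => star (x s)) t :=
  hx.linear (reverse ∘ₗ (involute (Q := euclideanForm N)).toLinearMap)

instance (N : ℕ) : IsDiffeologicalGroup (Spin N) where
  dSmooth_mul n p hp := by
    obtain ⟨h1, h2⟩ := isPlot_prod_iff.1 hp
    exact isPlot_spin_iff.2 fun t => (isPlot_spin_iff.1 h1 t).mul (isPlot_spin_iff.1 h2 t)
  dSmooth_inv n p hp := by
    refine isPlot_spin_iff.2 fun t => ?_
    simp only [Function.comp_apply, spin_coe_inv]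
    exact (isPlot_spin_iff.1 hp t).star_cl

lemma linSmoothAt_spinConj {F : Type*} [NormedAddCommGroup F] [NormedSpace ℝ F] {N : ℕ}
    {x : F → Spin N} {t : F} (hx : LinSmoothAt (fun s => (x s : Cl N)) t) (v : Fin N → ℝ) :
    LinSmoothAt (fun s => spinConj (x s) v) t := by
  obtain ⟨L, hL⟩ := LinearMap.exists_leftInverse_of_injective (ι (euclideanForm N))
    (LinearMap.ker_eq_bot.2 (ι_inj N))
  have : ∀ s, spinConj (x s) v = L (x s * (ι (euclideanForm N) v * star (x s : Cl N))) := by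
    intro s
    rw [← ι_spinConj]
    exact (LinearMap.congr_fun hL _).symm
  simp only [this]
  exact (hx.mul ((linSmoothAt_const _ _).mul hx.star_cl)).linear L

lemma contDiff_spinCover {N n : ℕ} {x : EuclideanSpace ℝ (Fin n) → Spin N} (hx : IsPlot x)
    (i j : Fin N) : ContDiff ℝ ∞ fun t => (spinCover N (x t)).1 i j := by
  rw [contDiff_iff_contDiffAt]
  intro t
  simp only [spinCover_apply]
  exact linSmoothAt_spinConj (isPlot_spin_iff.1 hx t) (Pi.single j 1) (LinearMap.proj i)

end DiffeologicalGroup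

/-! ### The inclusion `Spinʳ(m) → Spinʳ(m + 1)` -/

section SpinRIncl

variable {r m : ℕ}

/-- The class `[μ, ν] ∈ Spinʳ(n)`. -/
abbrev spinRMk (r n : ℕ) : Spin n × Spin r →* SpinR r n := QuotientGroup.mk' (spinRCenter r n)

@[simp] lemma spinRCover_mk (n : ℕ) (z : Spin n × Spin r) :
    spinRCover r n (spinRMk r n z) = spinCover n z.1 := rfl

lemma exists_spinRMk_eq {n : ℕ} (x : SpinR r n) : ∃ μ ν, spinRMk r n (μ, ν) = x := by
  obtain ⟨⟨μ, ν⟩, h⟩ := QuotientGroup.mk'_surjective _ x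
  exact ⟨μ, ν, h⟩

lemma spinRMk_eq_iff {n : ℕ} {z w : Spin n × Spin r} : spinRMk r n z = spinRMk r n w ↔
    ((z.1 : Cl n) = w.1 ∧ (z.2 : Cl r) = w.2) ∨ ((z.1 : Cl n) = -w.1 ∧ (z.2 : Cl r) = -w.2) := by
  have key : ∀ {l : ℕ} (x y : Spin l) (c : Cl l), Commute c (x : Cl l) →
      (((x⁻¹ * y : Spin l) : Cl l) = c ↔ (y : Cl l) = c * x) := by
    intro l x y c hc
    rw [Submonoid.coe_mul, spin_coe_inv]
    constructor
    · rintro rfl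
      rw [hc.eq, ← mul_assoc, spin_mul_star, one_mul]
    · intro h
      rw [h, hc.eq, ← mul_assoc, spin_star_mul, one_mul]
  have h1 : spinRMk r n z = spinRMk r n w ↔ w⁻¹ * z ∈ spinRCenter r n := by
    rw [eq_comm]; exact QuotientGroup.eq
  rw [h1]
  change (_ ∧ _) ∨ (_ ∧ _) ↔ _
  simp only [Prod.fst_mul, Prod.snd_mul, Prod.fst_inv, Prod.snd_inv]
  rw [key _ _ _ (Commute.one_left _), key _ _ _ (Commute.one_left _),
    key _ _ _ (Commute.one_left _).neg_left, key _ _ _ (Commute.one_left _).neg_left]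
  simp only [one_mul, neg_mul]

lemma dSmooth_spinRMk (r n : ℕ) : DSmooth (spinRMk r n : Spin n × Spin r → SpinR r n) :=
  dSmooth_quotientMk _

lemma subduction_spinRMk (r n : ℕ) : Subduction (spinRMk r n : Spin n × Spin r → SpinR r n) :=
  subduction_quotientMk _

/-- The inclusion `Spinʳ(m) → Spinʳ(m + 1)`. -/
def spinRIncl (r m : ℕ) : SpinR r m →* SpinR r (m + 1) :=
  QuotientGroup.map _ _ ((inclSpin m).prodMap (MonoidHom.id _)) (by
    rintro z (⟨h1, h2⟩ | ⟨h1, h2⟩)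
    · exact Or.inl ⟨by change inclCl m (z.1 : Cl m) = 1; rw [h1, map_one], h2⟩
    · exact Or.inr ⟨by change inclCl m (z.1 : Cl m) = -1; rw [h1, map_neg, map_one], h2⟩)

@[simp] lemma spinRIncl_mk (z : Spin m × Spin r) :
    spinRIncl r m (spinRMk r m z) = spinRMk r (m + 1) (inclSpin m z.1, z.2) := rfl

lemma spinRIncl_injective : Function.Injective (spinRIncl r m) := by
  intro x y h
  obtain ⟨μ, ν, rfl⟩ := exists_spinRMk_eq x
  obtain ⟨μ', ν', rfl⟩ := exists_spinRMk_eq y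
  rw [spinRIncl_mk, spinRIncl_mk, spinRMk_eq_iff] at h
  rw [spinRMk_eq_iff]
  refine h.imp (fun h => ⟨inclCl_injective h.1, h.2⟩) (fun h => ⟨inclCl_injective ?_, h.2⟩)
  rw [map_neg]
  exact h.1

lemma isPlot_inclSpin {n : ℕ} {p : EuclideanSpace ℝ (Fin n) → Spin m} (hp : IsPlot p) :
    IsPlot fun t => inclSpin m (p t) :=
  isPlot_spin_iff.2 fun t => (isPlot_spin_iff.1 hp t).linear (inclCl m).toLinearMap

lemma dSmooth_spinRIncl : DSmooth (spinRIncl r m) := by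
  refine (subduction_spinRMk r m).dSmooth ?_
  refine (dSmooth_spinRMk r (m + 1)).comp (f := fun z : Spin m × Spin r => (inclSpin m z.1, z.2)) ?_
  intro n p hp
  exact isPlot_prod_iff.2 ⟨isPlot_inclSpin (isPlot_prod_iff.1 hp).1, (isPlot_prod_iff.1 hp).2⟩

/-- The inclusion `Spinʳ(m) → Spinʳ(m + 1)` is an embedding. -/
lemma isPlot_of_isPlot_spinRIncl (hm : 0 < m) {n : ℕ} {p : EuclideanSpace ℝ (Fin n) → SpinR r m}
    (hp : IsPlot fun t => spinRIncl r m (p t)) : IsPlot p := by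
  refine (subduction_spinRMk r (m + 1)).isPlot_of_lifts hp fun d g q hg hq hqp => ?_
  obtain ⟨hq1, hq2⟩ := isPlot_prod_iff.1 hq
  -- Whichever of its two representatives is lifted, the first component lies in Spin(m), because -1
  -- does. Its smoothness is then recovered by the linear retraction `retrCl`.
  have key : ∀ s, ∃ w : Spin m, inclSpin m w = (q s).1 ∧ p (g s) = spinRMk r m (w, (q s).2) := by
    intro s
    obtain ⟨μ, ν, hz⟩ := exists_spinRMk_eq (p (g s))
    have h := hqp s
    rw [← hz, spinRIncl_mk, spinRMk_eq_iff] at h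
    rcases h with ⟨h1, h2⟩ | ⟨h1, h2⟩
    · refine ⟨μ, Subtype.ext h1.symm, ?_⟩
      rw [← hz, spinRMk_eq_iff]
      exact Or.inl ⟨rfl, h2.symm⟩
    · have hn : ((negOneSpin hm * μ : Spin m) : Cl m) = -μ := by
        rw [Submonoid.coe_mul]; change -1 * _ = _; rw [neg_one_mul]
      refine ⟨negOneSpin hm * μ, Subtype.ext ?_, ?_⟩
      · rw [h1, coe_inclSpin, hn, map_neg]; rfl
      · rw [← hz, spinRMk_eq_iff]
        right
        rw [hn, neg_neg]
        exact ⟨rfl, by rw [h2, neg_neg]⟩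
  choose w hw hw' using key
  simp only [hw']
  refine dSmooth_spinRMk r m d (fun s => (w s, (q s).2)) (isPlot_prod_iff.2 ⟨?_, hq2⟩)
  refine isPlot_spin_iff.2 fun t => ((isPlot_spin_iff.1 hq1 t).linear (retrCl m)).congr
    (Filter.Eventually.of_forall fun s => ?_)
  change (w s : Cl m) = retrCl m ((q s).1 : Cl (m + 1))
  rw [← hw, coe_inclSpin, retrCl_inclCl]

@[simp] lemma spinRAux_spinRIncl (x : SpinR r m) :
    spinRAux r (m + 1) (spinRIncl r m x) = spinRAux r m x := by
  obtain ⟨μ, ν, rfl⟩ := exists_spinRMk_eq x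
  rfl

lemma spinRCover_spinRIncl_zero (x : SpinR r m) (i : Fin (m + 1)) :
    (spinRCover r (m + 1) (spinRIncl r m x)).1 i 0 = if i = 0 then 1 else 0 := by
  obtain ⟨μ, ν, rfl⟩ := exists_spinRMk_eq x
  exact spinCover_inclSpin_zero μ i

lemma spinRCover_spinRIncl_succ (x : SpinR r m) (j : Fin m) :
    (spinRCover r (m + 1) (spinRIncl r m x)).1 0 j.succ = 0 ∧
      ∀ i, (spinRCover r (m + 1) (spinRIncl r m x)).1 i.succ j.succ = (spinRCover r m x).1 i j := by
  obtain ⟨μ, ν, rfl⟩ := exists_spinRMk_eq x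
  exact spinCover_inclSpin_succ μ j

lemma exists_spinRIncl_eq (hm : 0 < m) {y : SpinR r (m + 1)}
    (hy : ∀ i, (spinRCover r (m + 1) y).1 i 0 = if i = 0 then 1 else 0) :
    ∃ x, spinRIncl r m x = y := by
  obtain ⟨μ, ν, rfl⟩ := exists_spinRMk_eq y
  obtain ⟨x, rfl⟩ := exists_inclSpin_eq hm (y := μ) hy
  exact ⟨spinRMk r m (x, ν), rfl⟩

end SpinRIncl

/-! ### Principal bundles from groups -/

section GroupBundle

variable {K H M : Type*} [Group K] [Group H] [DiffeologicalSpace K] [DiffeologicalSpace H]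
  [DiffeologicalSpace M] [IsDiffeologicalGroup K]

/-- A smooth section over `U` trivializes the projection of a group onto a coset space. -/
lemma exists_trivialization {j : H →* K} (hj : Function.Injective j) (hjs : DSmooth j)
    (hjp : ∀ (n : ℕ) (p : EuclideanSpace ℝ (Fin n) → H), IsPlot (fun t => j (p t)) → IsPlot p)
    {proj : K → M} (hproj : DSmooth proj) (hprojj : ∀ a h, proj (a * j h) = proj a)
    (hfib : ∀ a b, proj a = proj b → ∃ h, b = a * j h) {U : Set M} {s : U → K} (hs : DSmooth s)
    (hsp : ∀ u, proj (s u) = u) :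
    ∃ e : U × H ≃ {p : K // proj p ∈ U}, DSmooth e ∧ DSmooth e.symm ∧
      (∀ u h, proj (e (u, h)).1 = u) ∧ ∀ u h l, (e (u, h * l)).1 = (e (u, h)).1 * j l := by
  let f : U × H → {p : K // proj p ∈ U} := fun x => ⟨s x.1 * j x.2, by
    rw [hprojj, hsp]; exact x.1.2⟩
  have hf : Function.Bijective f := by
    constructor
    · rintro ⟨u, h⟩ ⟨u', h'⟩ hu
      have h1 : s u * j h = s u' * j h' := congrArg Subtype.val hu
      have h2 : u = u' := by
        apply Subtype.ext
        rw [← hsp, ← hprojj (s u) h, h1, hprojj, hsp]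
      subst h2
      rw [hj (mul_left_cancel h1)]
    · rintro ⟨p, hp⟩
      obtain ⟨h, hh⟩ := hfib (s ⟨proj p, hp⟩) p (hsp _)
      exact ⟨(⟨proj p, hp⟩, h), Subtype.ext hh.symm⟩
  refine ⟨Equiv.ofBijective f hf, ?_, ?_, ?_, ?_⟩
  · intro n p hp
    obtain ⟨h1, h2⟩ := isPlot_prod_iff.1 hp
    exact isPlot_subtype_iff.2 (isPlot_mul (hs n _ h1) (hjs n _ h2))
  · intro n p hp
    set e := Equiv.ofBijective f hf
    have h1 : ∀ t, s (e.symm (p t)).1 * j (e.symm (p t)).2 = (p t).1 := fun t =>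
      congrArg Subtype.val (e.apply_symm_apply (p t))
    have h2 : ∀ t, ((e.symm (p t)).1 : M) = proj (p t).1 := fun t => by
      rw [← h1, hprojj, hsp]
    have h3 : IsPlot fun t => (e.symm (p t)).1 := by
      refine isPlot_subtype_iff.2 ?_
      simp only [h2]
      exact hproj n _ hp
    refine isPlot_prod_iff.2 ⟨h3, hjp n _ ?_⟩
    have h4 : ∀ t, j (e.symm (p t)).2 = (s (e.symm (p t)).1)⁻¹ * (p t).1 := fun t => by
      rw [eq_inv_mul_iff_mul_eq, h1]
    simp only [Function.comp_apply, h4]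
    exact isPlot_mul (isPlot_inv (hs n _ h3)) hp
  · intro u h
    change proj (s u * j h) = u
    rw [hprojj, hsp]
  · intro u h l
    change s u * j (h * l) = s u * j h * j l
    rw [map_mul, mul_assoc]

end GroupBundle

/-! ### The homogeneous spinʳ structures -/

section Homogeneous

variable {V : Type*} [NormedAddCommGroup V] [InnerProductSpace ℝ V] {m r : ℕ}
  {o : Orientation ℝ V (Fin (m + 1))}
  (b : OrthonormalBasis (Fin (m + 1)) ℝ V)

/-- The `i`-th vector of the frame `b · A`. -/
def frameVec {N : ℕ} (b : OrthonormalBasis (Fin N) ℝ V)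
    (A : Matrix.specialOrthogonalGroup (Fin N) ℝ) (i : Fin N) : V := ∑ j, A.1 j i • b j

lemma frameVec_mul {N : ℕ} (b : OrthonormalBasis (Fin N) ℝ V)
    (A B : Matrix.specialOrthogonalGroup (Fin N) ℝ) (i : Fin N) :
    frameVec b (A * B) i = ∑ j, B.1 j i • frameVec b A j := by
  simp only [frameVec, Submonoid.coe_mul, Matrix.mul_apply, Finset.sum_smul, Finset.smul_sum]
  rw [Finset.sum_comm]
  refine Finset.sum_congr rfl fun j _ => Finset.sum_congr rfl fun l _ => ?_
  rw [smul_smul, mul_comm]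

lemma norm_frameVec {N : ℕ} (b : OrthonormalBasis (Fin N) ℝ V)
    (A : Matrix.specialOrthogonalGroup (Fin N) ℝ) (i : Fin N) : ‖frameVec b A i‖ = 1 :=
  (orthonormal_of_specialOrthogonal b A).1 i

lemma exists_frame_basis (hb : b.toBasis.orientation = o)
    (A : Matrix.specialOrthogonalGroup (Fin (m + 1)) ℝ) :
    ∃ b' : OrthonormalBasis (Fin (m + 1)) ℝ V, (∀ i, b' i = frameVec b A i) ∧
      b'.toBasis.orientation = o := by
  obtain ⟨φ, hdet, hφ⟩ := exists_isometry_of_specialOrthogonal b A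
  refine ⟨b.map φ, fun i => by rw [OrthonormalBasis.map_apply, hφ]; rfl, ?_⟩
  rw [OrthonormalBasis.toBasis_map, ← hb, Module.Basis.orientation_comp_linearEquiv_eq_iff_det_pos,
    hdet]
  exact one_pos

/-- The base point of the frame `b · λ(x)`. -/
def frameBase (x : SpinR r (m + 1)) : Metric.sphere (0 : V) 1 :=
  ⟨frameVec b (spinRCover r (m + 1) x) 0, by rw [mem_sphere_zero_iff_norm, norm_frameVec]⟩

/-- The frame `b · λ(x)`. -/
def frameOf (hb : b.toBasis.orientation = o) (x : SpinR r (m + 1)) : SphereFrame o where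
  base := frameBase b x
  vec i := frameVec b (spinRCover r (m + 1) x) i.succ
  positive := by
    obtain ⟨b', h1, h2⟩ := exists_frame_basis b hb (spinRCover r (m + 1) x)
    exact ⟨b', h1 0, fun i => h1 _, h2⟩

lemma frameBase_mul_spinRIncl (x : SpinR r (m + 1)) (k : SpinR r m) :
    frameBase b (x * spinRIncl r m k) = frameBase b x := by
  apply Subtype.ext
  change frameVec b _ 0 = frameVec b _ 0
  rw [map_mul, frameVec_mul]
  simp [spinRCover_spinRIncl_zero]

lemma frameVec_mul_spinRIncl (x : SpinR r (m + 1)) (k : SpinR r m) (i : Fin m) :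
    frameVec b (spinRCover r (m + 1) (x * spinRIncl r m k)) i.succ =
      ∑ j, (spinRCover r m k).1 j i • frameVec b (spinRCover r (m + 1) x) j.succ := by
  rw [map_mul, frameVec_mul, Fin.sum_univ_succ, (spinRCover_spinRIncl_succ k i).1, zero_smul,
    zero_add]
  simp only [(spinRCover_spinRIncl_succ k i).2]

/-- If x and y have the same base point, x⁻¹y fixes the first basis vector, and the stabilizer of
that vector is Spinʳ(m). -/
lemma exists_eq_mul_spinRIncl (hm : 0 < m) {x y : SpinR r (m + 1)}
    (h : frameBase b x = frameBase b y) : ∃ k, y = x * spinRIncl r m k := by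
  obtain ⟨k, hk⟩ := exists_spinRIncl_eq (r := r) hm (y := x⁻¹ * y) (fun i => by
    set A := spinRCover r (m + 1) x with hA
    set B := spinRCover r (m + 1) (x⁻¹ * y) with hB
    have h1 : frameVec b A 0 = ∑ j, B.1 j 0 • frameVec b A j := by
      rw [← frameVec_mul, hA, hB, ← map_mul, mul_inv_cancel_left]
      exact congrArg Subtype.val h
    have h2 := (orthonormal_of_specialOrthogonal b A).inner_right_fintype (fun j => B.1 j 0) i
    change inner ℝ (frameVec b A i) (∑ j, B.1 j 0 • frameVec b A j) = _ at h2
    rw [← h1] at h2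
    rw [← h2]
    exact orthonormal_iff_ite.1 (orthonormal_of_specialOrthogonal b A) i 0)
  exact ⟨k, by rw [hk, mul_inv_cancel_left]⟩

lemma frameVec_of_covers {N : ℕ} {b : OrthonormalBasis (Fin N) ℝ V} {x : Spin N}
    {φ : V ≃ₗᵢ[ℝ] V} (h : Covers b x φ) (i : Fin N) : frameVec b (spinCover N x) i = φ (b i) :=
  ((covers_matrix_iff (T := (φ.toLinearEquiv : V →ₗ[ℝ] V))).1 h i).symm

lemma frameBase_surjective (hm : 0 < m) (x : Metric.sphere (0 : V) 1) :
    ∃ y : Spin (m + 1), frameBase b (spinRMk r (m + 1) (y, 1)) = x := by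
  have hx : ‖(x : V)‖ = 1 := mem_sphere_zero_iff_norm.1 x.2
  have key : ∀ (y : Spin (m + 1)) (φ : V ≃ₗᵢ[ℝ] V), Covers b y φ → φ (b 0) = x →
      frameBase b (spinRMk r (m + 1) (y, 1)) = x := fun y φ h h' => Subtype.ext <| by
    change frameVec b (spinRCover r (m + 1) (spinRMk r (m + 1) (y, 1))) 0 = x
    rw [spinRCover_mk, frameVec_of_covers h, h']
  have h0 : ‖b 0‖ = 1 := b.orthonormal.1 0
  -- The antipode of `b 0` is not reached by a single rotor; the last basis vector, different from
  -- `b 0` as m > 0, serves as an intermediate stop.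
  by_cases h : b 0 + x = 0
  · have h1 : (0 : Fin (m + 1)) ≠ Fin.last m := by
      rw [Ne, Fin.ext_iff]; simp; omega
    have hl : ‖b (Fin.last m)‖ = 1 := b.orthonormal.1 _
    have h01 : inner ℝ (b 0) (b (Fin.last m)) = 0 := b.orthonormal.2 h1
    have h2 := add_ne_zero_of_orthonormal h0 hl h01
    have hx0 : (x : V) = -b 0 := (neg_eq_of_add_eq_zero_right h).symm
    have h3 : b (Fin.last m) + x ≠ 0 := add_ne_zero_of_orthonormal hl hx
      (by rw [hx0, inner_neg_right, real_inner_comm, h01, neg_zero])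
    refine ⟨⟨_, rotorCl_mem b hl h3⟩ * ⟨_, rotorCl_mem b h0 h2⟩,
      key _ (rotor (b (Fin.last m)) x * rotor (b 0) (b (Fin.last m)))
      ((covers_rotorCl b hl h3).mul (covers_rotorCl b h0 h2)) ?_⟩
    change rotor (b (Fin.last m)) (x : V) (rotor (b 0) (b (Fin.last m)) (b 0)) = x
    rw [rotor_apply_self h0 hl h2, rotor_apply_self hl hx h3]
  · exact ⟨⟨_, rotorCl_mem b h0 h⟩, key _ (rotor (b 0) x) (covers_rotorCl b h0 h)
      (rotor_apply_self h0 hx h)⟩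

section Smooth

variable [DiffeologicalSpace V]

lemma isPlot_sphereFrame_iff {n : ℕ} {p : EuclideanSpace ℝ (Fin n) → SphereFrame o} :
    IsPlot p ↔ IsPlot (fun t => (p t).base) ∧ ∀ i, IsPlot fun t => (p t).vec i := by
  refine DiffeologicalSpace.isPlot_inf_iff.trans (and_congr Iff.rfl ?_)
  exact DiffeologicalSpace.isPlot_iInf_iff

variable [IsLinearDiffeology V]

lemma dSmooth_frameVec (i : Fin (m + 1)) :
    DSmooth fun x : SpinR r (m + 1) => frameVec b (spinRCover r (m + 1) x) i := by
  refine (subduction_spinRMk r (m + 1)).dSmooth ?_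
  intro n p hp
  refine isPlot_iff_linSmoothAt.2 fun t => ?_
  simp only [frameVec, Function.comp_def, spinRCover_mk]
  exact LinSmoothAt.sum fun j _ => LinSmoothAt.smul
    (contDiff_spinCover (isPlot_prod_iff.1 hp).1 j i).contDiffAt (linSmoothAt_const _ _)

lemma dSmooth_frameBase : DSmooth fun x : SpinR r (m + 1) => frameBase b x :=
  dSmooth_frameVec b 0

lemma dSmooth_frameOf (hb : b.toBasis.orientation = o) :
    DSmooth fun x : SpinR r (m + 1) => frameOf b hb x := fun n p hp =>
  isPlot_sphereFrame_iff.2 ⟨dSmooth_frameBase b n p hp, fun _ => dSmooth_frameVec b _ n p hp⟩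


/-- The product with a local section defined by rotations. -/
lemma exists_section (hm : 0 < m) (x : Metric.sphere (0 : V) 1) :
    ∃ s : {u : Metric.sphere (0 : V) 1 | (x : V) + u ≠ 0} → SpinR r (m + 1),
      DSmooth s ∧ ∀ u, frameBase b (s u) = u := by
  have : FiniteDimensional ℝ V := b.toBasis.finiteDimensional_of_finite
  have hx : ‖(x : V)‖ = 1 := mem_sphere_zero_iff_norm.1 x.2
  obtain ⟨y, hy⟩ := frameBase_surjective (r := r) b hm x
  let s : {u : Metric.sphere (0 : V) 1 | (x : V) + u ≠ 0} → Spin (m + 1) := fun u =>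
    ⟨rotorCl b x u, rotorCl_mem b hx u.2⟩
  refine ⟨fun u => spinRMk r (m + 1) (s u * y, 1), ?_, fun u => Subtype.ext ?_⟩
  · refine (dSmooth_spinRMk r (m + 1)).comp (f := fun u => (s u * y, (1 : Spin r))) ?_
    intro n p hp
    refine isPlot_prod_iff.2 ⟨isPlot_mul (isPlot_spin_iff.2 fun t => ?_) isPlot_const, isPlot_const⟩
    exact linSmoothAt_rotorCl b contDiffAt_const
      (linSmoothAt_iff_contDiffAt.1 (isPlot_iff_linSmoothAt.1
        (isPlot_subtype_iff.1 (isPlot_subtype_iff.1 hp)) t)) (p t).2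
  · have hy' : frameVec b (spinCover (m + 1) y) 0 = x := congrArg Subtype.val hy
    obtain ⟨φ, hdet, hφ⟩ := exists_isometry_of_specialOrthogonal b (spinCover (m + 1) y)
    have hcy : Covers b y φ :=
      (covers_matrix_iff (T := (φ.toLinearEquiv : V →ₗ[ℝ] V))).2 hφ
    have hc : Covers b (s u * y : Spin (m + 1)) (rotor (x : V) u * φ : V ≃ₗᵢ[ℝ] V) :=
      (covers_rotorCl b hx u.2).mul hcy
    change frameVec b (spinCover (m + 1) (s u * y)) 0 = _
    rw [frameVec_of_covers hc]
    change rotor (x : V) u (φ (b 0)) = u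
    rw [← frameVec_of_covers hcy, hy',
      rotor_apply_self hx (mem_sphere_zero_iff_norm.1 u.1.2) u.2]

/-- The `Spinʳ(m)`-bundle `Spinʳ(m + 1) → Sᵐ`. -/
def homogeneousBundle (r : ℕ) (hm : 0 < m) :
    PrincipalBundle (SpinR r m) (Metric.sphere (0 : V) 1) where
  Total := SpinR r (m + 1)
  proj := frameBase b
  proj_smooth := dSmooth_frameBase b
  act x k := x * spinRIncl r m k
  act_smooth n p hp := by
    obtain ⟨h1, h2⟩ := isPlot_prod_iff.1 hp
    exact isPlot_mul h1 (dSmooth_spinRIncl n _ h2)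
  act_one p := by rw [map_one, mul_one]
  act_mul p k l := by rw [map_mul, mul_assoc]
  proj_act := frameBase_mul_spinRIncl b
  locally_trivial x := by
    obtain ⟨s, hs, hs'⟩ := exists_section (r := r) b hm x
    refine ⟨{u | (x : V) + u ≠ 0}, ?_, ?_, exists_trivialization spinRIncl_injective
      dSmooth_spinRIncl (fun _ _ => isPlot_of_isPlot_spinRIncl hm) (dSmooth_frameBase b)
      (frameBase_mul_spinRIncl b) (fun _ _ => exists_eq_mul_spinRIncl b hm) hs hs'⟩
    · exact isOpen_ne_fun (by fun_prop) continuous_const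
    · change (x : V) + x ≠ 0
      rw [← two_smul ℝ]
      refine smul_ne_zero two_ne_zero fun h => ?_
      have := mem_sphere_zero_iff_norm.1 x.2
      rw [h, norm_zero] at this
      exact zero_ne_one this

variable {G : Type*} [Group G] [DiffeologicalSpace G]

/-- The homogeneous spinʳ structure defined by a lift `Ψ` of `ρ`. -/
def homogeneousStructure (hb : b.toBasis.orientation = o) (hm : 0 < m) (ρ : G →* (V ≃ₗᵢ[ℝ] V))
    (Ψ : G →* SpinR r (m + 1)) (hΨ : DSmooth Ψ)
    (hρ : ∀ g i, ρ g (b i) = frameVec b (spinRCover r (m + 1) (Ψ g)) i) :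
    InvariantSpinRStructure o ρ r where
  toPrincipalBundle := homogeneousBundle b r hm
  Φ := frameOf b hb
  Φ_smooth := dSmooth_frameOf b hb
  base_Φ _ := rfl
  Φ_act := frameVec_mul_spinRIncl b
  gact := fun g (x : SpinR r (m + 1)) => (Ψ g * x : SpinR r (m + 1))
  gact_smooth n p hp := by
    obtain ⟨h1, h2⟩ := isPlot_prod_iff.1 hp
    exact isPlot_mul (K := SpinR r (m + 1)) (hΨ n _ h1) h2
  gact_one x := by rw [map_one]; exact one_mul (M := SpinR r (m + 1)) _
  gact_mul g h x := by rw [map_mul]; exact mul_assoc (G := SpinR r (m + 1)) _ _ _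
  gact_act g x k := (mul_assoc (G := SpinR r (m + 1)) _ _ _).symm
  base_Φ_gact := fun g (x : SpinR r (m + 1)) => by
    change frameVec b (spinRCover r (m + 1) (Ψ g * x)) 0 =
      ρ g (frameVec b (spinRCover r (m + 1) x) 0)
    rw [map_mul, frameVec_mul, frameVec, map_sum]
    simp only [map_smul, hρ]
  vec_Φ_gact := fun g (x : SpinR r (m + 1)) i => by
    change frameVec b (spinRCover r (m + 1) (Ψ g * x)) i.succ =
      ρ g (frameVec b (spinRCover r (m + 1) x) i.succ)
    rw [map_mul, frameVec_mul, frameVec, map_sum]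
    simp only [map_smul, hρ]

/-- The point [y, 1] of the fibre has trivial auxiliary component, so applying ξ to Ψ(h)p₀ = p₀k
gives ξ(k) = ξ(Ψ(h)). -/
lemma homogeneousStructure_correspondsTo (hb : b.toBasis.orientation = o) (hm : 0 < m)
    (ρ : G →* (V ≃ₗᵢ[ℝ] V)) (Ψ : G →* SpinR r (m + 1)) (hΨ : DSmooth Ψ)
    (hρ : ∀ g i, ρ g (b i) = frameVec b (spinRCover r (m + 1) (Ψ g)) i)
    (x : Metric.sphere (0 : V) 1) :
    (homogeneousStructure b hb hm ρ Ψ hΨ hρ).CorrespondsTo x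
      (((spinRAux r (m + 1)).comp Ψ).comp (isotropy ρ x).subtype) := by
  obtain ⟨y, hy⟩ := frameBase_surjective (r := r) b hm x
  let S := homogeneousStructure b hb hm ρ Ψ hΨ hρ
  let p₀ : SpinR r (m + 1) := spinRMk r (m + 1) (y, 1)
  change frameBase b p₀ = x at hy
  refine ⟨(show S.Total from p₀), hy, fun h => ?_⟩
  have h1 : frameBase b p₀ = frameBase b (Ψ h * p₀) := Subtype.ext <| by
    rw [hy]
    refine Eq.trans ?_ (S.base_Φ_gact h (show S.Total from p₀)).symm
    change _ = ρ h (frameBase b p₀)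
    rw [hy]
    exact h.2.symm
  obtain ⟨k, hk⟩ := exists_eq_mul_spinRIncl b hm h1
  refine ⟨k, hk, ?_⟩
  have h2 := congrArg (spinRAux r (m + 1)) hk
  have h3 : spinRAux r (m + 1) p₀ = 1 := map_one (spinCover r)
  rw [map_mul, map_mul, h3, mul_one, one_mul, spinRAux_spinRIncl] at h2
  exact h2.symm

end Smooth

end Homogeneous

/-! ### The invariant structures on `S⁴ᵏ⁻¹` -/

section SpSpStructure

variable {k m r : ℕ} (b : OrthonormalBasis (Fin (m + 1)) ℝ (QuatSpace k))
  {o : Orientation ℝ (QuatSpace k) (Fin (m + 1))}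

/-- The lift of the standard representation of `Sp(k)·Sp(1)` to `Spinʳ`, defined by a suitable
homomorphism `κ : Sp(1) → Spin(r)`. -/
def spSpSpinR (κ : Sp1 →* Spin r) (hκ : (κ (-1) : Cl r) = (-1) ^ k) :
    SpSp k →* SpinR r (m + 1) :=
  QuotientGroup.lift (spSpCenter k)
    ((spinRMk r (m + 1)).comp ((spSpLift b).prod (κ.comp (MonoidHom.snd _ _)))) <| by
    rintro z (rfl | rfl)
    · exact map_one _
    · refine (spinRMk_eq_iff (w := 1)).2 ?_
      change ((spSpLift b (-1, -1) : Cl (m + 1)) = 1 ∧ (κ (-1) : Cl r) = 1) ∨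
        ((spSpLift b (-1, -1) : Cl (m + 1)) = -1 ∧ (κ (-1) : Cl r) = -1)
      rw [spSpLift_neg_one, hκ]
      -- Both components of the image of (-1, -1) equal (-1)ᵏ, so the pair is in the subgroup
      -- divided out in either case.
      rcases Nat.even_or_odd k with h | h
      · simp [h.neg_one_pow]
      · simp [h.neg_one_pow]

lemma spSpSpinR_mk (κ : Sp1 →* Spin r) (hκ : (κ (-1) : Cl r) = (-1) ^ k) (z : Sp k × Sp1) :
    spSpSpinR b κ hκ (z : SpSp k) = spinRMk r (m + 1) (spSpLift b z, κ z.2) := rfl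

lemma dSmooth_spSpSpinR (κ : Sp1 →* Spin r) (hκ : (κ (-1) : Cl r) = (-1) ^ k) (hκs : DSmooth κ) :
    DSmooth (spSpSpinR b κ hκ) := by
  refine (subduction_quotientMk _).dSmooth ?_
  refine (dSmooth_spinRMk r (m + 1)).comp (f := fun z : Sp k × Sp1 => (spSpLift b z, κ z.2)) ?_
  exact (dSmooth_spSpLift b).prodMk (hκs.comp dSmooth_snd)

lemma spSpRep_eq_frameVec (κ : Sp1 →* Spin r) (hκ : (κ (-1) : Cl r) = (-1) ^ k) (g : SpSp k)
    (i : Fin (m + 1)) :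
    spSpRep k g (b i) = frameVec b (spinRCover r (m + 1) (spSpSpinR b κ hκ g)) i := by
  obtain ⟨z, rfl⟩ := QuotientGroup.mk_surjective g
  rw [spSpSpinR_mk, spinRCover_mk]
  exact (frameVec_of_covers (covers_spSpLift b z) i).symm

/-- The invariant spinʳ structure on `S⁴ᵏ⁻¹` defined by `κ : Sp(1) → Spin(r)`. -/
def spSpStructure (hb : b.toBasis.orientation = o) (hm : 0 < m) (κ : Sp1 →* Spin r)
    (hκ : (κ (-1) : Cl r) = (-1) ^ k) (hκs : DSmooth κ) :
    InvariantSpinRStructure o (spSpRep k) r :=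
  homogeneousStructure b hb hm (spSpRep k) (spSpSpinR b κ hκ) (dSmooth_spSpSpinR b κ hκ hκs)
    (spSpRep_eq_frameVec b κ hκ)

lemma spSpStructure_correspondsTo (hb : b.toBasis.orientation = o) (hm : 0 < m) (hk : Odd k)
    (x : Metric.sphere (0 : QuatSpace k) 1) :
    (spSpStructure b hb hm sp1ToSpin (by rw [sp1ToSpin_neg_one, hk.neg_one_pow])
      dSmooth_sp1ToSpin).CorrespondsTo x
      ((spSpAux k).comp (isotropy (spSpRep k) x).subtype) := by
  have h : (spinRAux 3 (m + 1)).comp (spSpSpinR b sp1ToSpin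
      (by rw [sp1ToSpin_neg_one, hk.neg_one_pow])) = spSpAux k := by
    refine MonoidHom.ext fun g => ?_
    obtain ⟨z, rfl⟩ := QuotientGroup.mk_surjective g
    exact spinCover_sp1ToSpin z.2
  rw [← h]
  exact homogeneousStructure_correspondsTo b hb hm _ _ _ _ x

lemma exists_oriented_basis (hk : m + 1 = 4 * k) (o : Orientation ℝ (QuatSpace k) (Fin (m + 1))) :
    ∃ b : OrthonormalBasis (Fin (m + 1)) ℝ (QuatSpace k), b.toBasis.orientation = o := by
  have h : Module.finrank ℝ (QuatSpace k) = m + 1 := by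
    rw [(WithLp.linearEquiv 2 ℝ (Fin k → ℍ[ℝ])).finrank_eq, Module.finrank_pi_fintype]
    simp [Quaternion.finrank_eq_four, hk, mul_comm]
  exact ⟨_, Orientation.finOrthonormalBasis_orientation m.succ_pos h o⟩

end SpSpStructure

/-! ### Invariant spinʳ structures: isotropy homomorphisms and equivalence -/

section Bundle

variable {V : Type*} [NormedAddCommGroup V] [InnerProductSpace ℝ V] [DiffeologicalSpace V]

section Principal

variable {M K : Type*} [TopologicalSpace M] [DiffeologicalSpace M] [Group K] [DiffeologicalSpace K]
  (B : PrincipalBundle K M)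

lemma PrincipalBundle.exists_proj_eq (x : M) : ∃ p, B.proj p = x := by
  obtain ⟨U, _, hx, e, _, _, he, _⟩ := B.locally_trivial x
  exact ⟨_, he ⟨x, hx⟩ 1⟩

lemma PrincipalBundle.existsUnique_act {p q : B.Total} (h : B.proj p = B.proj q) :
    ∃! k, B.act p k = q := by
  obtain ⟨U, _, hx, e, _, _, he, he'⟩ := B.locally_trivial (B.proj p)
  have key : ∀ q : B.Total, B.proj q = B.proj p → ∃ k, (e (⟨B.proj p, hx⟩, k)).1 = q := by
    intro q hq
    obtain ⟨⟨u, k⟩, hk⟩ := e.surjective ⟨q, by rw [hq]; exact hx⟩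
    have hk' : (e (u, k)).1 = q := congrArg Subtype.val hk
    refine ⟨k, ?_⟩
    conv_rhs => rw [← hk']
    congr 3
    apply Subtype.ext
    rw [← he u k, hk', hq]
  obtain ⟨a, ha⟩ := key p rfl
  obtain ⟨c, hc⟩ := key q h.symm
  have hact : ∀ k, B.act p k = (e (⟨B.proj p, hx⟩, a * k)).1 := fun k => by rw [he', ha]
  refine ⟨a⁻¹ * c, ?_, fun k hk => ?_⟩
  · change B.act p _ = q
    rw [hact, mul_inv_cancel_left, hc]
  · have h1 : (e (⟨B.proj p, hx⟩, a * k)) = e (⟨B.proj p, hx⟩, c) := Subtype.ext <| by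
      rw [hc, ← hk, hact]
    rw [eq_inv_mul_iff_mul_eq]
    exact congrArg Prod.snd (e.injective h1)

lemma PrincipalBundle.act_injective (p : B.Total) : Function.Injective (B.act p) := fun k _ h =>
  (B.existsUnique_act (B.proj_act p k).symm).unique rfl h.symm

/-- Division in a principal bundle is smooth. -/
lemma PrincipalBundle.isPlot_div [IsDiffeologicalGroup K]
    (hM : ∀ (n : ℕ) (x : EuclideanSpace ℝ (Fin n) → M), IsPlot x → Continuous x) {n : ℕ}
    {p q : EuclideanSpace ℝ (Fin n) → B.Total} {k : EuclideanSpace ℝ (Fin n) → K}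
    (hp : IsPlot p) (hq : IsPlot q) (h : ∀ t, B.act (p t) (k t) = q t) : IsPlot k := by
  refine isPlot_of_locally fun t => ?_
  obtain ⟨U, hU, hx, e, _, hes, he, he'⟩ := B.locally_trivial (B.proj (p t))
  refine ⟨(fun s => B.proj (p s)) ⁻¹' U, hU.preimage (hM n _ (B.proj_smooth n p hp)), hx,
    fun d g hg hg' => ?_⟩
  let p' : EuclideanSpace ℝ (Fin d) → {y : B.Total // B.proj y ∈ U} := fun s => ⟨p (g s), hg s⟩
  let q' : EuclideanSpace ℝ (Fin d) → {y : B.Total // B.proj y ∈ U} := fun s =>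
    ⟨q (g s), by rw [← h, B.proj_act]; exact hg s⟩
  have hp' : IsPlot fun s => (e.symm (p' s)).2 :=
    (isPlot_prod_iff.1 (hes d p' (isPlot_subtype_iff.2 (hp.comp_contDiff hg')))).2
  have hq' : IsPlot fun s => (e.symm (q' s)).2 :=
    (isPlot_prod_iff.1 (hes d q' (isPlot_subtype_iff.2 (hq.comp_contDiff hg')))).2
  have : ∀ s, k (g s) = (e.symm (p' s)).2⁻¹ * (e.symm (q' s)).2 := by
    intro s
    rw [eq_inv_mul_iff_mul_eq]
    have h1 : e ((e.symm (p' s)).1, (e.symm (p' s)).2 * k (g s)) = q' s := Subtype.ext <| by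
      rw [he', Prod.mk.eta, Equiv.apply_symm_apply]
      exact h _
    rw [← h1, Equiv.symm_apply_apply]
  simp only [this]
  exact isPlot_mul (isPlot_inv hp') hq'

end Principal

lemma continuous_of_isPlot_sphere [IsLinearDiffeology V] [FiniteDimensional ℝ V] (n : ℕ)
    (x : EuclideanSpace ℝ (Fin n) → Metric.sphere (0 : V) 1) (hx : IsPlot x) : Continuous x :=
  continuous_induced_rng.2 (isPlot_iff_contDiff_of_linear.1 (isPlot_subtype_iff.1 hx)).continuous

lemma SphereFrame.ext' {V : Type*} [NormedAddCommGroup V] [InnerProductSpace ℝ V] {m : ℕ} {o : Orientation ℝ V (Fin (m + 1))} {F F' : SphereFrame o}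
    (h : F.base = F'.base) (h' : ∀ i, F.vec i = F'.vec i) : F = F' := by
  cases F
  cases F'
  congr
  exact funext h'

section Invariant

variable {m r : ℕ} {o : Orientation ℝ V (Fin (m + 1))} {G : Type*} [Group G]
  [DiffeologicalSpace G] {ρ : G →* (V ≃ₗᵢ[ℝ] V)}

namespace InvariantSpinRStructure

variable (T : InvariantSpinRStructure o ρ r)

lemma coe_proj_gact (g : G) (t : T.Total) : (T.proj (T.gact g t) : V) = ρ g (T.proj t) := by
  rw [← T.base_Φ, T.base_Φ_gact, T.base_Φ]

/-- The isotropy homomorphism `σ` at `t`, defined by `h · t = t · σ(h)`. -/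
lemma exists_isotropyHom {x : Metric.sphere (0 : V) 1} (t : T.Total) (ht : T.proj t = x) :
    ∃ σ : isotropy ρ x →* SpinR r m, ∀ h : isotropy ρ x, T.gact h t = T.act t (σ h) := by
  have h1 : ∀ h : isotropy ρ x, ∃ k, T.act t k = T.gact h t := fun h =>
    (T.existsUnique_act (Subtype.ext (by
      rw [coe_proj_gact, ht]
      exact h.2.symm))).exists
  choose σ hσ using h1
  refine ⟨⟨⟨σ, ?_⟩, ?_⟩, fun h => (hσ h).symm⟩
  · apply T.act_injective t
    rw [hσ, T.act_one]
    exact T.gact_one t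
  · intro g h
    apply T.act_injective t
    change T.act t (σ (g * h)) = T.act t (σ g * σ h)
    rw [hσ, T.act_mul, hσ, ← T.gact_act, hσ]
    exact T.gact_mul _ _ _

lemma isPlot_isotropyHom [IsLinearDiffeology V] [FiniteDimensional ℝ V]
    {x : Metric.sphere (0 : V) 1} {t : T.Total} {σ : isotropy ρ x →* SpinR r m}
    (hσ : ∀ h : isotropy ρ x, T.gact h t = T.act t (σ h)) {n : ℕ}
    {h : EuclideanSpace ℝ (Fin n) → isotropy ρ x} (hh : IsPlot fun s => (h s : G)) :
    IsPlot fun s => σ (h s) :=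
  T.isPlot_div continuous_of_isPlot_sphere (p := fun _ => t) (q := fun s => T.gact (h s) t)
    isPlot_const (T.gact_smooth n (fun s => ((h s : G), t)) (isPlot_prod_iff.2 ⟨hh, isPlot_const⟩))
    fun _ => (hσ _).symm

/-- Structures with the same frame and isotropy homomorphism at a point admit an equivariant map. -/
lemma exists_map [IsLinearDiffeology V] [FiniteDimensional ℝ V]
    (S T : InvariantSpinRStructure o ρ r) {x₀ : Metric.sphere (0 : V) 1}
    {p₀ : S.Total} {t₀ : T.Total} (hp₀ : S.proj p₀ = x₀)
    (hst : ∀ h : isotropy ρ x₀, ∃ k, S.gact h p₀ = S.act p₀ k ∧ T.gact h t₀ = T.act t₀ k)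
    (hsec : ∀ x : Metric.sphere (0 : V) 1, ∃ U : Set (Metric.sphere (0 : V) 1), IsOpen U ∧ x ∈ U ∧
      ∃ s : U → G, DSmooth s ∧ ∀ u, ρ (s u) x₀ = u) :
    (∀ p, ∃ g k, S.act (S.gact g p₀) k = p) ∧ ∃ f : S.Total → T.Total, DSmooth f ∧
      ∀ g k, f (S.act (S.gact g p₀) k) = T.act (T.gact g t₀) k := by
  have hex : ∀ (p : S.Total) (g : G), ρ g x₀ = S.proj p → ∃ k, S.act (S.gact g p₀) k = p := by
    intro p g hg
    exact (S.existsUnique_act (Subtype.ext (by rw [coe_proj_gact, hp₀, hg]))).exists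
  have hex2 : ∀ p, ∃ g k, S.act (S.gact g p₀) k = p := by
    intro p
    obtain ⟨U, _, hx, s, _, hs⟩ := hsec (S.proj p)
    exact ⟨s ⟨_, hx⟩, hex p _ (hs ⟨_, hx⟩)⟩
  -- Two expressions g p₀ k of one point differ by an isotropy element, on which both structures act
  -- by the same `l`; hence the map g p₀ k ↦ g t₀ k is well defined.
  have hwd : ∀ g k g' k', S.act (S.gact g p₀) k = S.act (S.gact g' p₀) k' →
      T.act (T.gact g t₀) k = T.act (T.gact g' t₀) k' := by
    intro g k g' k' h
    have h1 : S.gact (g'⁻¹ * g) p₀ = S.act p₀ (k' * k⁻¹) := by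
      rw [S.gact_mul, S.act_mul]
      have h2 := congrArg (fun p => S.gact g'⁻¹ (S.act p k⁻¹)) h
      simp only [← S.act_mul, mul_inv_cancel, S.act_one] at h2
      rw [h2, S.gact_act, ← S.gact_mul, inv_mul_cancel, S.gact_one, S.act_mul]
    have h3 : ρ (g'⁻¹ * g) x₀ = x₀ := by
      rw [← hp₀, ← S.coe_proj_gact, h1, S.proj_act]
    obtain ⟨l, hl, hl'⟩ := hst ⟨_, h3⟩
    have h4 : l = k' * k⁻¹ := S.act_injective p₀ (hl.symm.trans h1)
    have h5 : T.gact g t₀ = T.gact g' (T.gact (g'⁻¹ * g) t₀) := by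
      rw [← T.gact_mul, mul_inv_cancel_left]
    rw [h5, show T.gact (g'⁻¹ * g) t₀ = T.act t₀ l from hl', h4, T.gact_act, ← T.act_mul,
      inv_mul_cancel_right]
  refine ⟨hex2, ?_⟩
  choose g₁ k₁ hgk using hex2
  refine ⟨fun p => T.act (T.gact (g₁ p) t₀) (k₁ p), ?_, fun g k => hwd _ _ _ _ (hgk _)⟩
  intro n p hp
  refine isPlot_of_locally fun t => ?_
  obtain ⟨U, hU, hx, s, hs, hs'⟩ := hsec (S.proj (p t))
  refine ⟨(fun a => S.proj (p a)) ⁻¹' U,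
    hU.preimage (continuous_of_isPlot_sphere n _ (S.proj_smooth n p hp)), hx, fun d g hg hg' => ?_⟩
  have hpg : IsPlot fun a => p (g a) := hp.comp_contDiff hg'
  -- The chosen `g₁` and `k₁` need not be smooth. Locally they are replaced by a smooth section of
  -- the orbit map and by a quotient in the bundle, without changing the value.
  have hγ : IsPlot fun a => s ⟨S.proj (p (g a)), hg a⟩ :=
    hs d _ (isPlot_subtype_iff.2 (S.proj_smooth d _ hpg))
  choose κ hκ using fun a => hex (p (g a)) (s ⟨S.proj (p (g a)), hg a⟩) (hs' _)
  have hκ' : IsPlot κ := S.isPlot_div continuous_of_isPlot_sphere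
    (S.gact_smooth d (fun a => (s ⟨S.proj (p (g a)), hg a⟩, p₀))
      (isPlot_prod_iff.2 ⟨hγ, isPlot_const⟩)) hpg hκ
  have := T.act_smooth d (fun a => (T.gact (s ⟨S.proj (p (g a)), hg a⟩) t₀, κ a))
    (isPlot_prod_iff.2 ⟨T.gact_smooth d (fun a => (s ⟨S.proj (p (g a)), hg a⟩, t₀))
      (isPlot_prod_iff.2 ⟨hγ, isPlot_const⟩), hκ'⟩)
  convert this using 2 with a
  exact hwd _ _ _ _ ((hgk _).trans (hκ a).symm)

/-- Structures with the same frame and isotropy homomorphism at a point are equivalent. -/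
lemma equivalent_of_isotropyHom [IsLinearDiffeology V] [FiniteDimensional ℝ V]
    (S T : InvariantSpinRStructure o ρ r) {x₀ : Metric.sphere (0 : V) 1}
    {p₀ : S.Total} {t₀ : T.Total} (hp₀ : S.proj p₀ = x₀) (hΦ : S.Φ p₀ = T.Φ t₀)
    (hst : ∀ h : isotropy ρ x₀, ∃ k, S.gact h p₀ = S.act p₀ k ∧ T.gact h t₀ = T.act t₀ k)
    (hsec : ∀ x : Metric.sphere (0 : V) 1, ∃ U : Set (Metric.sphere (0 : V) 1), IsOpen U ∧ x ∈ U ∧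
      ∃ s : U → G, DSmooth s ∧ ∀ u, ρ (s u) x₀ = u) : S.Equivalent T := by
  have ht₀ : T.proj t₀ = x₀ := by rw [← T.base_Φ, ← hΦ, S.base_Φ, hp₀]
  obtain ⟨hS, f, hf, hf'⟩ := exists_map S T hp₀ hst hsec
  obtain ⟨hT, f₂, hf₂, hf₂'⟩ := exists_map T S ht₀
    (fun h => (hst h).imp fun _ hk => ⟨hk.2, hk.1⟩) hsec
  refine ⟨⟨f, f₂, fun p => ?_, fun p => ?_⟩, hf, hf₂, fun p l => ?_, fun h p => ?_, fun p => ?_⟩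
  · obtain ⟨g, k, rfl⟩ := hS p
    rw [hf', hf₂']
  · obtain ⟨g, k, rfl⟩ := hT p
    rw [hf₂', hf']
  · obtain ⟨g, k, rfl⟩ := hS p
    change f _ = T.act (f _) l
    rw [← S.act_mul, hf', hf', T.act_mul]
  · obtain ⟨g, k, rfl⟩ := hS p
    change f _ = T.gact h (f _)
    rw [S.gact_act, ← S.gact_mul, hf', hf', T.gact_act, ← T.gact_mul]
  · obtain ⟨g, k, rfl⟩ := hS p
    change T.Φ (f _) = _
    rw [hf']
    refine SphereFrame.ext' ?_ fun i => ?_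
    · rw [T.base_Φ, S.base_Φ, T.proj_act, S.proj_act]
      apply Subtype.ext
      rw [coe_proj_gact, coe_proj_gact, hp₀, ht₀]
    · rw [T.Φ_act, S.Φ_act]
      simp only [T.vec_Φ_gact, S.vec_Φ_gact, hΦ]

/-- Every frame is the image of a point of a spinʳ structure. -/
lemma exists_Φ_eq (hm : 0 < m) (F : SphereFrame o) : ∃ t, T.Φ t = F := by
  obtain ⟨t, ht⟩ := T.exists_proj_eq F.base
  obtain ⟨b, hb0, hb, hbo⟩ := F.positive
  obtain ⟨c, hc0, hc, hco⟩ := (T.Φ t).positive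
  have hbc : c 0 = b 0 := by rw [hb0, hc0, T.base_Φ, ht]
  let φ := c.equiv b (Equiv.refl _)
  have hφ : ∀ i, φ (c i) = b i := fun i => by simp [φ]
  have hdet : LinearMap.det (φ.toLinearEquiv : V →ₗ[ℝ] V) = 1 := by
    have h1 := OrthonormalBasis.det_to_matrix_orthonormalBasis_of_same_orientation c b
      (hco.trans hbo.symm)
    have h2 := c.toBasis.det_comp (φ.toLinearEquiv : V →ₗ[ℝ] V) c.toBasis
    rw [Module.Basis.det_self, mul_one] at h2
    rw [← h2, ← h1]
    congr 1
    funext i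
    simp [φ]
  obtain ⟨y, hy⟩ := exists_spin_covers c φ hdet
  have hy' := (covers_matrix_iff (T := (φ.toLinearEquiv : V →ₗ[ℝ] V))).1 hy
  -- The two bases share their first vector, the base point, so the rotation between them comes from
  -- Spin(m), which moves `t` to a point over the required frame.
  obtain ⟨x, rfl⟩ := exists_inclSpin_eq hm (y := y) (fun i => by
    have h1 : φ (c 0) = ∑ j, (spinCover (m + 1) y).1 j 0 • c j := hy' 0
    rw [hφ, ← hbc] at h1
    have h2 := congrArg (fun v => c.repr v i) h1
    simp [Pi.single_apply] at h2
    rw [← h2])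
  refine ⟨T.act t (spinRMk r m (x, 1)), SphereFrame.ext' ?_ fun i => ?_⟩
  · rw [T.base_Φ, T.proj_act, ht]
  · have h1 : φ (c i.succ) = ∑ j, (spinCover (m + 1) (inclSpin m x)).1 j i.succ • c j := hy' i.succ
    rw [hφ, hb, Fin.sum_univ_succ, (spinCover_inclSpin_succ x i).1, zero_smul, zero_add] at h1
    rw [T.Φ_act, h1]
    refine Finset.sum_congr rfl fun j _ => ?_
    rw [(spinCover_inclSpin_succ x i).2, hc, spinRCover_mk]

end InvariantSpinRStructure

end Invariant

end Bundle

/-! ### Homomorphisms from `Sp(1)` to `SO(3)` -/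

section Dichotomy

/-- The skew-symmetric matrix of `x ↦ w × x`. -/
def hat (w : Fin 3 → ℝ) : Matrix (Fin 3) (Fin 3) ℝ :=
  !![0, -w 2, w 1; w 2, 0, -w 0; -w 1, w 0, 0]

lemma hat_injective : Function.Injective hat := by
  intro v w h
  have h0 := congrFun (congrFun h 2) 1
  have h1 := congrFun (congrFun h 0) 2
  have h2 := congrFun (congrFun h 1) 0
  ext i
  fin_cases i
  · simpa [hat] using h0
  · simpa [hat] using h1
  · simpa [hat] using h2

lemma transpose_mul_self_so {n : ℕ} (R : Matrix.specialOrthogonalGroup (Fin n) ℝ) :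
    R.1.transpose * R.1 = 1 :=
  (Matrix.mem_orthogonalGroup_iff' _ _).1 (Matrix.mem_specialOrthogonalGroup_iff.1 R.2).1

lemma mul_transpose_self_so {n : ℕ} (R : Matrix.specialOrthogonalGroup (Fin n) ℝ) :
    R.1 * R.1.transpose = 1 :=
  (Matrix.mem_orthogonalGroup_iff _ _).1 (Matrix.mem_specialOrthogonalGroup_iff.1 R.2).1

/-- Rotations preserve the cross product. In matrix terms the adjugate of R is its transpose, and
each entry is one of those nine identities. -/
lemma conj_hat (R : Matrix.specialOrthogonalGroup (Fin 3) ℝ) (w : Fin 3 → ℝ) :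
    R.1 * hat w * R.1.transpose = hat (R.1.mulVec w) := by
  have hdet : R.1.det = 1 := (Matrix.mem_specialOrthogonalGroup_iff.1 R.2).2
  have hadj : R.1.adjugate = R.1.transpose := by
    have h1 := Matrix.adjugate_mul R.1
    rw [hdet, one_smul] at h1
    calc R.1.adjugate = R.1.adjugate * (R.1 * R.1.transpose) := by
          rw [mul_transpose_self_so, mul_one]
      _ = R.1.transpose := by rw [← mul_assoc, h1, one_mul]
  have e : ∀ i j, R.1.adjugate i j = R.1 j i := fun i j => by rw [hadj]; rfl
  rw [Matrix.adjugate_fin_three] at e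
  have e00 := e 0 0
  have e01 := e 0 1
  have e02 := e 0 2
  have e10 := e 1 0
  have e11 := e 1 1
  have e12 := e 1 2
  have e20 := e 2 0
  have e21 := e 2 1
  have e22 := e 2 2
  simp at e00 e01 e02 e10 e11 e12 e20 e21 e22
  ext i j
  fin_cases i <;> fin_cases j <;>
    simp [hat, Matrix.mul_apply, Fin.sum_univ_three, Matrix.mulVec, dotProduct]
  · ring
  · linear_combination -(w 0) * e02 - (w 1) * e12 - (w 2) * e22
  · linear_combination (w 0) * e01 + (w 1) * e11 + (w 2) * e21
  · linear_combination (w 0) * e02 + (w 1) * e12 + (w 2) * e22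
  · ring
  · linear_combination -(w 0) * e00 - (w 1) * e10 - (w 2) * e20
  · linear_combination -(w 0) * e01 - (w 1) * e11 - (w 2) * e21
  · linear_combination (w 0) * e00 + (w 1) * e10 + (w 2) * e20
  · ring

/-- A matrix invariant under conjugation by `SO(3)` is scalar. -/
lemma eq_smul_one_of_conj {C : Matrix (Fin 3) (Fin 3) ℝ}
    (h : ∀ q : Sp1, C * (sp1Cover q).1 = (sp1Cover q).1 * C) : C = C 0 0 • 1 := by
  have hI : (sp1Cover qI).1 = !![1, 0, 0; 0, -1, 0; 0, 0, -1] := by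
    change sp1Matrix qI.1 = _
    rw [sp1Matrix_eq]
    simp [qI_coords]
  have hJ : (sp1Cover qJ).1 = !![-1, 0, 0; 0, 1, 0; 0, 0, -1] := by
    change sp1Matrix qJ.1 = _
    rw [sp1Matrix_eq]
    simp [qJ_coords]
  -- The half turns about two axes force the off-diagonal entries to vanish; the unit quaternion (1
  -- + i + j + k)/2 permutes the axes cyclically and makes the diagonal entries equal.
  have hW : ∃ q : Sp1, (sp1Cover q).1 = !![0, 0, 1; 1, 0, 0; 0, 1, 0] := by
    refine ⟨⟨(1 / 2 : ℝ) • (1 + imQuat ![1, 1, 1]), mem_sp1_of_normSq (by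
      rw [Quaternion.normSq_def']; simp; norm_num)⟩, ?_⟩
    change sp1Matrix _ = _
    rw [sp1Matrix_eq]
    simp
    norm_num
  obtain ⟨q, hq⟩ := hW
  have h1 := h qI
  have h2 := h qJ
  have h3 := h q
  rw [hI] at h1
  rw [hJ] at h2
  rw [hq] at h3
  have a1 : ∀ i j, _ := fun i j => congrFun (congrFun h1 i) j
  have a2 : ∀ i j, _ := fun i j => congrFun (congrFun h2 i) j
  have a3 : ∀ i j, _ := fun i j => congrFun (congrFun h3 i) j
  have b1 := a1 0 1
  have b2 := a1 0 2
  have b3 := a1 1 0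
  have b4 := a1 2 0
  have b5 := a2 1 2
  have b6 := a2 2 1
  have b7 := a3 1 0
  have b8 := a3 2 1
  simp [Matrix.mul_apply, Fin.sum_univ_three] at b1 b2 b3 b4 b5 b6 b7 b8
  ext i j
  fin_cases i <;> fin_cases j <;> simp <;> linarith

/-- Such a rotation is a scalar c with c³ = det R = 1, and 1 is the only real cube root of 1. -/
lemma eq_one_of_commute_sp1Cover {R : Matrix.specialOrthogonalGroup (Fin 3) ℝ}
    (h : ∀ q : Sp1, R * sp1Cover q = sp1Cover q * R) : R = 1 := by
  have h1 := eq_smul_one_of_conj (C := R.1) fun q => congrArg Subtype.val (h q)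
  have hdet : R.1.det = 1 := (Matrix.mem_specialOrthogonalGroup_iff.1 R.2).2
  rw [h1, Matrix.det_smul, Matrix.det_one, mul_one, Fintype.card_fin] at hdet
  have h2 : R.1 0 0 = 1 := 
    ((pow_eq_one_iff_of_ne_zero (by norm_num : (3 : ℕ) ≠ 0)).1 hdet).resolve_right
      fun h => absurd h.2 (by decide)
  apply Subtype.ext
  rw [h1, h2, one_smul]
  rfl

lemma sp1Cover_mulVec (q : Sp1) (v : Fin 3 → ℝ) :
    imQuat ((sp1Cover q).1.mulVec v) = q.1 * imQuat v * star q.1 := by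
  rw [← imQuat_imPart (conj_re_zero q.1 v), ← spinConj_sp1ToSpin, ← spinCover_sp1ToSpin]
  change imQuat ((LinearMap.toMatrix' (spinConj (sp1ToSpin q))).mulVec v) = _
  rw [LinearMap.toMatrix'_mulVec]

lemma one_add_imQuat_ne_zero (v : Fin 3 → ℝ) : 1 + imQuat v ≠ 0 := by
  intro h
  have h1 : (1 + imQuat v).re = (0 : ℍ[ℝ]).re := by rw [h]
  simp at h1

/-- A chart of `Sp(1)` around the identity. -/
def sp1Chart (v : EuclideanSpace ℝ (Fin 3)) : Sp1 :=
  qnormalize (1 + imQuat v.ofLp) (one_add_imQuat_ne_zero _)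

lemma isPlot_sp1Chart : IsPlot sp1Chart := by
  refine isPlot_subtype_iff.2 (isPlot_iff_contDiff_of_linear.2 ?_)
  let L : EuclideanSpace ℝ (Fin 3) →ₗ[ℝ] ℍ[ℝ] :=
    imQuat ∘ₗ (WithLp.linearEquiv 2 ℝ (Fin 3 → ℝ)).toLinearMap
  have h1 : ContDiff ℝ ∞ fun v : EuclideanSpace ℝ (Fin 3) => 1 + imQuat v.ofLp :=
    contDiff_const.add (LinearMap.toContinuousLinearMap L).contDiff
  exact ((h1.norm ℝ fun v => one_add_imQuat_ne_zero _).inv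
    fun v => norm_ne_zero_iff.2 (one_add_imQuat_ne_zero _)).smul h1

lemma sp1Chart_zero : sp1Chart 0 = 1 := Subtype.ext <| by
  change ‖1 + imQuat 0‖⁻¹ • (1 + imQuat 0) = (1 : ℍ[ℝ])
  simp

/-- The chart v ↦ (1 + v)/‖1 + v‖ commutes with conjugation, so the derivative at 1 is equivariant
without recourse to the exponential map. -/
lemma conj_sp1Chart (q : Sp1) (v : EuclideanSpace ℝ (Fin 3)) :
    q * sp1Chart v * q⁻¹ = sp1Chart (WithLp.toLp 2 ((sp1Cover q).1.mulVec v.ofLp)) := by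
  apply Subtype.ext
  have h : 1 + imQuat ((sp1Cover q).1.mulVec v.ofLp) = q.1 * (1 + imQuat v.ofLp) * star q.1 := by
    rw [sp1Cover_mulVec, mul_add, add_mul, mul_one, sp1_mul_star]
  change q.1 * (‖1 + imQuat v.ofLp‖⁻¹ • (1 + imQuat v.ofLp)) * star q.1 =
    ‖1 + imQuat ((sp1Cover q).1.mulVec v.ofLp)‖⁻¹ • (1 + imQuat ((sp1Cover q).1.mulVec v.ofLp))
  rw [h, norm_mul, norm_mul, norm_star, norm_sp1, one_mul, mul_one, mul_smul_comm, smul_mul_assoc]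

variable {φ : Sp1 →* Matrix.specialOrthogonalGroup (Fin 3) ℝ}

/-- The derivative at `1` of a homomorphism `Sp(1) → SO(3)`. -/
def sp1Deriv (φ : Sp1 →* Matrix.specialOrthogonalGroup (Fin 3) ℝ) (i j : Fin 3) :
    EuclideanSpace ℝ (Fin 3) →L[ℝ] ℝ :=
  fderiv ℝ (fun v => (φ (sp1Chart v)).1 i j) 0

lemma hasDerivAt_sp1Chart
    (hφ : ∀ (n : ℕ) (p : EuclideanSpace ℝ (Fin n) → Sp1), IsPlot p →
      ∀ i j, ContDiff ℝ ∞ fun t => (φ (p t)).1 i j) (v : EuclideanSpace ℝ (Fin 3)) (i j : Fin 3)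
    {a : ℝ → ℝ} {a' : ℝ} (ha : HasDerivAt a a' 0) (ha0 : a 0 = 0) :
    HasDerivAt (fun t => (φ (sp1Chart (a t • v))).1 i j) (sp1Deriv φ i j (a' • v)) 0 := by
  have h1 : HasFDerivAt (fun v => (φ (sp1Chart v)).1 i j) (sp1Deriv φ i j) (a 0 • v) := by
    rw [ha0, zero_smul]
    exact ((hφ 3 sp1Chart isPlot_sp1Chart i j).differentiable (by simp) 0).hasFDerivAt
  exact h1.comp_hasDerivAt 0 (ha.smul_const v)

/-- Differentiate φφᵀ = 1 at the identity. -/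
lemma sp1Deriv_skew
    (hφ : ∀ (n : ℕ) (p : EuclideanSpace ℝ (Fin n) → Sp1), IsPlot p →
      ∀ i j, ContDiff ℝ ∞ fun t => (φ (p t)).1 i j) (v : EuclideanSpace ℝ (Fin 3)) (i j : Fin 3) :
    sp1Deriv φ i j v + sp1Deriv φ j i v = 0 := by
  have hd : ∀ i j, HasDerivAt (fun t : ℝ => (φ (sp1Chart (t • v))).1 i j) (sp1Deriv φ i j v) 0 := by
    intro i j
    have := hasDerivAt_sp1Chart hφ v i j (hasDerivAt_id 0) rfl
    rwa [one_smul] at this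
  have h0 : ∀ i j, (φ (sp1Chart ((0 : ℝ) • v))).1 i j = if i = j then 1 else 0 := fun i j => by
    rw [zero_smul, sp1Chart_zero, map_one]
    exact Matrix.one_apply
  have h1 := HasDerivAt.fun_sum (u := Finset.univ) fun l _ => (hd i l).mul (hd j l)
  have h2 : HasDerivAt (fun t : ℝ => (1 : Matrix (Fin 3) (Fin 3) ℝ) i j) 0 0 := hasDerivAt_const _ _
  have h3 := h1.unique (h2.congr_of_eventuallyEq (Filter.Eventually.of_forall fun t => by
    have := congrFun (congrFun (mul_transpose_self_so (φ (sp1Chart (t • v)))) i) j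
    rw [Matrix.mul_apply] at this
    exact this))
  simp only [h0] at h3
  simpa [Finset.sum_add_distrib, add_comm] using h3

lemma sp1Deriv_equivariant
    (hφ : ∀ (n : ℕ) (p : EuclideanSpace ℝ (Fin n) → Sp1), IsPlot p →
      ∀ i j, ContDiff ℝ ∞ fun t => (φ (p t)).1 i j) (q : Sp1) (v : EuclideanSpace ℝ (Fin 3)) :
    (Matrix.of fun i j => sp1Deriv φ i j (WithLp.toLp 2 ((sp1Cover q).1.mulVec v.ofLp))) =
      (φ q).1 * (Matrix.of fun i j => sp1Deriv φ i j v) * (φ q).1.transpose := by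
  have hd : ∀ v i j,
      HasDerivAt (fun t : ℝ => (φ (sp1Chart (t • v))).1 i j) (sp1Deriv φ i j v) 0 := by
    intro v i j
    have := hasDerivAt_sp1Chart hφ v i j (hasDerivAt_id 0) rfl
    rwa [one_smul] at this
  ext i j
  simp only [Matrix.mul_apply, Matrix.of_apply, Matrix.transpose_apply]
  have h1 := HasDerivAt.fun_sum (u := Finset.univ) fun l _ => (HasDerivAt.fun_sum
    (u := Finset.univ) fun n _ => (hd v n l).const_mul ((φ q).1 i n)).mul_const ((φ q).1 j l)
  refine (hd _ i j).unique (h1.congr_of_eventuallyEq (Filter.Eventually.of_forall fun t => ?_))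
  have h2 : (t • (WithLp.toLp 2 ((sp1Cover q).1.mulVec v.ofLp)) : EuclideanSpace ℝ (Fin 3)) =
      WithLp.toLp 2 ((sp1Cover q).1.mulVec (t • v).ofLp) := by
    rw [WithLp.ofLp_smul, Matrix.mulVec_smul, WithLp.toLp_smul]
  have h3 : (φ (q⁻¹)).1 = (φ q).1.transpose := by
    rw [map_inv]
    rfl
  change (φ (sp1Chart (t • _))).1 i j = _
  rw [h2, ← conj_sp1Chart, map_mul, map_mul, Submonoid.coe_mul, Submonoid.coe_mul, h3,
    Matrix.mul_apply]
  simp only [Matrix.mul_apply, Matrix.transpose_apply]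

/-- The point of the one-parameter subgroup of a unit imaginary quaternion. -/
def sp1Circle {v : Fin 3 → ℝ} (hv : v ⬝ᵥ v = 1) (θ : ℝ) : Sp1 :=
  ⟨Real.cos θ • (1 : ℍ[ℝ]) + Real.sin θ • imQuat v, mem_sp1_of_normSq (by
    have h : Quaternion.normSq (Real.cos θ • (1 : ℍ[ℝ]) + Real.sin θ • imQuat v) =
        Real.cos θ ^ 2 + Real.sin θ ^ 2 * (v ⬝ᵥ v) := by
      rw [Quaternion.normSq_def']; simp [dotProduct, Fin.sum_univ_three]; ring
    rw [h, hv, mul_one, Real.cos_sq_add_sin_sq])⟩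

lemma sp1Circle_add {v : Fin 3 → ℝ} (hv : v ⬝ᵥ v = 1) (s t : ℝ) :
    sp1Circle hv (s + t) = sp1Circle hv s * sp1Circle hv t := by
  apply Subtype.ext
  have h : imQuat v * imQuat v = -1 := by rw [imQuat_mul_self, hv]; simp
  change Real.cos (s + t) • (1 : ℍ[ℝ]) + Real.sin (s + t) • imQuat v =
    (Real.cos s • (1 : ℍ[ℝ]) + Real.sin s • imQuat v) *
      (Real.cos t • (1 : ℍ[ℝ]) + Real.sin t • imQuat v)
  simp only [add_mul, mul_add, smul_mul_smul_comm, one_mul, mul_one, h, Real.cos_add, Real.sin_add]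
  module

lemma sp1Circle_eq_sp1Chart {v : Fin 3 → ℝ} (hv : v ⬝ᵥ v = 1) {θ : ℝ} (hθ : 0 < Real.cos θ) :
    sp1Circle hv θ = sp1Chart (Real.tan θ • WithLp.toLp 2 v) := by
  apply Subtype.ext
  have h1 : (sp1Circle hv θ).1 = Real.cos θ • (1 + imQuat (Real.tan θ • v)) := by
    change Real.cos θ • (1 : ℍ[ℝ]) + Real.sin θ • imQuat v = _
    rw [map_smul, smul_add, smul_smul, Real.tan_eq_sin_div_cos, mul_div_cancel₀ _ hθ.ne']
  have h2 : ‖1 + imQuat (Real.tan θ • v)‖⁻¹ = Real.cos θ := by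
    have h3 := norm_sp1 (sp1Circle hv θ)
    rw [h1, norm_smul, Real.norm_of_nonneg hθ.le] at h3
    exact inv_eq_of_mul_eq_one_left h3
  change _ = ‖1 + imQuat (Real.tan θ • v)‖⁻¹ • (1 + imQuat (Real.tan θ • v))
  rw [h1, h2]

/-- Along a circle cos θ + v sin θ the derivative vanishes at 0, hence everywhere by the
homomorphism property. Every unit quaternion is a product of two imaginary ones, which are points θ
= π/2 of such circles. -/
lemma eq_one_of_sp1Deriv_eq_zero
    (hφ : ∀ (n : ℕ) (p : EuclideanSpace ℝ (Fin n) → Sp1), IsPlot p →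
      ∀ i j, ContDiff ℝ ∞ fun t => (φ (p t)).1 i j) (h0 : ∀ i j, sp1Deriv φ i j = 0) (q : Sp1) :
    φ q = 1 := by
  have key : ∀ {v : Fin 3 → ℝ} (hv : v ⬝ᵥ v = 1) (θ : ℝ), φ (sp1Circle hv θ) = 1 := by
    intro v hv θ
    have h1 : ∀ i j, HasDerivAt (fun t : ℝ => (φ (sp1Circle hv t)).1 i j) 0 0 := by
      intro i j
      -- In the chart the circle is the line spanned by v, run through with parameter tan θ.
      have ht : HasDerivAt Real.tan (1 / Real.cos 0 ^ 2) 0 := Real.hasDerivAt_tan (by simp)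
      have := hasDerivAt_sp1Chart hφ (WithLp.toLp 2 v) i j ht (by simp)
      rw [h0] at this
      refine this.congr_of_eventuallyEq ?_
      have hc : ∀ᶠ t in nhds (0 : ℝ), 0 < Real.cos t :=
        Real.continuous_cos.continuousAt.eventually_const_lt (by simp)
      filter_upwards [hc] with t ht
      rw [sp1Circle_eq_sp1Chart hv ht]
    have h2 : ∀ i j (s : ℝ), HasDerivAt (fun t : ℝ => (φ (sp1Circle hv t)).1 i j) 0 s := by
      intro i j s
      have h3 := HasDerivAt.fun_sum (u := Finset.univ) fun l _ =>
        (HasDerivAt.comp_sub_const s s (by rw [sub_self]; exact h1 l j)).const_mul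
          ((φ (sp1Circle hv s)).1 i l)
      simp only [mul_zero, Finset.sum_const_zero] at h3
      refine h3.congr_of_eventuallyEq (Filter.Eventually.of_forall fun t => ?_)
      change (φ (sp1Circle hv t)).1 i j = _
      rw [show t = s + (t - s) by ring, sp1Circle_add, map_mul, Submonoid.coe_mul,
        Matrix.mul_apply]
      simp
    have h3 : φ (sp1Circle hv θ) = φ (sp1Circle hv 0) := by
      apply Subtype.ext
      ext i j
      exact is_const_of_deriv_eq_zero (fun s => (h2 i j s).differentiableAt)
        (fun s => (h2 i j s).deriv) θ 0
    rw [h3, show sp1Circle hv 0 = 1 from Subtype.ext (by simp [sp1Circle]), map_one]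
  obtain ⟨v, w, hv, hw, hq⟩ := exists_eq_imQuat_mul q
  have h1 : q = sp1Circle hv (Real.pi / 2) * sp1Circle hw (Real.pi / 2) := Subtype.ext <| by
    rw [hq]
    simp [sp1Circle]
  rw [h1, map_mul, key, key, one_mul]

/-- A smooth homomorphism `Sp(1) → SO(3)` is trivial or conjugate to the double covering. -/
theorem eq_one_or_conj_sp1Cover
    (hφ : ∀ (n : ℕ) (p : EuclideanSpace ℝ (Fin n) → Sp1), IsPlot p →
      ∀ i j, ContDiff ℝ ∞ fun t => (φ (p t)).1 i j) :
    (∀ q, φ q = 1) ∨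
      ∃ R : Matrix.specialOrthogonalGroup (Fin 3) ℝ, ∀ q, φ q = R * sp1Cover q * R⁻¹ := by
  let e : Fin 3 → EuclideanSpace ℝ (Fin 3) := fun l => EuclideanSpace.single l 1
  let c : EuclideanSpace ℝ (Fin 3) → Fin 3 → ℝ := fun v =>
    ![sp1Deriv φ 2 1 v, sp1Deriv φ 0 2 v, sp1Deriv φ 1 0 v]
  -- `B` is the derivative of φ after so(3) is identified with ℝ³ by `hat`; it intertwines the
  -- double covering with φ.
  let B : Matrix (Fin 3) (Fin 3) ℝ := Matrix.of fun i l => c (e l) i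
  have hX : ∀ v, (Matrix.of fun i j => sp1Deriv φ i j v) = hat (c v) := by
    intro v
    have hs := sp1Deriv_skew hφ v
    ext i j
    fin_cases i <;> fin_cases j <;> simp [hat, c]
    · linarith [hs 0 0]
    · linarith [hs 0 1]
    · linarith [hs 1 1]
    · linarith [hs 1 2]
    · linarith [hs 2 0]
    · linarith [hs 2 2]
  have hB : ∀ v : EuclideanSpace ℝ (Fin 3), c v = B.mulVec v.ofLp := by
    intro v
    have hv : v = ∑ l, v l • e l := by
      ext i
      simp [e, Fin.sum_univ_three]
      fin_cases i <;> simp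
    have hD : ∀ i j, sp1Deriv φ i j v = ∑ l, sp1Deriv φ i j (e l) * v l := by
      intro i j
      conv_lhs => rw [hv]
      simp [mul_comm]
    ext i
    simp only [Matrix.mulVec, dotProduct, B, Matrix.of_apply]
    fin_cases i <;> exact hD _ _
  have hcomm : ∀ q, B * (sp1Cover q).1 = (φ q).1 * B := by
    intro q
    have h1 : ∀ v : Fin 3 → ℝ,
        (B * (sp1Cover q).1).mulVec v = ((φ q).1 * B).mulVec v := by
      intro v
      apply hat_injective
      have := sp1Deriv_equivariant hφ q (WithLp.toLp 2 v)
      rw [hX, hX, conj_hat, hB, hB] at this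
      rw [← Matrix.mulVec_mulVec, ← Matrix.mulVec_mulVec]
      exact this
    exact Matrix.toLin'.injective (LinearMap.ext h1)
  -- BᵀB commutes with the double covering, hence is a scalar s ≥ 0. So B vanishes and φ is trivial,
  -- or B/√s is an orthogonal intertwiner.
  have hC : B.transpose * B = (B.transpose * B) 0 0 • 1 := by
    refine eq_smul_one_of_conj fun q => ?_
    have h1 := congrArg Matrix.transpose (hcomm q)
    rw [Matrix.transpose_mul, Matrix.transpose_mul] at h1
    calc B.transpose * B * (sp1Cover q).1
        = (sp1Cover q).1 * ((sp1Cover q).1.transpose * B.transpose) * (B * (sp1Cover q).1) := by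
          rw [← mul_assoc _ _ B.transpose, mul_transpose_self_so, one_mul, mul_assoc]
      _ = (sp1Cover q).1 * (B.transpose * ((φ q).1.transpose * (φ q).1) * B) := by
          rw [h1, hcomm]; simp only [mul_assoc]
      _ = _ := by rw [transpose_mul_self_so, mul_one]
  set s := (B.transpose * B) 0 0 with hs
  have hdiag : ∀ i, ∑ j, B j i * B j i = s := by
    intro i
    have := congrFun (congrFun hC i) i
    simpa [Matrix.mul_apply] using this
  have hs0 : 0 ≤ s := by
    rw [← hdiag 0]
    exact Finset.sum_nonneg fun j _ => mul_self_nonneg _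
  rcases hs0.eq_or_lt with h0 | hpos
  · left
    have hB0 : B = 0 := by
      ext j i
      have := (Finset.sum_eq_zero_iff_of_nonneg fun j _ => mul_self_nonneg (B j i)).1
        ((hdiag i).trans h0.symm) j (Finset.mem_univ _)
      exact mul_self_eq_zero.1 this
    refine eq_one_of_sp1Deriv_eq_zero hφ fun i j => ?_
    ext1 v
    have := congrFun (congrFun (hX v) i) j
    rw [hB, hB0, Matrix.zero_mulVec] at this
    rw [show sp1Deriv φ i j v = _ from this]
    fin_cases i <;> fin_cases j <;> simp [hat]
  · right
    have hR : ((√s)⁻¹ • B).transpose * ((√s)⁻¹ • B) = 1 := by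
      rw [Matrix.transpose_smul, smul_mul_smul_comm, hC, smul_smul, ← mul_inv,
        Real.mul_self_sqrt hs0, inv_mul_cancel₀ hpos.ne', one_smul]
    have key : ∀ R : Matrix (Fin 3) (Fin 3) ℝ, R.transpose * R = 1 → R.det = 1 →
        (∀ q, R * (sp1Cover q).1 = (φ q).1 * R) →
        ∃ R : Matrix.specialOrthogonalGroup (Fin 3) ℝ, ∀ q, φ q = R * sp1Cover q * R⁻¹ := by
      intro R h1 h2 h3
      refine ⟨⟨R, Matrix.mem_specialOrthogonalGroup_iff.2
        ⟨(Matrix.mem_orthogonalGroup_iff' _ _).2 h1, h2⟩⟩, fun q => ?_⟩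
      rw [eq_mul_inv_iff_mul_eq]
      exact Subtype.ext (h3 q).symm
    have hRc : ∀ q, (√s)⁻¹ • B * (sp1Cover q).1 = (φ q).1 * (√s)⁻¹ • B := fun q => by
      rw [smul_mul_assoc, hcomm, mul_smul_comm]
    have hdet : ((√s)⁻¹ • B).det * ((√s)⁻¹ • B).det = 1 := by
      have := congrArg Matrix.det hR
      rwa [Matrix.det_mul, Matrix.det_transpose, Matrix.det_one] at this
    rcases mul_self_eq_one_iff.1 hdet with h | h
    · exact key _ hR h hRc
    -- In odd dimension a change of sign turns determinant -1 into 1 and keeps the intertwining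
    -- property.
    · refine key (-((√s)⁻¹ • B)) ?_ ?_ fun q => ?_
      · rw [Matrix.transpose_neg, neg_mul_neg, hR]
      · rw [Matrix.det_neg, h]; norm_num
      · rw [neg_mul, hRc, mul_neg]

end Dichotomy

/-! ### The lifted isotropy representation -/

section Nu

variable {k m r : ℕ}

lemma spin_ne_neg {N : ℕ} (x : Spin N) : (x : Cl N) ≠ -x := by
  intro h
  have h1 : (2 : ℝ) • (x : Cl N) = 0 := by
    rw [two_smul]
    nth_rewrite 2 [h]
    exact add_neg_cancel _
  rw [smul_eq_zero_iff_right two_ne_zero] at h1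
  have := spin_star_mul x
  rw [h1, mul_zero] at this
  exact zero_ne_one this

lemma spinRMk_right_injective {N : ℕ} {x : Spin N} {y z : Spin r}
    (h : spinRMk r N (x, y) = spinRMk r N (x, z)) : y = z := by
  rcases spinRMk_eq_iff.1 h with ⟨_, h⟩ | ⟨h, _⟩
  · exact Subtype.ext h
  · exact absurd h (spin_ne_neg x)

/-- The second component of a smooth family in `Spinʳ` with smooth first component is smooth. -/
lemma isPlot_of_isPlot_spinRMk {N n : ℕ} {x : EuclideanSpace ℝ (Fin n) → Spin N}
    {y : EuclideanSpace ℝ (Fin n) → Spin r} (hx : IsPlot x)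
    (h : IsPlot fun t => spinRMk r N (x t, y t)) : IsPlot y := by
  refine (subduction_spinRMk r N).isPlot_of_lifts h fun d g q hg hq hqp => ?_
  obtain ⟨hq1, hq2⟩ := isPlot_prod_iff.1 hq
  -- A smooth local lift is ±(x, y) with a common sign. The functional `f`, equal to 1 on the unit,
  -- reads this sign off x* times the first component.
  obtain ⟨f, hf⟩ := LinearMap.exists_leftInverse_of_injective (Algebra.linearMap ℝ (Cl N))
    (LinearMap.ker_eq_bot.2 (algebraMap_inj N))
  have hf1 : f 1 = 1 := by
    have := LinearMap.congr_fun hf 1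
    simpa using this
  refine isPlot_spin_iff.2 fun t => ?_
  have hx' := isPlot_spin_iff.1 (hx.comp_contDiff hg) t
  refine (LinSmoothAt.smul ((hx'.star_cl.mul (isPlot_spin_iff.1 hq1 t)) f)
    (isPlot_spin_iff.1 hq2 t)).congr (Filter.Eventually.of_forall fun s => ?_)
  change (y (g s) : Cl r) = f (star (x (g s) : Cl N) * ((q s).1 : Cl N)) • ((q s).2 : Cl r)
  rcases spinRMk_eq_iff.1 (hqp s) with ⟨h1, h2⟩ | ⟨h1, h2⟩
  · rw [h1, h2]
    simp [hf1]
  · rw [h1, h2]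
    simp [hf1]

variable (i₀ : Fin k)

/-- A standard basis vector as a point of the unit sphere. -/
def qeSphere : Metric.sphere (0 : QuatSpace k) 1 := ⟨qe i₀, mem_sphere_zero_iff_norm.2 (norm_qe i₀)⟩

/-- The stabilizer of a standard basis vector in `Sp(k) × Sp(1)`. -/
def qeStab : Subgroup (Sp k × Sp1) :=
  (isotropy (spSpRep k) (qeSphere i₀)).comap (QuotientGroup.mk' (spSpCenter k))

variable {i₀}

lemma mem_qeStab {z : Sp k × Sp1} : z ∈ qeStab i₀ ↔ spSpIsometry z (qe i₀) = qe i₀ := Iff.rfl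

/-- The class in the isotropy group of an element of the stabilizer. -/
def qeStabMk : qeStab i₀ →* isotropy (spSpRep k) (qeSphere i₀) where
  toFun z := ⟨(z.1 : SpSp k), z.2⟩
  map_one' := rfl
  map_mul' _ _ := rfl

lemma isPlot_qeStabMk {n : ℕ} {z : EuclideanSpace ℝ (Fin n) → qeStab i₀}
    (hz : IsPlot fun t => (z t).1) : IsPlot fun t => (qeStabMk (z t) : SpSp k) :=
  dSmooth_quotientMk _ n _ hz

/-- An isotropy element fixes x and acts on the frame through λ(σ(h)), so in the basis formed by x
and the frame its matrix is 1 ⊕ λ(σ(h)). -/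
lemma frameVec_isotropyHom {o : Orientation ℝ (QuatSpace k) (Fin (m + 1))}
    {T : InvariantSpinRStructure o (spSpRep k) r} {x : Metric.sphere (0 : QuatSpace k) 1}
    {t : T.Total} {σ : isotropy (spSpRep k) x →* SpinR r m}
    (hσ : ∀ h : isotropy (spSpRep k) x, T.gact h t = T.act t (σ h))
    {b : OrthonormalBasis (Fin (m + 1)) ℝ (QuatSpace k)} (hb0 : b 0 = x)
    (hb : ∀ i : Fin m, b i.succ = (T.Φ t).vec i) (h : isotropy (spSpRep k) x) (i : Fin (m + 1)) :
    spSpRep k h (b i) = frameVec b (spinRCover r (m + 1) (spinRIncl r m (σ h))) i := by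
  refine Fin.cases ?_ (fun i => ?_) i
  · rw [frameVec, hb0, show spSpRep k h x = x from h.2]
    simp [spinRCover_spinRIncl_zero, hb0]
  · rw [frameVec, Fin.sum_univ_succ, (spinRCover_spinRIncl_succ _ _).1, zero_smul, zero_add, hb,
      ← T.vec_Φ_gact, hσ, T.Φ_act]
    simp only [(spinRCover_spinRIncl_succ _ _).2, hb]

/-- The isotropy homomorphism lifts to a homomorphism to `Spin(r)`. -/
lemma exists_lift_isotropyHom (hr : 0 < r) {o : Orientation ℝ (QuatSpace k) (Fin (m + 1))}
    {T : InvariantSpinRStructure o (spSpRep k) r}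
    {t : T.Total} {σ : isotropy (spSpRep k) (qeSphere i₀) →* SpinR r m}
    (hσ : ∀ h : isotropy (spSpRep k) (qeSphere i₀), T.gact h t = T.act t (σ h))
    {b : OrthonormalBasis (Fin (m + 1)) ℝ (QuatSpace k)} (hb0 : b 0 = qeSphere i₀)
    (hb : ∀ i : Fin m, b i.succ = (T.Φ t).vec i) :
    ∃ ν : qeStab i₀ →* Spin r, (∀ z, spinRIncl r m (σ (qeStabMk z)) =
      spinRMk r (m + 1) (spSpLift b z, ν z)) ∧
      ∀ (n : ℕ) (z : EuclideanSpace ℝ (Fin n) → qeStab i₀), IsPlot (fun t => (z t).1) →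
        IsPlot fun t => ν (z t) := by
  have : FiniteDimensional ℝ (QuatSpace k) := b.toBasis.finiteDimensional_of_finite
  -- The first component covers the same rotation as `spSpLift b z`, hence agrees with it up to
  -- sign. Changing both signs gives the representative whose first component is `spSpLift b z`, and
  -- it determines ν.
  have h1 : ∀ z : qeStab i₀, ∃ ν : Spin r, spinRIncl r m (σ (qeStabMk z)) =
      spinRMk r (m + 1) (spSpLift b z, ν) := by
    intro z
    obtain ⟨μ, ν, hμ⟩ := exists_spinRMk_eq (spinRIncl r m (σ (qeStabMk z)))
    have hc : Covers b μ ((spSpIsometry z.1).toLinearEquiv : QuatSpace k →ₗ[ℝ] QuatSpace k) := by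
      refine covers_matrix_iff.2 fun i => ?_
      have := frameVec_isotropyHom hσ hb0 hb (qeStabMk z) i
      rw [← hμ, spinRCover_mk] at this
      exact this
    rw [← hμ]
    rcases hc.eq_or_eq_neg (covers_spSpLift b z.1) with h | h
    · exact ⟨ν, spinRMk_eq_iff.2 (Or.inl ⟨h, rfl⟩)⟩
    · refine ⟨negOneSpin hr * ν, spinRMk_eq_iff.2 (Or.inr ⟨h, ?_⟩)⟩
      rw [Submonoid.coe_mul]
      change _ = -(-1 * (ν : Cl r))
      rw [neg_one_mul, neg_neg]
  choose ν hν using h1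
  refine ⟨⟨⟨ν, ?_⟩, ?_⟩, hν, fun n z hz => ?_⟩
  · apply spinRMk_right_injective (x := (1 : Spin (m + 1)))
    have := hν 1
    rw [map_one, map_one, map_one, Subgroup.coe_one, map_one] at this
    exact this.symm
  · intro z w
    apply spinRMk_right_injective (x := spSpLift b (z * w : qeStab i₀))
    change _ = spinRMk r (m + 1) (_, ν z * ν w)
    rw [← hν, map_mul, map_mul, map_mul, hν, hν, Subgroup.coe_mul, map_mul, ← map_mul]
    rfl
  · refine isPlot_of_isPlot_spinRMk (dSmooth_spSpLift b n _ hz) ?_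
    simp only [Function.comp_apply, MonoidHom.coe_mk, OneHom.coe_mk, ← hν]
    exact dSmooth_spinRIncl n _ (T.isPlot_isotropyHom hσ (isPlot_qeStabMk hz))

/-- The embedding `q ↦ (diag(q, …, q), q)` of `Sp(1)` in the stabilizer. -/
def diagStab (i₀ : Fin k) : Sp1 →* qeStab i₀ :=
  ((diagSp (k := k)).prod (MonoidHom.id _)).codRestrict _ fun q => mem_qeStab.2 <| by
    change spSpIsometry (diagSp q, q) _ = _
    rw [spSpIsometry_eq]
    ext1 i
    rw [rmul_apply, spAct_diagSp, qe_apply]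
    split_ifs
    · rw [mul_one, sp1_mul_star]
    · rw [mul_zero, zero_mul]

/-- The class of (-1, -1) is trivial, so [-1, ν] = [1, 1], where -1 is `spSpLift` of (-1, -1) for
odd `k`. This forces ν = -1 and is the obstruction behind the whole theorem. -/
lemma lift_isotropyHom_diagStab_neg_one (hk : Odd k)
    {σ : isotropy (spSpRep k) (qeSphere i₀) →* SpinR r m}
    {b : OrthonormalBasis (Fin (m + 1)) ℝ (QuatSpace k)} {ν : qeStab i₀ →* Spin r}
    (hν : ∀ z, spinRIncl r m (σ (qeStabMk z)) = spinRMk r (m + 1) (spSpLift b z, ν z)) :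
    (ν (diagStab i₀ (-1)) : Cl r) = -1 := by
  have h1 : ((diagStab i₀ (-1)).1 : Sp k × Sp1) = (-1, -1) := Prod.ext diagSp_neg_one rfl
  have h2 : qeStabMk (diagStab i₀ (-1)) = 1 := by
    apply Subtype.ext
    change (((diagStab i₀ (-1)).1 : Sp k × Sp1) : SpSp k) = 1
    rw [h1, QuotientGroup.eq_one_iff]
    exact Or.inr rfl
  have h3 := hν (diagStab i₀ (-1))
  rw [h2, h1, map_one, map_one, ← map_one (spinRMk r (m + 1)), spinRMk_eq_iff] at h3
  simp only [spSpLift_neg_one, hk.neg_one_pow] at h3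
  rcases h3 with ⟨h, _⟩ | ⟨_, h⟩
  · exact absurd h (spin_ne_neg 1)
  · rw [eq_neg_iff_add_eq_zero, add_comm, ← eq_neg_iff_add_eq_zero]
    exact h

lemma exists_basis_of_frame {o : Orientation ℝ (QuatSpace k) (Fin (m + 1))} (hk : m + 1 = 4 * k)
    (x : Metric.sphere (0 : QuatSpace k) 1) (hm : 0 < m) :
    ∃ (F : SphereFrame o) (b : OrthonormalBasis (Fin (m + 1)) ℝ (QuatSpace k)),
      F.base = x ∧ b 0 = x ∧ ∀ i : Fin m, b i.succ = F.vec i := by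
  obtain ⟨c, hc⟩ := exists_oriented_basis hk o
  obtain ⟨y, hy⟩ := frameBase_surjective (r := 1) c hm x
  let F : SphereFrame o := frameOf c hc (spinRMk 1 (m + 1) (y, 1))
  obtain ⟨b, hb0, hb, -⟩ := F.positive
  exact ⟨F, b, hy, by rw [hb0]; exact congrArg Subtype.val hy, hb⟩

lemma sp1_commutator : qI * qJ * (qI⁻¹ * qJ⁻¹) = -1 := Subtype.ext <| by
  change qI.1 * qJ.1 * (star qI.1 * star qJ.1) = ((-1 : Sp1) : ℍ[ℝ])
  rw [coe_neg_one_sp1]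
  ext <;> simp [qI_coords, qJ_coords]

/-- There are no invariant spin and spin^c structures on `S⁸ⁿ⁺³`. -/
lemma isEmpty_of_le_two (hk : m + 1 = 4 * k) (hko : Odd k) (hr : 0 < r) (hr2 : r ≤ 2)
    (o : Orientation ℝ (QuatSpace k) (Fin (m + 1))) :
    IsEmpty (InvariantSpinRStructure o (spSpRep k) r) := by
  refine ⟨fun T => ?_⟩
  have hm : 0 < m := by have := hko.pos; omega
  let i₀ : Fin k := ⟨0, hko.pos⟩
  obtain ⟨F, b, hF, hb0, hb⟩ := exists_basis_of_frame (o := o) hk (qeSphere i₀) hm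
  obtain ⟨t, ht⟩ := T.exists_Φ_eq hm F
  obtain ⟨σ, hσ⟩ := T.exists_isotropyHom t (x := qeSphere i₀) (by rw [← T.base_Φ, ht, hF])
  obtain ⟨ν, hν, -⟩ := exists_lift_isotropyHom hr hσ hb0 (by rwa [ht])
  have h1 := lift_isotropyHom_diagStab_neg_one hko hν
  have hc : ∀ x y : Spin r, x * y = y * x := fun x y => Subtype.ext (spin_comm_of_le_two hr2 x y)
  rw [← sp1_commutator] at h1
  simp only [map_mul, map_inv] at h1
  -- In a commutative group the commutator is 1, whereas ν of the diagonal -1 is -1.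
  rw [hc (ν (diagStab i₀ qI))⁻¹, ← mul_inv_rev, mul_inv_cancel] at h1
  exact spin_ne_neg 1 h1


/-! ### Normal form of the isotropy homomorphism for r = 3 -/

section Normalize

variable {i₀ : Fin k}

lemma herm_eq_zero_symm {u v : QuatSpace k} (h : herm u v = 0) : herm v u = 0 := by
  rw [← star_herm, h, star_zero]

/-- The embedding of `Sp(1)` in the stabilizer by quaternionic reflections. -/
def ureflStab {u : QuatSpace k} (hu : ‖u‖ = 1) (h : herm u (qe i₀) = 0) : Sp1 →* qeStab i₀ :=
  ((urefl u hu).prod 1).codRestrict _ fun q => mem_qeStab.2 <| by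
    change spSpIsometry (urefl u hu q, 1) _ = _
    rw [spSpIsometry_eq, spAct_urefl_of_orthogonal hu q h]
    simp

lemma isPlot_ureflStab {u : QuatSpace k} (hu : ‖u‖ = 1) (h : herm u (qe i₀) = 0) {n : ℕ}
    {q : EuclideanSpace ℝ (Fin n) → Sp1} (hq : IsPlot q) :
    IsPlot fun t => (ureflStab hu h (q t)).1 := by
  refine isPlot_prod_iff.2 ⟨isPlot_subtype_iff.2 (isPlot_iff_linSmoothAt.2 fun t => ?_),
    isPlot_const⟩
  have hq' := isPlot_iff_linSmoothAt.1 (isPlot_subtype_iff.1 hq) t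
  refine linSmoothAt_matrix fun i j => ?_
  exact (linSmoothAt_const _ t).add (((linSmoothAt_const (u i) t).mul
    (hq'.sub (linSmoothAt_const 1 t))).mul (linSmoothAt_const (star (u j)) t))

lemma isPlot_diagStab {n : ℕ} {q : EuclideanSpace ℝ (Fin n) → Sp1} (hq : IsPlot q) :
    IsPlot fun t => (diagStab i₀ (q t)).1 :=
  isPlot_prod_iff.2 ⟨dSmooth_diagSp n q hq, hq⟩

lemma urefl_commute {u v : QuatSpace k} (hu : ‖u‖ = 1) (hv : ‖v‖ = 1) (h : herm u v = 0)
    (p q : Sp1) : urefl u hu p * urefl v hv q = urefl v hv q * urefl u hu p := by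
  refine sp_ext fun l => ?_
  rw [map_mul, map_mul]
  change spAct (urefl u hu p) (spAct (urefl v hv q) (qe l)) =
    spAct (urefl v hv q) (spAct (urefl u hu p) (qe l))
  rw [spAct_urefl hv q, map_add, spAct_rmul, spAct_urefl_of_orthogonal hu p h, spAct_urefl hu p,
    map_add, spAct_rmul, spAct_urefl_of_orthogonal hv q (herm_eq_zero_symm h), spAct_urefl hv q]
  abel

/-- The quaternionic reflection taking u to v conjugates one copy of Sp(1) to the other, and it
fixes `qe i₀` because both axes are orthogonal to it. -/
lemma ureflStab_conj {u v : QuatSpace k} (hu : ‖u‖ = 1) (hv : ‖v‖ = 1) (h : herm u (qe i₀) = 0)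
    (h' : herm v (qe i₀) = 0) :
    ∃ z : qeStab i₀, ∀ q, z * ureflStab hu h q * z⁻¹ = ureflStab hv h' q := by
  let A := householder u v hu hv
  have hA : ((A, 1) : Sp k × Sp1) ∈ qeStab i₀ := mem_qeStab.2 <| by
    rw [spSpIsometry_eq, spAct_householder_of_orthogonal hu hv h h']
    simp
  refine ⟨⟨_, hA⟩, fun q => Subtype.ext (Prod.ext ?_ ?_)⟩
  · change A * urefl u hu q * A⁻¹ = urefl v hv q
    have h1 : ∀ w (hw : ‖w‖ = 1), w = v → urefl w hw q = urefl v hv q := by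
      rintro _ _ rfl
      rfl
    have hAu : spAct A u = v := spAct_householder hu hv
    rw [conj_urefl A hu q (by rw [hAu, hv]), h1 _ _ hAu]
  · change (1 : Sp1) * 1 * 1⁻¹ = 1
    simp

lemma smooth_spinCover_comp {ν : qeStab i₀ →* Spin 3}
    (hν : ∀ (n : ℕ) (z : EuclideanSpace ℝ (Fin n) → qeStab i₀), IsPlot (fun t => (z t).1) →
      IsPlot fun t => ν (z t)) {f : Sp1 →* qeStab i₀}
    (hf : ∀ (n : ℕ) (q : EuclideanSpace ℝ (Fin n) → Sp1), IsPlot q →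
      IsPlot fun t => (f (q t)).1) (n : ℕ) (q : EuclideanSpace ℝ (Fin n) → Sp1) (hq : IsPlot q)
    (i j : Fin 3) : ContDiff ℝ ∞ fun t => (((spinCover 3).comp (ν.comp f)) (q t)).1 i j :=
  contDiff_spinCover (hν n _ (hf n q hq)) i j

/-- `Sp(k - 1)` acts trivially on the auxiliary bundle if `k` is odd. -/
lemma spinCover_ureflStab (hk : Odd k) {ν : qeStab i₀ →* Spin 3}
    (hν : ∀ (n : ℕ) (z : EuclideanSpace ℝ (Fin n) → qeStab i₀), IsPlot (fun t => (z t).1) →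
      IsPlot fun t => ν (z t)) {u : QuatSpace k} (hu : ‖u‖ = 1) (h : herm u (qe i₀) = 0) (q : Sp1) :
    spinCover 3 (ν (ureflStab hu h q)) = 1 := by
  -- For k = 1 there is no unit vector orthogonal to `qe i₀`. By parity the next case is k = 3,
  -- which leaves room for two orthogonal axes.
  have h3 : 3 ≤ k := by
    by_contra hlt
    have hk1 : k = 1 := by
      obtain ⟨a, ha⟩ := hk
      omega
    subst hk1
    have h1 := herm_eq_zero_symm h
    rw [herm_qe_left] at h1
    have h2 : u = 0 := by
      ext1 i
      rw [Subsingleton.elim i i₀, h1]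
      rfl
    rw [h2, norm_zero] at hu
    exact zero_ne_one hu
  obtain ⟨i₁, hi₁, i₂, hi₂, h12⟩ : ∃ i₁ ∈ ({i₀}ᶜ : Finset (Fin k)), ∃ i₂ ∈ ({i₀}ᶜ : Finset (Fin k)),
      i₁ ≠ i₂ := Finset.one_lt_card.1 (by
    rw [Finset.card_compl, Fintype.card_fin, Finset.card_singleton]; omega)
  have hqe : ∀ {i j : Fin k}, i ≠ j → herm (qe i) (qe j) = 0 := fun h => by
    rw [herm_qe_left, qe_apply, if_neg h]
  have h1 := hqe (by simpa using hi₁ : i₁ ≠ i₀)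
  have h2 := hqe (by simpa using hi₂ : i₂ ≠ i₀)
  have hconj : ∀ {u v : QuatSpace k} (hu : ‖u‖ = 1) (hv : ‖v‖ = 1) (h : herm u (qe i₀) = 0)
      (h' : herm v (qe i₀) = 0), (∀ q, spinCover 3 (ν (ureflStab hu h q)) = 1) →
      ∀ q, spinCover 3 (ν (ureflStab hv h' q)) = 1 := by
    intro u v hu hv h h' H q
    obtain ⟨z, hz⟩ := ureflStab_conj hu hv h h'
    rw [← hz, map_mul, map_mul, map_mul, map_mul, H, mul_one, map_inv, map_inv, mul_inv_cancel]
  refine hconj (norm_qe i₁) hu h1 h ?_ q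
  rcases eq_one_or_conj_sp1Cover (smooth_spinCover_comp hν
    (fun n q hq => isPlot_ureflStab (norm_qe i₁) h1 hq)) with H | ⟨R, hR⟩
  · exact H
  -- If the copy along `i₁` covers SO(3), the commuting copy along `i₂` is mapped to the trivial
  -- centre. The two copies are conjugate, so both are trivial.
  · refine hconj (norm_qe i₂) (norm_qe i₁) h2 h1 fun q => ?_
    set X := spinCover 3 (ν (ureflStab (norm_qe i₂) h2 q)) with hX
    have h4 : R⁻¹ * X * R = 1 := by
      refine eq_one_of_commute_sp1Cover fun p => ?_
      have h5 : spinCover 3 (ν (ureflStab (norm_qe i₁) h1 p)) * X =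
          X * spinCover 3 (ν (ureflStab (norm_qe i₁) h1 p)) := by
        rw [hX, ← map_mul, ← map_mul, ← map_mul, ← map_mul]
        congr 2
        exact Subtype.ext (Prod.ext (urefl_commute _ _ (hqe h12) _ _) rfl)
      have h6 : spinCover 3 (ν (ureflStab (norm_qe i₁) h1 p)) = R * sp1Cover p * R⁻¹ := hR p
      rw [h6] at h5
      calc R⁻¹ * X * R * sp1Cover p = R⁻¹ * (X * (R * sp1Cover p * R⁻¹)) * R := by group
        _ = R⁻¹ * (R * sp1Cover p * R⁻¹ * X) * R := by rw [h5]
        _ = _ := by group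
    calc X = R * (R⁻¹ * X * R) * R⁻¹ := by group
      _ = 1 := by rw [h4]; group

/-- The lifted isotropy homomorphism is conjugate to the projection to `Sp(1) = Spin(3)`. -/
lemma exists_eq_conj_sp1ToSpin (hk : Odd k) {ν : qeStab i₀ →* Spin 3}
    (hν : ∀ (n : ℕ) (z : EuclideanSpace ℝ (Fin n) → qeStab i₀), IsPlot (fun t => (z t).1) →
      IsPlot fun t => ν (z t)) (hν1 : (ν (diagStab i₀ (-1)) : Cl 3) = -1) :
    ∃ R : Spin 3, ∀ z, ν z = R * sp1ToSpin z.1.2 * R⁻¹ := by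
  -- Elements over the same rotation agree up to sign and have equal squares. Since all unit
  -- quaternions are squares, homomorphisms from Sp(1) to Spin(3) that agree in SO(3) are equal.
  have hone : ∀ x y : Spin 3, spinCover 3 x = spinCover 3 y → x * x = y * y := by
    intro x y h
    apply Subtype.ext
    rcases eq_or_eq_neg_of_spinCover_eq h with h | h <;> simp [h]
  rcases eq_one_or_conj_sp1Cover (smooth_spinCover_comp hν
    (fun n q hq => isPlot_diagStab (i₀ := i₀) hq)) with H | ⟨R₀, hR₀⟩
  · exfalso
    -- In the trivial case ν(i) = ±1, so ν(-1) = ν(i)² = 1, contrary to ν(-1) = -1.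
    have h1 : (-1 : Sp1) = qI * qI := Subtype.ext (by
      rw [coe_neg_one_sp1]; ext <;> simp [qI_coords])
    have h2 : spinCover 3 (ν (diagStab i₀ qI)) = spinCover 3 1 := by rw [map_one]; exact H qI
    rw [h1, map_mul, map_mul, hone _ _ h2, mul_one] at hν1
    exact spin_ne_neg 1 hν1
  · obtain ⟨R, hR⟩ := spinCover_surjective R₀
    refine ⟨R, fun z => ?_⟩
    let f : qeStab i₀ →* Spin 3 := (MulAut.conj R).toMonoidHom.comp
      (sp1ToSpin.comp ((MonoidHom.snd _ _).comp (qeStab i₀).subtype))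
    let E : Subgroup (qeStab i₀) := ν.eqLocus f
    suffices z ∈ E from this
    have hf : ∀ z, f z = R * sp1ToSpin z.1.2 * R⁻¹ := fun z => rfl
    have hD : ∀ q, diagStab i₀ q ∈ E := by
      intro q
      obtain ⟨p, rfl⟩ := exists_sq_eq q
      change ν _ = f _
      rw [map_mul, map_mul, map_mul]
      apply hone
      rw [hf, map_mul, map_mul, map_inv, hR, spinCover_sp1ToSpin]
      exact hR₀ p
    have hN : ∀ (A : Sp k) (hA : spAct A (qe i₀) = qe i₀),
        (⟨(A, 1), mem_qeStab.2 (by rw [spSpIsometry_eq, hA]; simp)⟩ : qeStab i₀) ∈ E := by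
      intro A hA
      have := mem_of_urefl_mem (C := (E.map (qeStab i₀).subtype).comap (MonoidHom.inl _ _)) {i₀}
        (fun u hu h q => ?_) (A := A) (by simpa using hA)
      · obtain ⟨w, hw, hw'⟩ := this
        have e : (⟨(A, 1), mem_qeStab.2 (by rw [spSpIsometry_eq, hA]; simp)⟩ : qeStab i₀) = w :=
          Subtype.ext hw'.symm
        rw [e]
        exact hw
      · obtain ⟨p, rfl⟩ := exists_sq_eq q
        have h' := herm_eq_zero_symm (h i₀ (Finset.mem_singleton_self _))
        refine ⟨ureflStab hu h' (p * p), ?_, rfl⟩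
        change ν _ = f _
        rw [map_mul, map_mul, map_mul]
        apply hone
        have h1 : f (ureflStab hu h' p) = 1 := by
          rw [hf]
          change R * sp1ToSpin 1 * R⁻¹ = 1
          rw [map_one, mul_one, mul_inv_cancel]
        rw [h1, map_one]
        exact spinCover_ureflStab hk hν hu h' p
    -- Every element of the stabilizer is (A, 1) times a diagonal element, with A fixing `qe i₀`.
    have hz : spAct (z * (diagStab i₀ z.1.2)⁻¹).1.1 (qe i₀) = qe i₀ := by
      have h1 := (z * (diagStab i₀ z.1.2)⁻¹).2
      have h2 : (z * (diagStab i₀ z.1.2)⁻¹).1.2 = 1 := mul_inv_cancel _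
      rw [mem_qeStab, ← Prod.mk.eta (p := (z * (diagStab i₀ z.1.2)⁻¹).1), h2, spSpIsometry_eq] at h1
      simpa using h1
    have h3 := mul_mem (hN _ hz) (hD z.1.2)
    convert h3
    rw [← mul_inv_eq_iff_eq_mul]
    exact Subtype.ext (Prod.ext rfl (mul_inv_cancel _))

/-- At a suitable point over `qe i₀` the isotropy homomorphism is the standard one. -/
lemma exists_normalized (hm : 0 < m) (hk : Odd k)
    {o : Orientation ℝ (QuatSpace k) (Fin (m + 1))}
    (T : InvariantSpinRStructure o (spSpRep k) 3) {F : SphereFrame o}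
    {b : OrthonormalBasis (Fin (m + 1)) ℝ (QuatSpace k)} (hF : F.base = qeSphere i₀)
    (hb0 : b 0 = qeSphere i₀) (hb : ∀ i : Fin m, b i.succ = F.vec i) :
    ∃ t : T.Total, T.Φ t = F ∧ ∀ z : qeStab i₀, ∃ l : SpinR 3 m,
      T.gact (qeStabMk z) t = T.act t l ∧
      spinRIncl 3 m l = spinRMk 3 (m + 1) (spSpLift b z, sp1ToSpin z.1.2) := by
  obtain ⟨t, ht⟩ := T.exists_Φ_eq hm F
  obtain ⟨σ, hσ⟩ := T.exists_isotropyHom t (x := qeSphere i₀) (by rw [← T.base_Φ, ht, hF])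
  obtain ⟨ν, hν, hνs⟩ := exists_lift_isotropyHom (by norm_num) hσ hb0 (by rwa [ht])
  obtain ⟨R, hR⟩ := exists_eq_conj_sp1ToSpin hk hνs (lift_isotropyHom_diagStab_neg_one hk hν)
  -- Moving the point by [1, R] leaves the frame unchanged, since λ of it is 1, and conjugates ν by
  -- R.
  refine ⟨T.act t (spinRMk 3 m (1, R)), SphereFrame.ext' ?_ fun i => ?_, fun z =>
    ⟨(spinRMk 3 m (1, R))⁻¹ * σ (qeStabMk z) * spinRMk 3 m (1, R), ?_, ?_⟩⟩
  · rw [T.base_Φ, T.proj_act, ← T.base_Φ, ht]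
  · rw [T.Φ_act, spinRCover_mk, map_one, ht]
    simp [Matrix.one_apply]
  · rw [T.gact_act, hσ, ← T.act_mul, ← T.act_mul]
    congr 1
    group
  · rw [map_mul, map_mul, hν, map_inv, spinRIncl_mk, ← map_inv, ← map_mul, ← map_mul, hR]
    congr 1
    refine Prod.ext ?_ ?_
    · change (inclSpin m 1)⁻¹ * spSpLift b z.1 * inclSpin m 1 = spSpLift b z.1
      rw [map_one]; group
    · change R⁻¹ * (R * sp1ToSpin z.1.2 * R⁻¹) * R = sp1ToSpin z.1.2
      group

end Normalize

/-! ### Sections of the action -/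

/-- Quaternionic conjugation as a real linear map. -/
def conjLin : ℍ[ℝ] →ₗ[ℝ] ℍ[ℝ] where
  toFun := star
  map_add' := star_add
  map_smul' c x := Quaternion.star_smul c x

lemma linSmoothAt_inv_quat {F : Type*} [NormedAddCommGroup F] [NormedSpace ℝ F] {x : F → ℍ[ℝ]}
    {t : F} (hx : LinSmoothAt x t) (h : x t ≠ 0) : LinSmoothAt (fun s => (x s)⁻¹) t := by
  have h1 : ∀ s, (x s)⁻¹ = (‖x s‖ ^ 2)⁻¹ • star (x s) := fun s => by
    rw [sq, ← Quaternion.normSq_eq_norm_mul_self]; rfl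
  simp only [h1]
  have h2 := linSmoothAt_iff_contDiffAt.1 hx
  refine LinSmoothAt.smul ((h2.norm_sq ℝ).inv (by simpa using h)) ?_
  exact hx.linear conjLin

lemma linSmoothAt_householder {F : Type*} [NormedAddCommGroup F] [NormedSpace ℝ F]
    {v : QuatSpace k} (hv : ‖v‖ = 1) {w : F → QuatSpace k} (hw : ∀ s, ‖w s‖ = 1) {t : F}
    (h : ContDiffAt ℝ ∞ w t) (hne : v ≠ w t) :
    LinSmoothAt (fun s => (householder v (w s) hv (hw s)).1) t := by
  let D : Fin k → QuatSpace k →ₗ[ℝ] ℍ[ℝ] := fun i =>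
    { toFun := fun u => u i, map_add' := fun _ _ => rfl, map_smul' := fun _ _ => rfl }
  have hd : LinSmoothAt (fun s => v - w s) t :=
    (linSmoothAt_const _ _).sub (linSmoothAt_iff_contDiffAt.2 h)
  have hdi : ∀ i, LinSmoothAt (fun s => (v - w s) i) t := fun i => hd.linear (D i)
  have hst : ∀ i, LinSmoothAt (fun s => star ((v - w s) i)) t := fun i =>
    (hdi i).linear conjLin
  have hh : LinSmoothAt (fun s => herm (v - w s) v) t :=
    LinSmoothAt.sum fun i _ => (hst i).mul (linSmoothAt_const _ _)
  have hi := (linSmoothAt_inv_quat hh (herm_sub_self_ne_zero hv (hw t) hne)).neg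
  refine linSmoothAt_matrix fun i j => ?_
  exact (linSmoothAt_const _ t).add (((hdi i).mul hi).mul (hst j))

lemma norm_coe_sphere (y : Metric.sphere (0 : QuatSpace k) 1) : ‖(y : QuatSpace k)‖ = 1 :=
  mem_sphere_zero_iff_norm.1 y.2

lemma dSmooth_householder {v : QuatSpace k} (hv : ‖v‖ = 1) (B : Sp k) :
    DSmooth fun u : {u : Metric.sphere (0 : QuatSpace k) 1 // v ≠ u} =>
      householder v u.1 hv (norm_coe_sphere u.1) * B := by
  intro n p hp
  refine isPlot_subtype_iff.2 (isPlot_iff_linSmoothAt.2 fun t => ?_)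
  exact (linSmoothAt_householder hv (fun s => norm_coe_sphere (p s).1)
    (linSmoothAt_iff_contDiffAt.1 (isPlot_iff_linSmoothAt.1
      (isPlot_subtype_iff.1 (isPlot_subtype_iff.1 hp)) t)) (p t).2).mul (linSmoothAt_const B.1 t)

/-- The inclusion of `Sp(k)` in `Sp(k)·Sp(1)`. -/
def spToSpSp (k : ℕ) : Sp k →* SpSp k := (QuotientGroup.mk' (spSpCenter k)).comp (MonoidHom.inl _ _)

lemma dSmooth_spToSpSp : DSmooth (spToSpSp k) :=
  (dSmooth_quotientMk (spSpCenter k)).comp (dSmooth_id.prodMk dSmooth_const)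

lemma spSpRep_spToSpSp (A : Sp k) (v : QuatSpace k) : spSpRep k (spToSpSp k A) v = spAct A v := by
  change spSpIsometry (A, 1) v = _
  rw [spSpIsometry_eq]
  change rmul (star (1 : ℍ[ℝ])) _ = _
  rw [star_one, rmul_one]

lemma dSmooth_sectionSpSp (x₀ : Metric.sphere (0 : QuatSpace k) 1) {y : QuatSpace k} (hy : ‖y‖ = 1) :
    DSmooth fun u : {u : Metric.sphere (0 : QuatSpace k) 1 // y ≠ u} =>
      spToSpSp k (householder y u.1 hy (norm_coe_sphere u.1) *
        householder x₀.1 y (norm_coe_sphere x₀) hy) :=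
  dSmooth_spToSpSp.comp (dSmooth_householder hy _)

lemma spSpRep_sectionSpSp (x₀ u : Metric.sphere (0 : QuatSpace k) 1) {y : QuatSpace k} (hy : ‖y‖ = 1) :
    spSpRep k (spToSpSp k (householder y u.1 hy (norm_coe_sphere u) *
        householder x₀.1 y (norm_coe_sphere x₀) hy)) x₀ = u := by
  rw [spSpRep_spToSpSp, map_mul]
  rw [LinearIsometryEquiv.coe_mul, Function.comp_apply]
  rw [spAct_householder, spAct_householder]

lemma exists_section_spSp_of_ne (x₀ x : Metric.sphere (0 : QuatSpace k) 1) {y : QuatSpace k} (hy : ‖y‖ = 1)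
    (hne : y ≠ x) :
    ∃ U : Set (Metric.sphere (0 : QuatSpace k) 1), IsOpen U ∧ x ∈ U ∧
      ∃ s : U → SpSp k, DSmooth s ∧ ∀ u, spSpRep k (s u) x₀ = u :=
  ⟨{u | y ≠ u}, isOpen_ne_fun continuous_const continuous_subtype_val, hne,
    fun u => spToSpSp k (householder y u.1 hy (norm_coe_sphere u.1) *
      householder x₀.1 y (norm_coe_sphere x₀) hy), dSmooth_sectionSpSp x₀ hy, fun u => spSpRep_sectionSpSp x₀ u.1 hy⟩

/-- The orbit map of `Sp(k)·Sp(1)` on the unit sphere has smooth local sections. -/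
lemma exists_section_spSp (x₀ x : Metric.sphere (0 : QuatSpace k) 1) :
    ∃ U : Set (Metric.sphere (0 : QuatSpace k) 1), IsOpen U ∧ x ∈ U ∧
      ∃ s : U → SpSp k, DSmooth s ∧ ∀ u, spSpRep k (s u) x₀ = u := by
  -- The section goes from x₀ to y and from y to u by quaternionic reflections; it is singular only
  -- at u = y, so y is taken antipodal to x.
  refine exists_section_spSp_of_ne x₀ x (y := -x.1) (by rw [norm_neg, norm_coe_sphere]) fun h => ?_
  have h1 : (x : QuatSpace k) = 0 := by
    rw [neg_eq_iff_add_eq_zero, ← two_smul ℝ] at h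
    exact (smul_eq_zero.1 h).resolve_left two_ne_zero
  have h2 := norm_coe_sphere x
  rw [h1, norm_zero] at h2
  exact zero_ne_one h2

/-- Invariant spin^ℍ structures on `S⁸ⁿ⁺³` are unique. -/
lemma equivalent_of_odd (hk : m + 1 = 4 * k) (hko : Odd k)
    {o : Orientation ℝ (QuatSpace k) (Fin (m + 1))}
    (S T : InvariantSpinRStructure o (spSpRep k) 3) : S.Equivalent T := by
  have hm : 0 < m := by have := hko.pos; omega
  let i₀ : Fin k := ⟨0, hko.pos⟩
  obtain ⟨F, b, hF, hb0, hb⟩ := exists_basis_of_frame (o := o) hk (qeSphere i₀) hm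
  obtain ⟨p₀, hp₀, hp⟩ := exists_normalized hm hko S hF hb0 hb
  obtain ⟨t₀, ht₀, ht⟩ := exists_normalized hm hko T hF hb0 hb
  refine S.equivalent_of_isotropyHom T (x₀ := qeSphere i₀) (by rw [← S.base_Φ, hp₀, hF])
    (hp₀.trans ht₀.symm) (fun h => ?_) (exists_section_spSp _)
  -- Both normalized isotropy homomorphisms have the same image in Spin³(m + 1), and Spin³(m) embeds
  -- there, so they coincide.
  obtain ⟨z, hz⟩ := QuotientGroup.mk_surjective h.1
  have hzm : z ∈ qeStab i₀ := by
    change (z : SpSp k) ∈ isotropy _ _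
    rw [hz]
    exact h.2
  have hh : qeStabMk ⟨z, hzm⟩ = h := Subtype.ext hz
  obtain ⟨l, hl, hl'⟩ := hp ⟨z, hzm⟩
  obtain ⟨l₂, hl₂, hl₂'⟩ := ht ⟨z, hzm⟩
  rw [hh] at hl hl₂
  rw [spinRIncl_injective (hl₂'.trans hl'.symm)] at hl₂
  exact ⟨l, hl, hl₂⟩

lemma exists_even_structure (hk : m + 1 = 4 * k) (hm : 0 < m) (hke : Even k)
    (o : Orientation ℝ (QuatSpace k) (Fin (m + 1))) :
    Nonempty (InvariantSpinRStructure o (spSpRep k) 1) := by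
  obtain ⟨b, hb⟩ := exists_oriented_basis hk o
  -- For even `k` the trivial κ satisfies κ(-1) = 1 = (-1)ᵏ, so no auxiliary bundle is needed.
  exact ⟨spSpStructure b hb hm 1 (by rw [hke.neg_one_pow]; rfl) dSmooth_const⟩

lemma exists_odd_structure (hk : m + 1 = 4 * k) (hko : Odd k)
    (o : Orientation ℝ (QuatSpace k) (Fin (m + 1))) :
    ∃ S : InvariantSpinRStructure o (spSpRep k) 3, ∀ x, S.CorrespondsTo x
      ((spSpAux k).comp (isotropy (spSpRep k) x).subtype) := by
  have hm : 0 < m := by have := hko.pos; omega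
  obtain ⟨b, hb⟩ := exists_oriented_basis hk o
  exact ⟨_, spSpStructure_correspondsTo b hb hm hko⟩

lemma hasInvariantSpinType_odd (hk : m + 1 = 4 * k) (hko : Odd k)
    (o : Orientation ℝ (QuatSpace k) (Fin (m + 1))) :
    HasInvariantSpinType o (spSpRep k) 3 := by
  refine ⟨⟨by norm_num, ⟨(exists_odd_structure hk hko o).choose⟩⟩, ?_⟩
  rintro r ⟨hr, ⟨T⟩⟩
  by_contra hlt
  exact (isEmpty_of_le_two hk hko hr (by omega) o).false T

end Nu

end SphereSpin

end

theorem mainTheorem6 :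
    -- the spin type of `S^{8n+3}`
    (∀ (n : ℕ) (o : Orientation ℝ (SphereSpin.QuatSpace (2 * n + 1)) (Fin (8 * n + 3 + 1))),
      SphereSpin.HasInvariantSpinType o (SphereSpin.spSpRep (2 * n + 1)) 3) ∧
    -- the spin type of `S^{4n+3}`
    (∀ (n : ℕ) (o : Orientation ℝ (SphereSpin.QuatSpace (n + 1)) (Fin (4 * n + 3 + 1))),
      SphereSpin.HasInvariantSpinType o (SphereSpin.spSpRep (n + 1)) (if Odd n then 1 else 3)) ∧
    -- the invariant spin^ℍ structures on `S^{8n+3}`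
    (∀ (n : ℕ) (o : Orientation ℝ (SphereSpin.QuatSpace (2 * n + 1)) (Fin (8 * n + 3 + 1))),
      ∃ S : SphereSpin.InvariantSpinRStructure o (SphereSpin.spSpRep (2 * n + 1)) 3,
        (∀ x, S.CorrespondsTo x ((SphereSpin.spSpAux (2 * n + 1)).comp
          (SphereSpin.isotropy (SphereSpin.spSpRep (2 * n + 1)) x).subtype)) ∧
        ∀ T : SphereSpin.InvariantSpinRStructure o (SphereSpin.spSpRep (2 * n + 1)) 3,
          S.Equivalent T) := by
  refine ⟨fun n o => SphereSpin.hasInvariantSpinType_odd (by omega) ⟨n, rfl⟩ o, fun n o => ?_,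
    fun n o => ?_⟩
  · split_ifs with h
    · exact ⟨⟨le_rfl, SphereSpin.exists_even_structure (by omega) (by omega) h.add_one o⟩,
        fun r hr => hr.1⟩
    · exact SphereSpin.hasInvariantSpinType_odd (by omega)
        (Nat.not_odd_iff_even.1 h).add_one o
  · obtain ⟨S, hS⟩ := SphereSpin.exists_odd_structure (k := 2 * n + 1) (by omega) ⟨n, rfl⟩ o
    exact ⟨S, hS, fun T => SphereSpin.equivalent_of_odd (by omega) ⟨n, rfl⟩ S T⟩
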